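/- **Theorem (the commutative hexagon).** Let $k$ be a field of characteristic $0$. Consider the following Hopf algebras over $k$. * $\mathrm{QSym}\supset\mathrm{Sym}$: the quasi-symmetric and symmetric formal power series of bounded degree in $x_1,x_2,\dots$, with linear bases the monomial quasi-symmetric functions $M_I$ ($I$ a composition) and the monomial symmetric functions $m_\lambda$ ($\lambda$ a partition), and coproducts $\Delta(M_K)=\sum_{I\sqcup J=K}M_I\otimes M_J$ (juxtaposition) and $\Delta(m_\lambda)=\sum_{\mu\cup\nu=\lambda}m_\mu\otimes m_\nu$. Put $e_n=m_{(1^n)}$ and $e_\lambda=e_{\lambda_1}e_{\lambda_2}\cdots$; $\mathrm{Sym}$ carries the inner product with $(e_\lambda,m_\mu)=\delta_{\lambda,\mu}$. * $\mathrm{NSym}=k\langle E_1,E_2,\dots\rangle$ with $\Delta(E_n)=\sum_{i+j=n}E_i\otimes E_j$ ($E_0=1$), paired with $\mathrm{QSym}$ by $\langle E_{i_1}\cdots E_{i_l},M_J\rangle=\delta_{(i_1,\dots,i_l),J}$. * $\mathcal H_K$, the polynomial algebra on (isomorphism classes of finite) rooted trees, and $\mathcal H_F$, the free associative algebra on planar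 rooted trees, each with the multiplicative coproduct determined by $\Delta(t)=t\otimes 1+(\mathrm{id}\otimes B_+)\Delta(B_-(t))$ on trees $t$. Here $B_+$ turns a forest (ordered in the planar case) into a tree by adding a root, and $B_-$ is its inverse. * $k\mathcal T$, the vector space on rooted trees, with the Grossman–Larson product ($t\circ t'$ is the sum of the trees obtained by attaching each branch of $t=B_+(t_1\cdots t_n)$ to some vertex of $t'$; unit $\bullet$) and the coproduct $\Delta B_+(t_1\cdots t_n)=\sum_{I\sqcup J=\{1,\dots,n\}}B_+(t(I))\otimes B_+(t(J))$, where $t(I)=\prod_{i\in I}t_i$. It is paired with $\mathcal H_K$ by $\langle t,u\rangle=(t,B_+(u))$, where $(t,t')=|\mathrm{Sym}(t)|\,\delta_{t,t'}$ and $\mathrm{Sym}(t)$ is the automorphism group of $t$. * $k\mathcal P$, the vector space on planar rooted trees, with $T\circ T'$ the sum of the planar trees obtained by attaching the branches of $T$, in order, to the naturally (weakly) ordered attachment points of $T'$ ($2m-1$ points if $T'$ has $m$ vertices), and $\Delta B_+(T_1\cdots T_n)=\sum_{i=0}^nB_+(T_1\cdots T_i)\otimes B_+(T_{i+1}\cdots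 T_n)$. It is paired with $\mathcal H_F$ by $\langle T,u\rangle=(T,B_+(u))$, where $(T,T')=\delta_{T,T'}$. (All counits are the projections onto degree $0$.) Let $\ell_n=B_+^{\,n-1}(\bullet)$ be the ladder with $n$ vertices, let $\kappa_n=\sum_t t/|\mathrm{Sym}(t)|\in k\mathcal T$, summed over the rooted trees with $n+1$ vertices, and define $\varepsilon_0=\bullet$ and $$\varepsilon_n=\kappa_1\circ\varepsilon_{n-1}-\kappa_2\circ\varepsilon_{n-2}+\dots+(-1)^{n-1}\kappa_n\qquad(n\ge1).$$ There are unique homomorphisms of unital algebras $$\Phi:\mathrm{NSym}\to\mathcal H_F,\quad \rho:\mathcal H_F\to\mathcal H_K,\quad \tau:\mathrm{NSym}\to\mathrm{Sym},\quad \phi:\mathrm{Sym}\to\mathcal H_K,\quad Z:\mathrm{NSym}\to k\mathcal T$$ such that $\Phi(E_n)=\ell_n$, $\rho$ sends each planar rooted tree to the underlying rooted tree, $\tau(E_n)=e_n$, $\phi(e_n)=\ell_n$ and $Z(E_n)=\varepsilon_n$ for all $n\ge1$. There are also unique dual (adjoint) linear maps with respect to the above pairings and inner product, $$\Phi^*:k\mathcal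 P\to\mathrm{QSym},\quad \rho^*:k\mathcal T\to k\mathcal P,\quad \tau^*:\mathrm{Sym}\to\mathrm{QSym},\quad \phi^*:k\mathcal T\to\mathrm{Sym},\quad Z^*:\mathcal H_K\to\mathrm{QSym}.$$ All ten maps are homomorphisms of Hopf algebras (they preserve units, products, counits and coproducts), and they form a commutative hexagon: $$\rho\Phi=\phi\tau,\qquad \Phi^*\rho^*=\tau^*\phi^*,\qquad \phi^*Z=\tau,\qquad Z^*\phi=\tau^*,$$ and consequently $Z^*\rho\Phi=\Phi^*\rho^*Z$. -/

import Mathlib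

open scoped TensorProduct

noncomputable section

namespace CommHexagon

/-! ## Bialgebra operations and their homomorphisms -/

/-- The four operations of a bialgebra on a `k`-module `A`.  It is only used for the seven explicit
Hopf algebras constructed below. -/
structure HopfOps (k A : Type*) [Field k] [AddCommGroup A] [Module k A] where
  one : A
  mul : A →ₗ[k] A →ₗ[k] A
  counit : A →ₗ[k] k
  comul : A →ₗ[k] A ⊗[k] A

/-- The operations on a `k`-algebra with given counit and coproduct. -/
def HopfOps.ofAlgebra {k A : Type*} [Field k] [Ring A] [Algebra k A]
    (counit : A →ₗ[k] k) (comul : A →ₗ[k] A ⊗[k] A) : HopfOps k A where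
  one := 1
  mul := LinearMap.mul k A
  counit := counit
  comul := comul

/-- Homomorphism of unital algebras. -/
structure IsAlgHom {k A B : Type*} [Field k] [AddCommGroup A] [Module k A] [AddCommGroup B]
    [Module k B] (opA : HopfOps k A) (opB : HopfOps k B) (f : A →ₗ[k] B) : Prop where
  map_one : f opA.one = opB.one
  map_mul : ∀ a b, f (opA.mul a b) = opB.mul (f a) (f b)

/-- Homomorphism of Hopf algebras: a map of unital algebras and of counital coalgebras
(such a map between Hopf algebras automatically commutes with the antipodes). -/
structure IsHopfHom {k A B : Type*} [Field k] [AddCommGroup A] [Module k A] [AddCommGroup B]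
    [Module k B] (opA : HopfOps k A) (opB : HopfOps k B) (f : A →ₗ[k] B) : Prop
    extends IsAlgHom opA opB f where
  map_counit : ∀ a, opB.counit (f a) = opA.counit a
  map_comul : ∀ a, opB.comul (f a) = TensorProduct.map f f (opA.comul a)

/-! ## Symmetric and quasi-symmetric functions -/

section Series

variable {k : Type*} [Field k]

/-- The exponent vector of the monomial `x_{n_1}^{i_1} ⋯ x_{n_l}^{i_l}`; the variables are
indexed by `ℕ` instead of the positive integers. -/
def expVec {l : ℕ} (n i : Fin l → ℕ) : ℕ →₀ ℕ := ∑ j, Finsupp.single (n j) (i j)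

/-- Formal power series in `x_0, x_1, …` of bounded degree. -/
def BoundedDegree (f : MvPowerSeries ℕ k) : Prop :=
  ∃ d : ℕ, ∀ m : ℕ →₀ ℕ, MvPowerSeries.coeff m f ≠ 0 → m.degree ≤ d

/-- The coefficients of `x_{n_1}^{i_1} ⋯ x_{n_l}^{i_l}` and of `x_1^{i_1} ⋯ x_l^{i_l}` agree,
for every sequence of exponents. -/
def CoeffInvariant {l : ℕ} (n : Fin l → ℕ) (f : MvPowerSeries ℕ k) : Prop :=
  ∀ i : Fin l → ℕ,
    MvPowerSeries.coeff (expVec n i) f = MvPowerSeries.coeff (expVec (fun j => (j : ℕ)) i) f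

theorem expVec_eq_embDomain {l : ℕ} (n : Fin l ↪ ℕ) (i : Fin l → ℕ) :
    expVec n i = Finsupp.embDomain n (Finsupp.equivFunOnFinite.symm i) := by
  classical
  rw [Finsupp.embDomain_eq_mapDomain, Finsupp.mapDomain,
    Finsupp.sum_fintype _ _ (fun _ => Finsupp.single_zero _)]
  rfl

theorem boundedDegree_algebraMap (c : k) :
    BoundedDegree (algebraMap k (MvPowerSeries ℕ k) c) := by
  classical
  refine ⟨0, fun m hm => ?_⟩
  rw [MvPowerSeries.algebraMap_apply, MvPowerSeries.coeff_C] at hm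
  have : m = 0 := by
    by_contra h
    simp [h] at hm
  simp [this]

theorem BoundedDegree.add {f g : MvPowerSeries ℕ k} (hf : BoundedDegree f)
    (hg : BoundedDegree g) : BoundedDegree (f + g) := by
  obtain ⟨a, ha⟩ := hf
  obtain ⟨b, hb⟩ := hg
  refine ⟨max a b, fun m hm => ?_⟩
  rw [map_add] at hm
  by_cases h : MvPowerSeries.coeff m f = 0
  · rw [h, zero_add] at hm
    exact (hb m hm).trans (le_max_right _ _)
  · exact (ha m h).trans (le_max_left _ _)

theorem BoundedDegree.mul {f g : MvPowerSeries ℕ k} (hf : BoundedDegree f)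
    (hg : BoundedDegree g) : BoundedDegree (f * g) := by
  classical
  obtain ⟨a, ha⟩ := hf
  obtain ⟨b, hb⟩ := hg
  refine ⟨a + b, fun m hm => ?_⟩
  rw [MvPowerSeries.coeff_mul] at hm
  obtain ⟨p, hp, hne⟩ := Finset.exists_ne_zero_of_sum_ne_zero hm
  rw [← Finset.HasAntidiagonal.mem_antidiagonal.1 hp, map_add]
  exact add_le_add (ha _ (left_ne_zero_of_mul hne)) (hb _ (right_ne_zero_of_mul hne))

theorem coeffInvariant_algebraMap {l : ℕ} (n : Fin l ↪ ℕ) (c : k) :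
    CoeffInvariant n (algebraMap k (MvPowerSeries ℕ k) c) := by
  classical
  intro i
  have h := expVec_eq_embDomain Fin.valEmbedding i
  change expVec (fun j => (j : ℕ)) i = _ at h
  rw [MvPowerSeries.algebraMap_apply, MvPowerSeries.coeff_C, MvPowerSeries.coeff_C,
    expVec_eq_embDomain, h]
  simp only [Finsupp.embDomain_eq_zero]

theorem CoeffInvariant.add {l : ℕ} {n : Fin l → ℕ} {f g : MvPowerSeries ℕ k}
    (hf : CoeffInvariant n f) (hg : CoeffInvariant n g) : CoeffInvariant n (f + g) := by
  intro i
  rw [map_add, map_add, hf, hg]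

theorem CoeffInvariant.mul {l : ℕ} {n : Fin l ↪ ℕ} {f g : MvPowerSeries ℕ k}
    (hf : CoeffInvariant n f) (hg : CoeffInvariant n g) : CoeffInvariant n (f * g) := by
  classical
  have key : ∀ e : Fin l ↪ ℕ, ∀ i : Fin l → ℕ, MvPowerSeries.coeff (expVec e i) (f * g) =
      ∑ p ∈ Finset.HasAntidiagonal.antidiagonal (Finsupp.equivFunOnFinite.symm i),
        MvPowerSeries.coeff (expVec e p.1) f * MvPowerSeries.coeff (expVec e p.2) g := by
    intro e i
    rw [MvPowerSeries.coeff_mul, expVec_eq_embDomain,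
      ← Finsupp.image_prodMap_embDomain_antidiagonal, Finset.sum_image]
    · refine Finset.sum_congr rfl fun p _ => ?_
      rw [expVec_eq_embDomain, expVec_eq_embDomain, Finsupp.equivFunOnFinite_symm_coe,
        Finsupp.equivFunOnFinite_symm_coe]
      rfl
    · exact (Function.Injective.prodMap (Finsupp.embDomain_injective e)
        (Finsupp.embDomain_injective e)).injOn
  intro i
  refine (key n i).trans (Eq.trans ?_ (key Fin.valEmbedding i).symm)
  exact Finset.sum_congr rfl fun p _ => by rw [hf, hg]; rfl

variable (k)

/-- The algebra of symmetric functions. -/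
def SymF : Subalgebra k (MvPowerSeries ℕ k) where
  carrier := {f | BoundedDegree f ∧
    ∀ (l : ℕ) (n : Fin l → ℕ), Function.Injective n → CoeffInvariant n f}
  algebraMap_mem' c := ⟨boundedDegree_algebraMap c,
    fun _ n hn => coeffInvariant_algebraMap ⟨n, hn⟩ c⟩
  add_mem' hf hg := ⟨hf.1.add hg.1, fun l n hn => (hf.2 l n hn).add (hg.2 l n hn)⟩
  mul_mem' hf hg := ⟨hf.1.mul hg.1,
    fun l n hn => CoeffInvariant.mul (n := ⟨n, hn⟩) (hf.2 l n hn) (hg.2 l n hn)⟩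

/-- The algebra of quasi-symmetric functions. -/
def QSymF : Subalgebra k (MvPowerSeries ℕ k) where
  carrier := {f | BoundedDegree f ∧
    ∀ (l : ℕ) (n : Fin l → ℕ), StrictMono n → CoeffInvariant n f}
  algebraMap_mem' c := ⟨boundedDegree_algebraMap c,
    fun _ n hn => coeffInvariant_algebraMap ⟨n, hn.injective⟩ c⟩
  add_mem' hf hg := ⟨hf.1.add hg.1, fun l n hn => (hf.2 l n hn).add (hg.2 l n hn)⟩
  mul_mem' hf hg := ⟨hf.1.mul hg.1,
    fun l n hn => CoeffInvariant.mul (n := ⟨n, hn.injective⟩) (hf.2 l n hn) (hg.2 l n hn)⟩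

variable {k}

/-- The exponents of a monomial, listed in increasing order of the variables that occur. -/
def expList (m : ℕ →₀ ℕ) : List ℕ := m.support.sort.map m

theorem expList_embDomain {l : ℕ} (n : Fin l ↪ ℕ) (hn : StrictMono n) (i : Fin l →₀ ℕ) :
    expList (Finsupp.embDomain n i) = i.support.sort.map i := by
  rw [expList, Finsupp.support_embDomain, ← StrictMonoOn.map_finsetSort n i.support (hn.strictMonoOn _),
    List.map_map]
  exact List.map_congr_left fun j _ => Finsupp.embDomain_apply_self n i j

theorem expMultiset_embDomain {l : ℕ} (n : Fin l ↪ ℕ) (i : Fin l →₀ ℕ) :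
    (Finsupp.embDomain n i).support.val.map (Finsupp.embDomain n i) = i.support.val.map i := by
  rw [Finsupp.support_embDomain, Finset.map_val, Multiset.map_map]
  exact Multiset.map_congr rfl fun j _ => Finsupp.embDomain_apply_self n i j

theorem sum_expMultiset (m : ℕ →₀ ℕ) : (m.support.val.map m).sum = m.degree := rfl

theorem sum_expList (m : ℕ →₀ ℕ) : (expList m).sum = m.degree := by
  rw [← sum_expMultiset, ← Finset.sort_eq m.support (· ≤ ·), Multiset.map_coe, Multiset.sum_coe]
  rfl

variable (k)

/-- The monomial quasi-symmetric function `M_I` of a composition `I`: the sum of all monomials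
`x_{n_1}^{i_1} ⋯ x_{n_l}^{i_l}` with `n_1 < ⋯ < n_l`. -/
def monoQSym (I : List ℕ+) : QSymF k :=
  ⟨fun m => if expList m = I.map PNat.val then 1 else 0, by
    refine ⟨⟨(I.map PNat.val).sum, fun m hm => ?_⟩, fun l n hn i => ?_⟩
    · by_cases h : expList m = I.map PNat.val
      · rw [← h, sum_expList]
      · exact absurd (if_neg h) hm
    · have h0 := expVec_eq_embDomain Fin.valEmbedding i
      have h1 := expVec_eq_embDomain ⟨n, hn.injective⟩ i
      change expVec (fun j => (j : ℕ)) i = _ at h0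
      change expVec n i = _ at h1
      have e : expList (Finsupp.embDomain ⟨n, hn.injective⟩ (Finsupp.equivFunOnFinite.symm i)) =
          expList (Finsupp.embDomain Fin.valEmbedding (Finsupp.equivFunOnFinite.symm i)) := by
        rw [expList_embDomain _ hn, expList_embDomain _ Fin.val_strictMono]
      change (if expList (expVec n i) = _ then (1 : k) else 0) =
        if expList (expVec (fun j => (j : ℕ)) i) = _ then 1 else 0
      rw [h0, h1, e]⟩

/-- The monomial symmetric function `m_λ` of a partition `λ` (a multiset of positive integers):
the sum of all monomials whose multiset of exponents is `λ`. -/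
def monoSym (p : Multiset ℕ+) : SymF k :=
  ⟨fun m => if m.support.val.map m = p.map PNat.val then 1 else 0, by
    refine ⟨⟨(p.map PNat.val).sum, fun m hm => ?_⟩, fun l n hn i => ?_⟩
    · by_cases h : m.support.val.map m = p.map PNat.val
      · rw [← h, sum_expMultiset]
      · exact absurd (if_neg h) hm
    · have h0 := expVec_eq_embDomain Fin.valEmbedding i
      have h1 := expVec_eq_embDomain ⟨n, hn⟩ i
      change expVec (fun j => (j : ℕ)) i = _ at h0
      change expVec n i = _ at h1
      change (if (expVec n i).support.val.map (expVec n i) = _ then (1 : k) else 0) =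
        if (expVec (fun j => (j : ℕ)) i).support.val.map (expVec (fun j => (j : ℕ)) i) = _
          then 1 else 0
      rw [h0, h1, expMultiset_embDomain, expMultiset_embDomain]⟩

/-- The elementary symmetric function `e_n = m_{(1,…,1)}`. -/
def elemSym (n : ℕ+) : SymF k := monoSym k (Multiset.replicate n 1)

/-- `e_λ = e_{λ_1} e_{λ_2} ⋯`. -/
def elemSymProd (p : Multiset ℕ+) : SymF k := (p.map (elemSym k)).prod

variable {k}

/-- The coefficient of `x_1^{i_1} ⋯ x_l^{i_l}`, where `I = (i_1, …, i_l)`. -/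
def compCoeff (I : List ℕ+) : MvPowerSeries ℕ k →ₗ[k] k :=
  MvPowerSeries.coeff (expVec (fun j : Fin I.length => (j : ℕ)) (fun j => (I.get j : ℕ)))

theorem finite_sum_le (d : ℕ) : {I : List ℕ+ | (I.map PNat.val).sum ≤ d}.Finite := by
  have h := (List.finite_length_le (Fin (d + 1)) d).image (List.map fun a : Fin (d + 1) => Nat.toPNat' (a : ℕ))
  refine h.subset fun I hI => ?_
  have hI' : (I.map PNat.val).sum ≤ d := hI
  have hle : ∀ a ∈ I, (a : ℕ) < d + 1 := fun a ha =>
    Nat.lt_succ_of_le ((List.le_sum_of_mem (List.mem_map_of_mem ha)).trans hI')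
  refine ⟨I.map (fun a : ℕ+ => Fin.ofNat (d + 1) (a : ℕ)), ?_, ?_⟩
  · rw [Set.mem_ofPred_eq, List.length_map]
    refine le_trans ?_ hI'
    have := List.card_nsmul_le_sum (I.map PNat.val) 1 (by
      intro x hx
      obtain ⟨a, -, rfl⟩ := List.mem_map.1 hx
      exact a.pos)
    simpa using this
  · rw [List.map_map]
    conv_rhs => rw [← List.map_id I]
    refine List.map_congr_left fun a ha => ?_
    simp [Fin.ofNat, Nat.mod_eq_of_lt (hle a ha)]

theorem degree_expVec {l : ℕ} (n i : Fin l → ℕ) : (expVec n i).degree = ∑ j, i j := by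
  simp [expVec, map_sum]

theorem finite_compCoeff {f : MvPowerSeries ℕ k} (hf : BoundedDegree f) :
    {I : List ℕ+ | compCoeff I f ≠ 0}.Finite := by
  obtain ⟨d, hd⟩ := hf
  refine (finite_sum_le d).subset fun I hI => ?_
  have h := hd _ hI
  rw [degree_expVec] at h
  refine le_trans (le_of_eq ?_) h
  conv_lhs => rw [← List.ofFn_get I, List.map_ofFn, List.sum_ofFn]
  rfl

variable (k)

/-- The coordinates of a quasi-symmetric function in the basis `M_I`. -/
def qsymCoords : QSymF k →ₗ[k] (List ℕ+ →₀ k) where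
  toFun f := Finsupp.ofSupportFinite (fun I => compCoeff I (f : MvPowerSeries ℕ k))
    (finite_compCoeff f.2.1)
  map_add' f g := by
    ext I
    exact map_add (compCoeff I) (f : MvPowerSeries ℕ k) g
  map_smul' c f := by
    ext I
    exact map_smul (compCoeff I) c (f : MvPowerSeries ℕ k)

/-- The coordinates of a symmetric function in the basis `m_λ`: the coordinate at `λ` is the
coefficient of `x_1^{λ_1} x_2^{λ_2} ⋯`, for an arbitrary ordering of the parts of `λ`. -/
def symCoords : SymF k →ₗ[k] (Multiset ℕ+ →₀ k) where
  toFun f := Finsupp.ofSupportFinite (fun p => compCoeff p.toList (f : MvPowerSeries ℕ k))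
    ((finite_compCoeff f.2.1).preimage
      (Function.LeftInverse.injective (g := fun I : List ℕ+ => (I : Multiset ℕ+))
        Multiset.coe_toList).injOn)
  map_add' f g := by
    ext p
    exact map_add (compCoeff p.toList) (f : MvPowerSeries ℕ k) g
  map_smul' c f := by
    ext p
    exact map_smul (compCoeff p.toList) c (f : MvPowerSeries ℕ k)

/-- `QSym`, with the coproduct `Δ(M_K) = ∑_{I ⊔ J = K} M_I ⊗ M_J`. -/
def opsQSym : HopfOps k (QSymF k) :=
  HopfOps.ofAlgebra
    ((MvPowerSeries.coeff (R := k) (0 : ℕ →₀ ℕ)) ∘ₗ (QSymF k).val.toLinearMap)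
    ((Finsupp.lsum k fun K : List ℕ+ => LinearMap.toSpanSingleton k (QSymF k ⊗[k] QSymF k)
        (∑ a ∈ Finset.range (K.length + 1), monoQSym k (K.take a) ⊗ₜ[k] monoQSym k (K.drop a)))
      ∘ₗ qsymCoords k)

/-- `Sym`, with the coproduct `Δ(m_λ) = ∑_{μ ∪ ν = λ} m_μ ⊗ m_ν`, a sum over all pairs of
multisets `(μ, ν)` with union (counting multiplicities) `λ`. -/
def opsSym : HopfOps k (SymF k) :=
  HopfOps.ofAlgebra
    ((MvPowerSeries.coeff (R := k) (0 : ℕ →₀ ℕ)) ∘ₗ (SymF k).val.toLinearMap)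
    ((Finsupp.lsum k fun p : Multiset ℕ+ => LinearMap.toSpanSingleton k (SymF k ⊗[k] SymF k)
        (∑ q ∈ p.antidiagonal.toFinset, monoSym k q.1 ⊗ₜ[k] monoSym k q.2))
      ∘ₗ symCoords k)

end Series

/-! ## Noncommutative symmetric functions -/

section NSym

variable (k : Type*) [Field k]

/-- `NSym`, as an algebra the noncommutative polynomials in `E_1, E_2, …`. -/
abbrev NSymF : Type _ := FreeAlgebra k ℕ+

/-- `E_0 = 1, E_1, E_2, …` -/
def genE : ℕ → NSymF k
  | 0 => 1
  | n + 1 => FreeAlgebra.ι k n.succPNat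

/-- `NSym`, with the coproduct for which the `E_n` are divided powers. -/
def opsNSym : HopfOps k (NSymF k) :=
  HopfOps.ofAlgebra
    (FreeAlgebra.lift k (fun _ : ℕ+ => (0 : k))).toLinearMap
    (FreeAlgebra.lift k (fun n : ℕ+ =>
      ∑ p ∈ Finset.HasAntidiagonal.antidiagonal (n : ℕ), genE k p.1 ⊗ₜ[k] genE k p.2)).toLinearMap

/-- The pairing of `NSym` with `QSym`: `⟨E_I, f⟩` is the coordinate of `f` at `M_I`, so that
`⟨E_I, M_J⟩ = δ_{I,J}`. -/
def pairNQ : NSymF k →ₗ[k] QSymF k →ₗ[k] k :=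
  (FreeAlgebra.basisFreeMonoid k ℕ+).constr k
    fun I : FreeMonoid ℕ+ => compCoeff I.toList ∘ₗ (QSymF k).val.toLinearMap

end NSym

/-! ## Planar rooted trees and rooted trees -/

/-- Finite planar rooted trees: a root with an ordered sequence of `n` planar rooted trees
attached to it. -/
inductive PTree : Type
  | node (n : ℕ) (c : Fin n → PTree) : PTree

namespace PTree

/-- `B_+` of an ordered forest. -/
def ofList (L : List PTree) : PTree := node L.length L.get

/-- `B_-`, the ordered forest left when the root is deleted. -/
def children : PTree → List PTree
  | node _ c => List.ofFn c

/-- `ladder i` is the ladder `ℓ_{i+1} = B_+^i(•)` with `i + 1` vertices; `ladder 0 = •`. -/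
def ladder : ℕ → PTree
  | 0 => ofList []
  | i + 1 => ofList [ladder i]

/-- The disjoint union of partial orders with a greatest element added. -/
@[reducible] def addTop {n : ℕ} {α : Fin n → Type} (h : ∀ i, PartialOrder (α i)) :
    PartialOrder (WithTop (Σ i, α i)) := inferInstance

/-- The lexicographic sum of the linear orders obtained by adding a least element to each summand,
with a greatest element added. -/
@[reducible] def lexAddTop {n : ℕ} {α : Fin n → Type} (h : ∀ i, LinearOrder (α i)) :
    LinearOrder (WithTop (Σₗ i, WithBot (α i))) := inferInstance

/-- The vertices of a planar rooted tree: the root is added on top of the disjoint union of the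
vertex sets of the branches. -/
def Vert : PTree → Type
  | node n c => WithTop (Σ i : Fin n, Vert (c i))

/-- The partial order on the vertices: the disjoint union of the orders of the branches, with the
root added as greatest element. -/
instance vertOrder : (T : PTree) → PartialOrder T.Vert
  | node _ c => addTop fun i => vertOrder (c i)

instance vertFintype : (T : PTree) → Fintype T.Vert
  | node n c =>
    letI : ∀ i : Fin n, Fintype (c i).Vert := fun i => vertFintype (c i)
    inferInstanceAs (Fintype (Option (Σ i : Fin n, (c i).Vert)))

/-- The number of vertices. -/
def size (T : PTree) : ℕ := Fintype.card T.Vert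

/-- Two planar rooted trees realize the same rooted tree if their vertex posets are isomorphic. -/
instance isoSetoid : Setoid PTree where
  r S T := Nonempty (S.Vert ≃o T.Vert)
  iseqv := ⟨fun _ => ⟨OrderIso.refl _⟩, fun ⟨e⟩ => ⟨e.symm⟩, fun ⟨e⟩ ⟨f⟩ => ⟨e.trans f⟩⟩

/-- The tree obtained from `T` by attaching the roots of the trees in `F v` to the vertex `v`, for
every vertex `v` of `T`. -/
def graft : (T : PTree) → (T.Vert → List PTree) → PTree
  | node n c, F =>
    ofList (F (⊤ : WithTop (Σ i : Fin n, (c i).Vert)) ++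
      List.ofFn fun i : Fin n => graft (c i) fun v =>
        F ((⟨i, v⟩ : Σ i : Fin n, (c i).Vert) : WithTop (Σ i : Fin n, (c i).Vert)))

/-- The attachment points of a planar rooted tree with branches `T_0, …, T_{n-1}`, in their natural
order `a_0 < (points of T_0) < a_1 < (points of T_1) < ⋯ < a_n`, where `a_0, …, a_n` are the
attachment points of the root.  The point `a_i`, `i < n`, is the `⊥` of the `i`th summand, and
`a_n` is `⊤`. -/
def Pt : PTree → Type
  | node n c => WithTop (Σₗ i : Fin n, WithBot (Pt (c i)))

instance ptOrder : (T : PTree) → LinearOrder T.Pt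
  | node _ c => lexAddTop fun i => ptOrder (c i)

instance ptFintype : (T : PTree) → Fintype T.Pt
  | node n c =>
    letI : ∀ i : Fin n, Fintype (c i).Pt := fun i => ptFintype (c i)
    inferInstanceAs (Fintype (Option (Σ i : Fin n, Option (c i).Pt)))

/-- The planar rooted tree obtained from `T` by attaching the ordered forest `F p` at the
attachment point `p`, for every attachment point `p` of `T`. -/
def planarGraft : (T : PTree) → (T.Pt → List PTree) → PTree
  | node n c, F =>
    ofList ((List.ofFn fun i : Fin n =>
        F ((toLex (⟨i, ⊥⟩ : Σ i : Fin n, WithBot (c i).Pt) : Σₗ i : Fin n, WithBot (c i).Pt) :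
          WithTop (Σₗ i : Fin n, WithBot (c i).Pt)) ++
        [planarGraft (c i) fun p =>
          F ((toLex (⟨i, (p : WithBot (c i).Pt)⟩ : Σ i : Fin n, WithBot (c i).Pt) :
            Σₗ i : Fin n, WithBot (c i).Pt) : WithTop (Σₗ i : Fin n, WithBot (c i).Pt))]).flatten ++
      F (⊤ : WithTop (Σₗ i : Fin n, WithBot (c i).Pt)))

end PTree

/-- Rooted trees up to isomorphism. -/
def RTree : Type := Quotient PTree.isoSetoid

namespace RTree

/-- The rooted tree underlying a planar rooted tree. -/
def ofPlanar (T : PTree) : RTree := Quotient.mk _ T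

/-- A planar representative of a rooted tree.  Everything defined through it below is independent
of the choice of the representative. -/
def toPlanar (t : RTree) : PTree := Quotient.out t

/-- `B_+` of a forest, a multiset of rooted trees. -/
def ofMultiset (s : Multiset RTree) : RTree :=
  ofPlanar (PTree.ofList (s.toList.map toPlanar))

/-- `B_-`, the forest left when the root is deleted. -/
def children (t : RTree) : Multiset RTree :=
  ((t.toPlanar.children.map ofPlanar : List RTree) : Multiset RTree)

/-- The tree with one vertex. -/
def bullet : RTree := ofPlanar (PTree.ladder 0)

/-- The number of vertices. -/
def size : RTree → ℕ :=
  Quotient.lift PTree.size fun _ _ ⟨e⟩ => Fintype.card_congr e.toEquiv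

/-- The order of the group of automorphisms of the poset of vertices. -/
def symOrder : RTree → ℕ :=
  Quotient.lift (fun T : PTree => Nat.card (T.Vert ≃o T.Vert)) fun _ _ ⟨e⟩ =>
    Nat.card_congr
      { toFun := fun a => (e.symm.trans a).trans e
        invFun := fun b => (e.trans b).trans e.symm
        left_inv := fun a => by ext v; simp
        right_inv := fun b => by ext v; simp }

end RTree

/-! ## The Hopf algebras of trees -/

section Trees

open Classical in
/-- The sum of the `m ^ n` rooted trees obtained by attaching each of the `n` branches of `t`
to some vertex of `t'`, where `m` is the number of vertices of `t'`. -/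
def glTree (k : Type*) [Field k] (t t' : RTree) : RTree →₀ k :=
  ∑ f : Fin t.toPlanar.children.length → t'.toPlanar.Vert,
    Finsupp.single (RTree.ofPlanar (t'.toPlanar.graft fun v =>
      ((List.finRange _).filter fun i => f i = v).map t.toPlanar.children.get)) 1

open Classical in
/-- The sum of the planar rooted trees obtained by attaching the branches of `T`, in order, to the
attachment points of `T'`. -/
def planarGLTree (k : Type*) [Field k] (T T' : PTree) : PTree →₀ k :=
  ∑ f : Fin T.children.length → T'.Pt with Monotone f,
    Finsupp.single (T'.planarGraft fun p =>
      ((List.finRange _).filter fun i => f i = p).map T.children.get) 1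

variable (k : Type*) [Field k]

/-- The vector space `kT` with basis the rooted trees. -/
abbrev KT : Type _ := RTree →₀ k

/-- The vector space `kP` with basis the planar rooted trees. -/
abbrev KP : Type _ := PTree →₀ k

/-- The Grossman-Larson Hopf algebra `kT`, with `Δ(B_+(t_1 ⋯ t_n))` the sum of all
`B_+(t(I)) ⊗ B_+(t(J))` for `{1, …, n}` the disjoint union of `I` and `J`. -/
def opsKT : HopfOps k (KT k) where
  one := Finsupp.single RTree.bullet 1
  mul := Finsupp.lift (KT k →ₗ[k] KT k) k RTree fun t =>
    Finsupp.lift (KT k) k RTree fun t' => glTree k t t'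
  counit := Finsupp.lapply RTree.bullet
  comul := Finsupp.lift (KT k ⊗[k] KT k) k RTree fun t =>
    (t.children.antidiagonal.map fun p =>
      (Finsupp.single (RTree.ofMultiset p.1) (1 : k) : KT k) ⊗ₜ[k]
        (Finsupp.single (RTree.ofMultiset p.2) (1 : k) : KT k)).sum

/-- The Hopf algebra `kP` of planar rooted trees, with
`Δ(B_+(T_1 ⋯ T_n)) = ∑_{0 ≤ i ≤ n} B_+(T_1 ⋯ T_i) ⊗ B_+(T_{i+1} ⋯ T_n)`. -/
def opsKP : HopfOps k (KP k) where
  one := Finsupp.single (PTree.ladder 0) 1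
  mul := Finsupp.lift (KP k →ₗ[k] KP k) k PTree fun T =>
    Finsupp.lift (KP k) k PTree fun T' => planarGLTree k T T'
  counit := Finsupp.lapply (PTree.ladder 0)
  comul := Finsupp.lift (KP k ⊗[k] KP k) k PTree fun T =>
    ∑ a ∈ Finset.range (T.children.length + 1),
      (Finsupp.single (PTree.ofList (T.children.take a)) (1 : k) : KP k) ⊗ₜ[k]
        (Finsupp.single (PTree.ofList (T.children.drop a)) (1 : k) : KP k)

/-- The Connes-Kreimer Hopf algebra `H_K`, as an algebra the polynomials in the rooted trees. -/
abbrev HK : Type _ := MvPolynomial RTree k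

/-- The Foissy Hopf algebra `H_F`, as an algebra the tensor algebra on `kP`, that is, the
noncommutative polynomials in the planar rooted trees. -/
abbrev HF : Type _ := FreeAlgebra k PTree

/-- `B_+ : H_K → kT`. -/
def bPlus : HK k →ₗ[k] KT k :=
  (MvPolynomial.basisMonomials RTree k).constr k fun s =>
    Finsupp.single (RTree.ofMultiset (Finsupp.toMultiset s)) 1

/-- `B_+ : H_F → kP`. -/
def planarBPlus : HF k →ₗ[k] KP k :=
  (FreeAlgebra.basisFreeMonoid k PTree).constr k fun L : FreeMonoid PTree =>
    Finsupp.single (PTree.ofList L.toList) 1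

/-- The inclusion of `kT` in `H_K`. -/
def inclKT : KT k →ₗ[k] HK k := Finsupp.lift (HK k) k RTree fun t => MvPolynomial.X t

/-- The inclusion of `kP` in `H_F`. -/
def inclKP : KP k →ₗ[k] HF k := Finsupp.lift (HF k) k PTree fun T => FreeAlgebra.ι k T

/-- `Δ(t) = t ⊗ 1 + (id ⊗ B_+) Δ(B_-(t))` in `H_K ⊗ H_K`, for the rooted tree `t` underlying a
planar rooted tree. -/
def comulHKTree : PTree → HK k ⊗[k] HK k
  | .node n c =>
    MvPolynomial.X (RTree.ofPlanar (.node n c)) ⊗ₜ[k] 1 +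
      TensorProduct.map LinearMap.id (inclKT k ∘ₗ bPlus k) (∏ i : Fin n, comulHKTree (c i))

/-- `Δ(T) = T ⊗ 1 + (id ⊗ B_+) Δ(B_-(T))` in `H_F ⊗ H_F`, for a planar rooted tree `T`. -/
def comulHFTree : PTree → HF k ⊗[k] HF k
  | .node n c =>
    FreeAlgebra.ι k (PTree.node n c) ⊗ₜ[k] 1 +
      TensorProduct.map LinearMap.id (inclKP k ∘ₗ planarBPlus k)
        (List.ofFn fun i : Fin n => comulHFTree (c i)).prod

def opsHK : HopfOps k (HK k) :=
  HopfOps.ofAlgebra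
    (MvPolynomial.aeval fun _ : RTree => (0 : k)).toLinearMap
    (MvPolynomial.aeval fun t : RTree => comulHKTree k t.toPlanar).toLinearMap

def opsHF : HopfOps k (HF k) :=
  HopfOps.ofAlgebra
    (FreeAlgebra.lift k fun _ : PTree => (0 : k)).toLinearMap
    (FreeAlgebra.lift k fun T : PTree => comulHFTree k T).toLinearMap

/-- The inner product on `kT` with `(t, t') = |Sym(t)|` if `t = t'`, and `0` otherwise. -/
def innerKT : KT k →ₗ[k] KT k →ₗ[k] k :=
  Finsupp.lift (KT k →ₗ[k] k) k RTree fun t => (t.symOrder : k) • Finsupp.lapply t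

/-- The inner product on `kP` for which the planar rooted trees are orthonormal. -/
def innerKP : KP k →ₗ[k] KP k →ₗ[k] k :=
  Finsupp.lift (KP k →ₗ[k] k) k PTree fun T => Finsupp.lapply T

/-- The duality pairing `⟨t, u⟩ = (t, B_+(u))` of `kT` with `H_K`. -/
def pairKT : KT k →ₗ[k] HK k →ₗ[k] k := (innerKT k).compl₂ (bPlus k)

/-- The duality pairing `⟨T, u⟩ = (T, B_+(u))` of `kP` with `H_F`. -/
def pairKP : KP k →ₗ[k] HF k →ₗ[k] k := (innerKP k).compl₂ (planarBPlus k)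

/-- `κ_n`, the sum of `t / |Sym(t)|` over the (finitely many) rooted trees `t` with `n + 1`
vertices. -/
def kappa (n : ℕ) : KT k :=
  ∑ᶠ t ∈ {t : RTree | t.size = n + 1}, Finsupp.single t ((t.symOrder : k)⁻¹)

/-- `ε_0 = •` and `ε_n = κ_1 ∘ ε_{n-1} - κ_2 ∘ ε_{n-2} + ⋯ + (-1)^{n-1} κ_n ∘ ε_0`. -/
def eps : ℕ → KT k
  | 0 => Finsupp.single RTree.bullet 1
  | n + 1 => ∑ j : Fin (n + 1), (-1 : k) ^ (j : ℕ) • (opsKT k).mul (kappa k (j + 1)) (eps (n - j))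

end Trees

/-! ## The maps of the hexagon -/

section Hexagon

variable (k : Type*) [Field k]

/-- Linear maps placed as the arrows of the hexagon, and a bilinear form on `Sym`. -/
@[ext]
structure HexagonMaps where
  /-- the bilinear form on `Sym` -/
  form : SymF k →ₗ[k] SymF k →ₗ[k] k
  Phi : NSymF k →ₗ[k] HF k
  rho : HF k →ₗ[k] HK k
  tau : NSymF k →ₗ[k] SymF k
  phi : SymF k →ₗ[k] HK k
  Z : NSymF k →ₗ[k] KT k
  PhiDual : KP k →ₗ[k] QSymF k
  rhoDual : KT k →ₗ[k] KP k
  tauDual : SymF k →ₗ[k] QSymF k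
  phiDual : KT k →ₗ[k] SymF k
  ZDual : HK k →ₗ[k] QSymF k

variable {k}

/-- The properties that define the maps: the form is the inner product on `Sym` with
`(e_λ, m_μ) = δ_{λ,μ}`; `Φ`, `ρ`, `τ`, `φ`, `Z` are the homomorphisms of algebras with the
prescribed values on generators; the other five maps are their duals with respect to the pairings
of `kP` with `H_F`, of `kT` with `H_K`, of `NSym` with `QSym`, and of `Sym` with itself. -/
structure HexagonMaps.IsHexagon (H : HexagonMaps k) : Prop where
  form_elem_mono : ∀ p q : Multiset ℕ+,
    H.form (elemSymProd k p) (monoSym k q) = if p = q then 1 else 0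
  Phi_hom : IsAlgHom (opsNSym k) (opsHF k) H.Phi
  Phi_E : ∀ n : ℕ+, H.Phi (FreeAlgebra.ι k n) = FreeAlgebra.ι k (PTree.ladder n.natPred)
  rho_hom : IsAlgHom (opsHF k) (opsHK k) H.rho
  rho_tree : ∀ T : PTree, H.rho (FreeAlgebra.ι k T) = MvPolynomial.X (RTree.ofPlanar T)
  tau_hom : IsAlgHom (opsNSym k) (opsSym k) H.tau
  tau_E : ∀ n : ℕ+, H.tau (FreeAlgebra.ι k n) = elemSym k n
  phi_hom : IsAlgHom (opsSym k) (opsHK k) H.phi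
  phi_e : ∀ n : ℕ+,
    H.phi (elemSym k n) = MvPolynomial.X (RTree.ofPlanar (PTree.ladder n.natPred))
  Z_hom : IsAlgHom (opsNSym k) (opsKT k) H.Z
  Z_E : ∀ n : ℕ+, H.Z (FreeAlgebra.ι k n) = eps k n
  PhiDual_adj : ∀ (w : NSymF k) (x : KP k), pairNQ k w (H.PhiDual x) = pairKP k x (H.Phi w)
  rhoDual_adj : ∀ (u : HF k) (x : KT k), pairKP k (H.rhoDual x) u = pairKT k x (H.rho u)
  tauDual_adj : ∀ (w : NSymF k) (f : SymF k), pairNQ k w (H.tauDual f) = H.form (H.tau w) f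
  phiDual_adj : ∀ (f : SymF k) (x : KT k), H.form (H.phiDual x) f = pairKT k x (H.phi f)
  ZDual_adj : ∀ (w : NSymF k) (u : HK k), pairNQ k w (H.ZDual u) = pairKT k (H.Z w) u

/-- All ten arrows are homomorphisms of Hopf algebras. -/
structure HexagonMaps.AreHopfHoms (H : HexagonMaps k) : Prop where
  Phi : IsHopfHom (opsNSym k) (opsHF k) H.Phi
  rho : IsHopfHom (opsHF k) (opsHK k) H.rho
  tau : IsHopfHom (opsNSym k) (opsSym k) H.tau
  phi : IsHopfHom (opsSym k) (opsHK k) H.phi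
  Z : IsHopfHom (opsNSym k) (opsKT k) H.Z
  PhiDual : IsHopfHom (opsKP k) (opsQSym k) H.PhiDual
  rhoDual : IsHopfHom (opsKT k) (opsKP k) H.rhoDual
  tauDual : IsHopfHom (opsSym k) (opsQSym k) H.tauDual
  phiDual : IsHopfHom (opsKT k) (opsSym k) H.phiDual
  ZDual : IsHopfHom (opsHK k) (opsQSym k) H.ZDual

end Hexagon

end CommHexagon

end

/-! Every arrow is fixed by its values on generators or by adjointness. What remains is to show that
the pairings are dualities of Hopf algebras, that the algebra maps respect coproducts, and that the
triangles of the hexagon close.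

Duality. In a dual pair (`IsDualPair`) each product is adjoint to the opposite coproduct and each
unit to the opposite counit. The adjoint of a Hopf homomorphism is then a Hopf homomorphism,
provided the pairing separates the points of the space in which the adjoint takes values
(`IsHopfHom.adjoint`). For `NSym` and `QSym`, left multiplication by `E_a` is adjoint to extracting
the coefficient of `x_0^a`, and the product rule for this extraction mirrors the coproduct of `E_a`.
For `kP` and `H_F`, the coefficient of `A ⊗ C` in `Δ(L)` counts the ordered attachments of `A` to
`B_+(C)` that give `B_+(L)` (`tensorCoeff_comulForest`). For `kT` and `H_K`, multiplication by a
tree `x` is adjoint to the derivation `|Sym(x)| ∂/∂x`, and the Leibniz rule on a grafted forest is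
the recursion of the coproduct (`formHK_graftSum`). The form on `Sym` is symmetric, because the form
it induces on `NSym` is (`pairNQ_tauQ_comm`). Hence `Sym` is self-dual and `τ*` is the inclusion in
`QSym`.

Algebra maps. Out of a free algebra only generators need checking, and the `E_n` are divided powers.
So are the `e_n` and the ladders, by direct computation. For `ε_n`, the functional `⟨ε_n, ·⟩` is the
coefficient of `X^n` in the character of `H_K` with `• ↦ X` and all other trees sent to `0`
(`pairKT_eps`). Its convolution inverse is the character `T ↦ (-X)^|T|`, whose coefficients are `±
⟨κ_n, ·⟩` (`kappaChar_mul_epsChar`); comparing coefficients gives the recursion that defines `ε_n`.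
Since `τ` is surjective, `φ` inherits its properties from `φτ = ρΦ`.

Hexagon. `ρΦ = φτ` holds on generators. For `φ*Z = τ`, the functionals `⟨ε_n, φ(·)⟩` and `(e_n, ·)`
obey the same product rule and agree on every `e_m` (`pairKT_eps_phiHom`). The other two identities
are the adjoints of these. -/

noncomputable section

namespace CommHexagon

/-! ## Dual pairs of Hopf algebras -/

section Pairing

variable {k A B A' B' : Type*} [Field k] [AddCommGroup A] [Module k A] [AddCommGroup B]
  [Module k B] [AddCommGroup A'] [Module k A'] [AddCommGroup B'] [Module k B']

/-- The pairing of `A ⊗ A` with `B ⊗ B` induced by a pairing of `A` with `B`. -/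
def tensorPairing (p : A →ₗ[k] B →ₗ[k] k) : A ⊗[k] A →ₗ[k] B ⊗[k] B →ₗ[k] k :=
  (TensorProduct.map₂ p p).compr₂ (TensorProduct.lid k k).toLinearMap

@[simp]
theorem tensorPairing_tmul (p : A →ₗ[k] B →ₗ[k] k) (a a' : A) (b b' : B) :
    tensorPairing p (a ⊗ₜ a') (b ⊗ₜ b') = p a b * p a' b' := by
  simp [tensorPairing]

theorem tensorPairing_flip (p : A →ₗ[k] B →ₗ[k] k) (x : A ⊗[k] A) (y : B ⊗[k] B) :
    tensorPairing p.flip y x = tensorPairing p x y := by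
  induction x with
  | zero => simp
  | add x x' hx hx' => simp [hx, hx']
  | tmul a a' =>
    induction y with
    | zero => simp
    | add y y' hy hy' => simp [hy, hy']
    | tmul b b' => simp

theorem tensorPairing_map (p : A →ₗ[k] B →ₗ[k] k) (q : A' →ₗ[k] B' →ₗ[k] k) (f : A →ₗ[k] A')
    (g : B' →ₗ[k] B) (h : ∀ a b, p a (g b) = q (f a) b) (x : A ⊗[k] A) (y : B' ⊗[k] B') :
    tensorPairing p x (TensorProduct.map g g y) = tensorPairing q (TensorProduct.map f f x) y := by
  induction x with
  | zero => simp
  | add x x' hx hx' => simp [hx, hx']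
  | tmul a a' =>
    induction y with
    | zero => simp
    | add y y' hy hy' => simp [hy, hy']
    | tmul b b' => simp [h]

/-- Expanding in a basis of `B ⊗ B` reduces the claim to two uses of separation, one for each tensor
factor, with a comparison of basis coefficients after each. -/
theorem separatingRight_tensorPairing {p : A →ₗ[k] B →ₗ[k] k} (hp : p.SeparatingRight) :
    (tensorPairing p).SeparatingRight := by
  intro y hy
  let b := Module.Basis.ofVectorSpace k B
  let c := (b.tensorProduct b).repr y
  have hexp : ∀ a a', ∑ i ∈ c.support, c i * (p a (b i.1) * p a' (b i.2)) = 0 := by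
    intro a a'
    rw [← hy (a ⊗ₜ a'), ← (b.tensorProduct b).linearCombination_repr y,
      Finsupp.linearCombination_apply, Finsupp.sum, map_sum]
    refine Finset.sum_congr rfl fun i _ => ?_
    rw [map_smul, Module.Basis.tensorProduct_apply, tensorPairing_tmul, smul_eq_mul]
  classical
  have h1 : ∀ a', ∑ i ∈ c.support, (c i * p a' (b i.2)) • b i.1 = 0 := by
    intro a'
    refine hp _ fun a => ?_
    rw [map_sum, ← hexp a a']
    refine Finset.sum_congr rfl fun i _ => ?_
    rw [map_smul, smul_eq_mul]
    ring
  have h2 : ∀ x a', ∑ i ∈ c.support with i.1 = x, c i * p a' (b i.2) = 0 := by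
    intro x a'
    have := congrArg (fun v => b.repr v x) (h1 a')
    simpa [Finsupp.single_apply, Finset.sum_filter, ← ite_and] using this
  have h3 : ∀ x, ∑ i ∈ c.support with i.1 = x, c i • b i.2 = 0 := by
    intro x
    refine hp _ fun a' => ?_
    rw [map_sum, ← h2 x a']
    exact Finset.sum_congr rfl fun i _ => by rw [map_smul, smul_eq_mul]
  have h4 : c = 0 := by
    ext ⟨x, z⟩
    by_contra hne
    have := congrArg (fun v => b.repr v z) (h3 x)
    simp only [map_sum, map_smul, Module.Basis.repr_self, Finsupp.finsetSum_apply,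
      Finsupp.smul_single, Finsupp.single_apply, smul_eq_mul, mul_one, map_zero,
      Finsupp.coe_zero, Pi.zero_apply] at this
    rw [Finset.sum_eq_single (⟨x, z⟩ : _ × _)] at this
    · exact hne (by simpa using this)
    · rintro ⟨x', z'⟩ hx hne'
      rw [if_neg]
      intro hz
      exact hne' (Prod.ext (Finset.mem_filter.1 hx).2 hz)
    · intro h
      rw [Finset.mem_filter, not_and] at h
      exact absurd rfl (h (Finsupp.mem_support_iff.2 hne))
  exact (b.tensorProduct b).repr.map_eq_zero_iff.1 h4

/-- The operations of `A` and of `B` are adjoint with respect to the pairing `p`. -/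
structure IsDualPair (opA : HopfOps k A) (opB : HopfOps k B) (p : A →ₗ[k] B →ₗ[k] k) : Prop where
  one_left : ∀ b, p opA.one b = opB.counit b
  one_right : ∀ a, p a opB.one = opA.counit a
  mul_left : ∀ a a' b, p (opA.mul a a') b = tensorPairing p (a ⊗ₜ a') (opB.comul b)
  mul_right : ∀ a b b', p a (opB.mul b b') = tensorPairing p (opA.comul a) (b ⊗ₜ b')

theorem IsDualPair.flip {opA : HopfOps k A} {opB : HopfOps k B} {p : A →ₗ[k] B →ₗ[k] k}
    (h : IsDualPair opA opB p) : IsDualPair opB opA p.flip where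
  one_left := h.one_right
  one_right := h.one_left
  mul_left b b' a := by
    rw [tensorPairing_flip, LinearMap.flip_apply, h.mul_right]
  mul_right b a a' := by
    rw [tensorPairing_flip, LinearMap.flip_apply, h.mul_left]

/-- The adjoint of a homomorphism of algebras is a homomorphism of coalgebras. -/
theorem comul_adjoint {opA : HopfOps k A} {opB : HopfOps k B} {opA' : HopfOps k A'}
    {opB' : HopfOps k B'} {p : A →ₗ[k] B →ₗ[k] k} {q : A' →ₗ[k] B' →ₗ[k] k}
    {f : A →ₗ[k] A'} {g : B' →ₗ[k] B}
    (hp : ∀ a a' b, p (opA.mul a a') b = tensorPairing p (a ⊗ₜ a') (opB.comul b))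
    (hq : ∀ a a' b, q (opA'.mul a a') b = tensorPairing q (a ⊗ₜ a') (opB'.comul b))
    (hf : ∀ a a', f (opA.mul a a') = opA'.mul (f a) (f a')) (hs : p.SeparatingRight)
    (h : ∀ a b, p a (g b) = q (f a) b) (b : B') :
    opB.comul (g b) = TensorProduct.map g g (opB'.comul b) := by
  refine sub_eq_zero.1 (separatingRight_tensorPairing hs _ fun x => ?_)
  induction x with
  | zero => simp
  | add x x' hx hx' => rw [map_add, LinearMap.add_apply, hx, hx', add_zero]
  | tmul a a' =>
    rw [map_sub, ← hp, h, hf, hq, tensorPairing_map p q f g h, TensorProduct.map_tmul, sub_self]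

/-- The adjoint of a homomorphism of Hopf algebras is a homomorphism of Hopf algebras. -/
theorem IsHopfHom.adjoint {opA : HopfOps k A} {opB : HopfOps k B} {opA' : HopfOps k A'}
    {opB' : HopfOps k B'} {p : A →ₗ[k] B →ₗ[k] k} {q : A' →ₗ[k] B' →ₗ[k] k}
    {f : A →ₗ[k] A'} {g : B' →ₗ[k] B} (hf : IsHopfHom opA opA' f) (hp : IsDualPair opA opB p)
    (hq : IsDualPair opA' opB' q) (hs : p.SeparatingRight) (h : ∀ a b, p a (g b) = q (f a) b) :
    IsHopfHom opB' opB g := by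
  have ext1 : ∀ y y' : B, (∀ a, p a y = p a y') → y = y' := fun y y' hy =>
    sub_eq_zero.1 (hs _ fun a => by rw [map_sub, hy, sub_self])
  refine ⟨⟨ext1 _ _ fun a => ?_, fun b b' => ext1 _ _ fun a => ?_⟩, fun b => ?_,
    comul_adjoint hp.mul_left hq.mul_left hf.map_mul hs h⟩
  · rw [h, hq.one_right, hf.map_counit, hp.one_right]
  · rw [h, hq.mul_right, hf.map_comul, ← tensorPairing_map p q f g h, TensorProduct.map_tmul,
      hp.mul_right]
  · rw [← hp.one_left, h, hf.map_one, hq.one_left]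

/-- Over a field `g ⊗ g` is again injective, so the coproduct identity can also be tested after
applying `g`. This serves `τ`, followed by the inclusion of `Sym` in `QSym`. -/
theorem IsHopfHom.of_comp_injective {opA : HopfOps k A} {opB : HopfOps k B} {opA' : HopfOps k A'}
    {f : A →ₗ[k] B} {g : B →ₗ[k] A'} (hgf : IsHopfHom opA opA' (g ∘ₗ f)) (hg : IsHopfHom opB opA' g)
    (hinj : Function.Injective g) : IsHopfHom opA opB f := by
  have hinj2 := TensorProduct.map_injective_of_flat_flat g g hinj hinj
  refine ⟨⟨hinj ?_, fun a b => hinj ?_⟩, fun a => ?_, fun a => hinj2 ?_⟩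
  · rw [hg.map_one, ← hgf.map_one, LinearMap.comp_apply]
  · rw [hg.map_mul, ← LinearMap.comp_apply, hgf.map_mul, LinearMap.comp_apply,
      LinearMap.comp_apply]
  · rw [← hg.map_counit, ← hgf.map_counit, LinearMap.comp_apply]
  · rw [← hg.map_comul]
    refine (hgf.map_comul a).trans ?_
    rw [TensorProduct.map_comp, LinearMap.comp_apply]

/-- An adjoint exists as soon as the functionals to be represented on a spanning set are. -/
theorem exists_adjoint {p : A →ₗ[k] B →ₗ[k] k} (hp : p.SeparatingRight) (q : A → B' →ₗ[k] k)
    (s : Set B') (hs : Submodule.span k s = ⊤) (h : ∀ x ∈ s, ∃ y, ∀ a, p a y = q a x) :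
    ∃ g : B' →ₗ[k] B, ∀ a x, p a (g x) = q a x := by
  have ext1 : ∀ y y' : B, (∀ a, p a y = p a y') → y = y' := fun y y' hy =>
    sub_eq_zero.1 (hp _ fun a => by rw [map_sub, hy, sub_self])
  have hall : ∀ x, ∃ y, ∀ a, p a y = q a x := by
    intro x
    have hx : x ∈ Submodule.span k s := hs ▸ Submodule.mem_top
    induction hx using Submodule.span_induction with
    | mem x hx => exact h x hx
    | zero => exact ⟨0, fun a => by simp⟩
    | add x x' _ _ hx hx' =>
      obtain ⟨y, hy⟩ := hx
      obtain ⟨y', hy'⟩ := hx'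
      exact ⟨y + y', fun a => by simp [hy, hy']⟩
    | smul c x _ hx =>
      obtain ⟨y, hy⟩ := hx
      exact ⟨c • y, fun a => by simp [hy]⟩
  -- Separation makes the representing element unique, so the chosen function is automatically
  -- linear.
  choose g hg using hall
  exact ⟨{ toFun := g
           map_add' := fun x x' => ext1 _ _ fun a => by simp [hg]
           map_smul' := fun c x => ext1 _ _ fun a => by simp [hg] }, fun a x => hg x a⟩

theorem adjoint_unique {p : A →ₗ[k] B →ₗ[k] k} (hp : p.SeparatingRight) {g g' : B' →ₗ[k] B}
    (h : ∀ a x, p a (g x) = p a (g' x)) : g = g' :=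
  LinearMap.ext fun x => sub_eq_zero.1 (hp _ fun a => by rw [map_sub, h, sub_self])

/-- The coproduct is multiplicative. -/
def HopfOps.ComulMul (op : HopfOps k A) : Prop :=
  ∀ a a', op.comul (op.mul a a') = TensorProduct.map₂ op.mul op.mul (op.comul a) (op.comul a')

/-- Both sides are the pairing of `Δa ⊗ Δa'` with `Δb ⊗ Δb'` after interchanging the two middle
factors, once in `A` and once in `B`. -/
theorem tensorPairing_map₂_left {opA : HopfOps k A} {opB : HopfOps k B} {p : A →ₗ[k] B →ₗ[k] k}
    (hp : IsDualPair opA opB p) (hB : opB.ComulMul) (a a' : A) (b b' : B) :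
    tensorPairing p (TensorProduct.map₂ opA.mul opA.mul (opA.comul a) (opA.comul a')) (b ⊗ₜ b') =
      tensorPairing p (a ⊗ₜ a') (opB.comul (opB.mul b b')) := by
  rw [hB]
  have h1 : ∀ x x' : A ⊗[k] A, tensorPairing p (TensorProduct.map₂ opA.mul opA.mul x x') (b ⊗ₜ b') =
      tensorPairing (tensorPairing p) (TensorProduct.tensorTensorTensorComm k A A A A (x ⊗ₜ x'))
        (opB.comul b ⊗ₜ opB.comul b') := by
    intro x x'
    induction x with
    | zero => simp
    | add x y hx hy => simp only [hx, hy, TensorProduct.add_tmul, map_add, LinearMap.add_apply]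
    | tmul a₁ a₂ =>
      induction x' with
      | zero => simp
      | add x y hx hy => simp only [hx, hy, TensorProduct.tmul_add, map_add, LinearMap.add_apply]
      | tmul a₁' a₂' => simp [hp.mul_left]
  have h2 : ∀ y y' : B ⊗[k] B, tensorPairing p (a ⊗ₜ a') (TensorProduct.map₂ opB.mul opB.mul y y') =
      tensorPairing (tensorPairing p) (opA.comul a ⊗ₜ opA.comul a')
        (TensorProduct.tensorTensorTensorComm k B B B B (y ⊗ₜ y')) := by
    intro y y'
    induction y with
    | zero => simp
    | add x y hx hy => simp only [hx, hy, TensorProduct.add_tmul, map_add, LinearMap.add_apply]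
    | tmul b₁ b₂ =>
      induction y' with
      | zero => simp
      | add x y hx hy => simp only [hx, hy, TensorProduct.tmul_add, map_add]
      | tmul b₁' b₂' => simp [hp.mul_right]
  have h3 : ∀ (x x' : A ⊗[k] A) (y y' : B ⊗[k] B),
      tensorPairing (tensorPairing p) (TensorProduct.tensorTensorTensorComm k A A A A (x ⊗ₜ x'))
        (y ⊗ₜ y') = tensorPairing (tensorPairing p) (x ⊗ₜ x')
        (TensorProduct.tensorTensorTensorComm k B B B B (y ⊗ₜ y')) := by
    intro x x' y y'
    induction x with
    | zero => simp
    | add x y hx hy => simp only [hx, hy, TensorProduct.add_tmul, map_add, LinearMap.add_apply]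
    | tmul a₁ a₂ =>
      induction x' with
      | zero => simp
      | add x y hx hy => simp only [hx, hy, TensorProduct.tmul_add, map_add, LinearMap.add_apply]
      | tmul a₁' a₂' =>
        induction y with
        | zero => simp
        | add x y hx hy => simp only [hx, hy, TensorProduct.add_tmul, map_add]
        | tmul b₁ b₂ =>
          induction y' with
          | zero => simp
          | add x y hx hy => simp only [hx, hy, TensorProduct.tmul_add, map_add]
          | tmul b₁' b₂' =>
            simp
            ring
  rw [h1, h2, h3]

/-- The dual of a bialgebra is a bialgebra. -/
theorem IsDualPair.comulMul_left {opA : HopfOps k A} {opB : HopfOps k B} {p : A →ₗ[k] B →ₗ[k] k}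
    (hp : IsDualPair opA opB p) (hs : p.SeparatingLeft) (hB : opB.ComulMul) : opA.ComulMul := by
  intro a a'
  have hs' := separatingRight_tensorPairing (LinearMap.flip_separatingRight.2 hs)
  refine sub_eq_zero.1 (hs' _ fun y => ?_)
  rw [tensorPairing_flip]
  induction y with
  | zero => simp
  | add x y hx hy => rw [map_add, hx, hy, add_zero]
  | tmul b b' =>
    rw [map_sub, LinearMap.sub_apply, ← hp.mul_right, tensorPairing_map₂_left hp hB, hp.mul_left,
      sub_self]

theorem comulMul_ofAlgebra {R : Type*} [Ring R] [Algebra k R] (ε : R →ₗ[k] k)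
    (Δ : R →ₐ[k] R ⊗[k] R) : (HopfOps.ofAlgebra ε Δ.toLinearMap).ComulMul := by
  intro a a'
  change Δ (a * a') = TensorProduct.map₂ (LinearMap.mul k R) (LinearMap.mul k R) (Δ a) (Δ a')
  rw [map_mul]
  induction Δ a with
  | zero => simp
  | add x y hx hy => simp only [add_mul, hx, hy, map_add, LinearMap.add_apply]
  | tmul a₁ a₂ =>
    induction Δ a' with
    | zero => simp
    | add x y hx hy => simp only [mul_add, hx, hy, map_add]
    | tmul b₁ b₂ => simp

end Pairing

/-! ## The word basis of a free algebra -/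

section FreeAlgebra

variable (k : Type*) [Field k] {X : Type*}

/-- The word with letters `L` in the free algebra. -/
def word (L : List X) : FreeAlgebra k X := (L.map (FreeAlgebra.ι k)).prod

@[simp] theorem word_nil : word k ([] : List X) = 1 := rfl

@[simp] theorem word_cons (x : X) (L : List X) : word k (x :: L) = FreeAlgebra.ι k x * word k L := by
  simp [word]

theorem word_append (L L' : List X) : word k (L ++ L') = word k L * word k L' := by
  simp [word]

theorem basisFreeMonoid_eq_word (L : FreeMonoid X) :
    FreeAlgebra.basisFreeMonoid k X L = word k L.toList := by
  have h : FreeAlgebra.basisFreeMonoid k X L =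
      FreeAlgebra.equivMonoidAlgebraFreeMonoid.symm (MonoidAlgebra.of k _ L) := rfl
  rw [h]
  clear h
  induction L using FreeMonoid.inductionOn' with
  | one => simp [← MonoidAlgebra.one_def]
  | of_mul x L ih =>
    rw [map_mul, map_mul, ih, FreeMonoid.toList_of_mul, word_cons]
    congr 1
    simp [FreeAlgebra.equivMonoidAlgebraFreeMonoid, MonoidAlgebra.of]

theorem span_range_word : Submodule.span k (Set.range (word k (X := X))) = ⊤ := by
  rw [eq_top_iff, ← (FreeAlgebra.basisFreeMonoid k X).span_eq, Submodule.span_le]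
  rintro _ ⟨L, rfl⟩
  rw [basisFreeMonoid_eq_word]
  exact Submodule.subset_span ⟨_, rfl⟩

variable {k}

theorem linearMap_ext_word {M : Type*} [AddCommMonoid M] [Module k M] {f g : FreeAlgebra k X →ₗ[k] M}
    (h : ∀ L, f (word k L) = g (word k L)) : f = g :=
  (FreeAlgebra.basisFreeMonoid k X).ext fun L => by rw [basisFreeMonoid_eq_word, h]

theorem constr_word {M : Type*} [AddCommMonoid M] [Module k M] (F : FreeMonoid X → M) (L : List X) :
    (FreeAlgebra.basisFreeMonoid k X).constr k F (word k L) = F (FreeMonoid.ofList L) := by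
  rw [← FreeMonoid.toList_ofList L, ← basisFreeMonoid_eq_word, Module.Basis.constr_basis]
  rfl

end FreeAlgebra

/-! ## The duality of `NSym` and `QSym` -/

section QSym

variable {k : Type*} [Field k]

/-- The exponent vector of `x_0^a` times the monomial `m` with all variables shifted by one. -/
def consExp (a : ℕ) (m : ℕ →₀ ℕ) : ℕ →₀ ℕ :=
  Finsupp.single 0 a + m.embDomain ⟨Nat.succ, Nat.succ_injective⟩

@[simp] theorem consExp_zero (a : ℕ) (m : ℕ →₀ ℕ) : consExp a m 0 = a := by
  rw [consExp, Finsupp.add_apply, Finsupp.single_eq_same, Finsupp.embDomain_of_notMem_range,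
    add_zero]
  rintro ⟨n, hn⟩
  exact Nat.succ_ne_zero n hn

@[simp] theorem consExp_succ (a : ℕ) (m : ℕ →₀ ℕ) (n : ℕ) : consExp a m (n + 1) = m n := by
  rw [consExp, Finsupp.add_apply, Finsupp.single_eq_of_ne (Nat.succ_ne_zero n), zero_add]
  exact Finsupp.embDomain_apply_self ⟨Nat.succ, Nat.succ_injective⟩ m n

/-- The exponents of all variables but the first. -/
def tailExp (m : ℕ →₀ ℕ) : ℕ →₀ ℕ := m.comapDomain Nat.succ Nat.succ_injective.injOn

@[simp] theorem tailExp_apply (m : ℕ →₀ ℕ) (n : ℕ) : tailExp m n = m (n + 1) := rfl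

@[simp] theorem consExp_tailExp (m : ℕ →₀ ℕ) : consExp (m 0) (tailExp m) = m := by
  ext n
  cases n <;> simp

@[simp] theorem tailExp_consExp (a : ℕ) (m : ℕ →₀ ℕ) : tailExp (consExp a m) = m := by
  ext n
  simp

theorem consExp_add (a b : ℕ) (m m' : ℕ →₀ ℕ) :
    consExp (a + b) (m + m') = consExp a m + consExp b m' := by
  ext n
  cases n <;> simp

theorem degree_consExp (a : ℕ) (m : ℕ →₀ ℕ) : (consExp a m).degree = a + m.degree := by
  have h : ∀ m : ℕ →₀ ℕ, m.degree = m.sum fun _ c => c := fun m => rfl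
  rw [consExp, map_add, Finsupp.degree_single, h, h, Finsupp.sum_embDomain]

theorem consExp_expVec {l : ℕ} (a : ℕ) (n i : Fin l → ℕ) :
    consExp a (expVec n i) =
      expVec (Fin.cons 0 (fun j => n j + 1) : Fin (l + 1) → ℕ) (Fin.cons a i) := by
  rw [consExp, expVec, expVec, Fin.sum_univ_succ]
  congr 1
  rw [Finsupp.embDomain_eq_mapDomain, Finsupp.mapDomain_finsetSum]
  simp [Finsupp.mapDomain_single]

/-- The coefficient of `x_0^a` in `f`, with the variables renumbered. -/
def headCoeff (a : ℕ) : MvPowerSeries ℕ k →ₗ[k] MvPowerSeries ℕ k where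
  toFun f := fun m => MvPowerSeries.coeff (consExp a m) f
  map_add' f g := by
    ext m
    exact map_add (MvPowerSeries.coeff (consExp a m)) f g
  map_smul' c f := by
    ext m
    exact map_smul (MvPowerSeries.coeff (consExp a m)) c f

theorem coeff_headCoeff (a : ℕ) (m : ℕ →₀ ℕ) (f : MvPowerSeries ℕ k) :
    MvPowerSeries.coeff m (headCoeff a f) = MvPowerSeries.coeff (consExp a m) f := rfl

/-- A factorization of a monomial factors the power of `x_0` and the remaining variables
independently. The resulting rule is dual to `Δ(E_a) = ∑ E_i ⊗ E_j`. -/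
theorem headCoeff_mul (a : ℕ) (f g : MvPowerSeries ℕ k) :
    headCoeff a (f * g) =
      ∑ p ∈ Finset.HasAntidiagonal.antidiagonal a, headCoeff p.1 f * headCoeff p.2 g := by
  classical
  ext m
  rw [coeff_headCoeff, MvPowerSeries.coeff_mul, map_sum]
  simp_rw [MvPowerSeries.coeff_mul, coeff_headCoeff]
  rw [← Finset.sum_product']
  refine Finset.sum_nbij' (fun p => ((p.1 0, p.2 0), (tailExp p.1, tailExp p.2)))
    (fun q => (consExp q.1.1 q.2.1, consExp q.1.2 q.2.2)) ?_ ?_ ?_ ?_ ?_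
  · rintro ⟨p, q⟩ h
    rw [Finset.HasAntidiagonal.mem_antidiagonal] at h
    simp only [Finset.mem_product, Finset.HasAntidiagonal.mem_antidiagonal]
    constructor
    · rw [← Finsupp.add_apply, h, consExp_zero]
    · ext n
      rw [Finsupp.add_apply, tailExp_apply, tailExp_apply, ← Finsupp.add_apply, h, consExp_succ]
  · rintro ⟨⟨b, c⟩, p, q⟩ h
    simp only [Finset.mem_product, Finset.HasAntidiagonal.mem_antidiagonal] at h ⊢
    rw [← consExp_add, h.1, h.2]
  · rintro ⟨p, q⟩ _
    simp
  · rintro ⟨⟨b, c⟩, p, q⟩ _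
    simp
  · rintro ⟨p, q⟩ _
    simp

theorem compCoeff_nil (f : MvPowerSeries ℕ k) : compCoeff [] f = MvPowerSeries.coeff 0 f := rfl

/-- Peeling off the first variable allows inductions on compositions and makes `headCoeff` dual to
prepending a letter. -/
theorem compCoeff_cons (a : ℕ+) (I : List ℕ+) (f : MvPowerSeries ℕ k) :
    compCoeff (a :: I) f = compCoeff I (headCoeff a f) := by
  rw [compCoeff, compCoeff, coeff_headCoeff, consExp_expVec]
  have h1 : (fun j : Fin (a :: I).length => (j : ℕ)) =
      (Fin.cons 0 fun j : Fin I.length => (j : ℕ) + 1) := by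
    funext j
    refine Fin.cases ?_ (fun j => ?_) j <;> simp
  have h2 : (fun j : Fin (a :: I).length => ((a :: I).get j : ℕ)) =
      (Fin.cons (a : ℕ) fun j : Fin I.length => (I.get j : ℕ)) := by
    funext j
    refine Fin.cases ?_ (fun j => ?_) j <;> simp
  rw [h1, h2]

theorem headCoeff_mem (a : ℕ) {f : MvPowerSeries ℕ k} (hf : f ∈ QSymF k) :
    headCoeff a f ∈ QSymF k := by
  obtain ⟨⟨d, hd⟩, h⟩ := hf
  refine ⟨⟨d, fun m hm => ?_⟩, fun l n hn i => ?_⟩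
  · have := hd _ hm
    rw [degree_consExp] at this
    omega
  · have hs : ∀ n : Fin l → ℕ, StrictMono n →
        StrictMono (Fin.cons 0 (fun j => n j + 1) : Fin (l + 1) → ℕ) := by
      intro n hn b c
      refine Fin.cases ?_ (fun b => ?_) b <;> refine Fin.cases ?_ (fun c => ?_) c
      · simp
      · simp
      · simp
      · simpa using fun h => hn h
    rw [coeff_headCoeff, coeff_headCoeff, consExp_expVec, consExp_expVec, h _ _ (hs n hn),
      h _ _ (hs _ Fin.val_strictMono)]

theorem exists_expVec (m : ℕ →₀ ℕ) : ∃ (l : ℕ) (i : Fin l → ℕ), m = expVec (fun j => (j : ℕ)) i := by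
  obtain ⟨l, hl⟩ := m.support.exists_nat_subset_range
  refine ⟨l, fun j => m j, ?_⟩
  refine m.sum_single.symm.trans ?_
  rw [Finsupp.sum_of_support_subset m hl _ (by simp), expVec, Finset.sum_range]

/-- Quasi-symmetry for the increasing sequence `j ↦ j + 1`: the coefficients do not change when the
variables are shifted past `x_0`. It matches the convention `E_0 = 1`. -/
theorem headCoeff_zero {f : MvPowerSeries ℕ k} (hf : f ∈ QSymF k) : headCoeff 0 f = f := by
  ext m
  obtain ⟨l, i, rfl⟩ := exists_expVec m
  rw [coeff_headCoeff]
  have : consExp 0 (expVec (fun j : Fin l => (j : ℕ)) i) = expVec (fun j => (j : ℕ) + 1) i := by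
    rw [consExp_expVec]
    simp [expVec, Fin.sum_univ_succ]
  rw [this]
  exact hf.2 l _ (fun a b h => by simpa using h) i

variable (k) in
/-- The operator on `QSym` adjoint to left multiplication by `E_a`. -/
def headQSym (a : ℕ) : QSymF k →ₗ[k] QSymF k where
  toFun f := ⟨headCoeff a f, headCoeff_mem a f.2⟩
  map_add' f g := Subtype.ext (map_add (headCoeff a) (f : MvPowerSeries ℕ k) g)
  map_smul' c f := Subtype.ext (map_smul (headCoeff a) c (f : MvPowerSeries ℕ k))

theorem headQSym_mul (a : ℕ) (f g : QSymF k) : headQSym k a (f * g) =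
    ∑ p ∈ Finset.HasAntidiagonal.antidiagonal a, headQSym k p.1 f * headQSym k p.2 g := by
  refine Subtype.ext ?_
  rw [AddSubmonoidClass.coe_finsetSum]
  exact headCoeff_mul a f.1 g.1

theorem headQSym_zero (f : QSymF k) : headQSym k 0 f = f := Subtype.ext (headCoeff_zero f.2)

theorem pairNQ_word (I : List ℕ+) (f : QSymF k) : pairNQ k (word k I) f = compCoeff I f.1 := by
  rw [pairNQ, constr_word]
  rfl

theorem pairNQ_genE_mul (a : ℕ) (w : NSymF k) (f : QSymF k) :
    pairNQ k (genE k a * w) f = pairNQ k w (headQSym k a f) := by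
  cases a with
  | zero => rw [headQSym_zero, genE, one_mul]
  | succ a =>
    have : (pairNQ k).flip f ∘ₗ LinearMap.mulLeft k (genE k (a + 1)) =
        (pairNQ k).flip (headQSym k (a + 1) f) := by
      refine linearMap_ext_word fun I => ?_
      simp only [LinearMap.comp_apply, LinearMap.mulLeft_apply, LinearMap.flip_apply]
      rw [genE, ← word_cons, pairNQ_word, pairNQ_word, compCoeff_cons]
      rfl
    exact LinearMap.congr_fun this w

/-- The functionals only give coefficients with positive exponents in initial variables. Arbitrary
exponent vectors are reached by stripping `x_0` repeatedly, the exponent `0` included because there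
both `headQSym` and `E_0` act trivially. `N` bounds the variables that occur. -/
theorem separatingRight_pairNQ : (pairNQ k).SeparatingRight := by
  suffices h : ∀ (N : ℕ) (f : QSymF k), (∀ w, pairNQ k w f = 0) → ∀ m : ℕ →₀ ℕ,
      (∀ n, N ≤ n → m n = 0) → MvPowerSeries.coeff m f.1 = 0 by
    intro f hf
    refine Subtype.ext (MvPowerSeries.ext fun m => ?_)
    obtain ⟨N, hN⟩ := m.support.exists_nat_subset_range
    refine h N f hf m fun n hn => ?_
    by_contra hne
    exact absurd (Finset.mem_range.1 (hN (Finsupp.mem_support_iff.2 hne))) (not_lt.2 hn)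
  intro N
  induction N with
  | zero =>
    intro f hf m hm
    obtain rfl : m = 0 := Finsupp.ext fun n => hm n (Nat.zero_le n)
    rw [← compCoeff_nil, ← pairNQ_word, hf]
  | succ N ih =>
    intro f hf m hm
    rw [← consExp_tailExp m, ← coeff_headCoeff]
    exact ih (headQSym k (m 0) f) (fun w => by rw [← pairNQ_genE_mul, hf]) _
      fun n hn => hm _ (Nat.succ_le_succ hn)

theorem expList_expVec (I : List ℕ+) :
    expList (expVec (fun j : Fin I.length => (j : ℕ)) (fun j => (I.get j : ℕ))) =
      I.map PNat.val := by
  have h := expVec_eq_embDomain (l := I.length) Fin.valEmbedding (fun j => (I.get j : ℕ))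
  change expVec (fun j : Fin I.length => (j : ℕ)) (fun j => (I.get j : ℕ)) = _ at h
  rw [h, expList_embDomain _ Fin.val_strictMono]
  have hs : (Finsupp.equivFunOnFinite.symm fun j : Fin I.length => (I.get j : ℕ)).support =
      Finset.univ := by
    ext j
    simp
  rw [hs, Fin.sort_univ]
  refine List.ext_get (by simp) fun n h1 h2 => ?_
  simp

theorem compCoeff_monoQSym (I J : List ℕ+) :
    compCoeff I (monoQSym k J : MvPowerSeries ℕ k) = if I = J then 1 else 0 := by
  change (if expList _ = J.map PNat.val then (1 : k) else 0) = _
  rw [expList_expVec]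
  simp [(List.map_injective_iff.2 PNat.coe_injective).eq_iff]

theorem pairNQ_word_monoQSym (I J : List ℕ+) :
    pairNQ k (word k I) (monoQSym k J) = if I = J then 1 else 0 := by
  rw [pairNQ_word, compCoeff_monoQSym]

theorem qsymCoords_apply (f : QSymF k) (I : List ℕ+) :
    qsymCoords k f I = pairNQ k (word k I) f := by
  rw [pairNQ_word]
  rfl

theorem qsym_ext {f g : QSymF k} (h : ∀ I, pairNQ k (word k I) f = pairNQ k (word k I) g) :
    f = g := by
  refine sub_eq_zero.1 (separatingRight_pairNQ _ fun w => ?_)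
  have : (pairNQ k).flip (f - g) = 0 := linearMap_ext_word fun I => by
    simp [h]
  exact LinearMap.congr_fun this w

theorem qsym_eq_sum (f : QSymF k) : f = (qsymCoords k f).sum fun I c => c • monoQSym k I := by
  refine qsym_ext fun I => ?_
  classical
  simp only [Finsupp.sum, map_sum, map_smul, pairNQ_word_monoQSym, smul_eq_mul, mul_ite, mul_one,
    mul_zero, Finset.sum_ite_eq]
  split_ifs with h
  · rw [qsymCoords_apply]
  · rw [← qsymCoords_apply, Finsupp.notMem_support_iff.1 h]

theorem span_range_monoQSym : Submodule.span k (Set.range (monoQSym k)) = ⊤ := by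
  rw [eq_top_iff]
  intro f _
  rw [qsym_eq_sum f]
  exact Submodule.sum_mem _ fun I _ => Submodule.smul_mem _ _ (Submodule.subset_span ⟨I, rfl⟩)

theorem qsymCoords_monoQSym (I : List ℕ+) : qsymCoords k (monoQSym k I) = Finsupp.single I 1 := by
  ext J
  rw [qsymCoords_apply, pairNQ_word_monoQSym, Finsupp.single_apply]
  simp [eq_comm]

theorem comul_monoQSym (K : List ℕ+) : (opsQSym k).comul (monoQSym k K) =
    ∑ a ∈ Finset.range (K.length + 1), monoQSym k (K.take a) ⊗ₜ[k] monoQSym k (K.drop a) := by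
  change (Finsupp.lsum k _) (qsymCoords k (monoQSym k K)) = _
  rw [qsymCoords_monoQSym, Finsupp.lsum_single, LinearMap.toSpanSingleton_apply, one_smul]

/-- Only the cut at position `I.length` can produce the pair `(I, J)`. -/
theorem sum_take_drop_eq {α M : Type*} [DecidableEq α] [AddCommMonoid M] (I J K : List α) (c : M) :
    (∑ a ∈ Finset.range (K.length + 1), if J = K.drop a ∧ I = K.take a then c else 0) =
      if I ++ J = K then c else 0 := by
  split_ifs with h
  · subst h
    rw [Finset.sum_eq_single I.length]
    · simp
    · rintro a ha hne
      rw [if_neg]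
      rintro ⟨-, h1⟩
      have := congrArg List.length h1
      rw [Finset.mem_range] at ha
      rw [List.length_take] at this
      simp at ha this
      omega
    · intro h
      exact absurd (Finset.mem_range.2 (by simp)) h
  · refine Finset.sum_eq_zero fun a _ => if_neg ?_
    rintro ⟨rfl, rfl⟩
    exact h (List.take_append_drop a K)

theorem pairNQ_mul_left (v w : NSymF k) (f : QSymF k) :
    pairNQ k (v * w) f = tensorPairing (pairNQ k) (v ⊗ₜ w) ((opsQSym k).comul f) := by
  -- On bases this is the duality of concatenation of words and deconcatenation of compositions.
  have h : ∀ I J, (pairNQ k (word k I * word k J)) =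
      tensorPairing (pairNQ k) (word k I ⊗ₜ word k J) ∘ₗ (opsQSym k).comul := by
    intro I J
    refine LinearMap.ext_on span_range_monoQSym ?_
    rintro _ ⟨K, rfl⟩
    rw [← word_append, pairNQ_word_monoQSym, LinearMap.comp_apply, comul_monoQSym, map_sum]
    simp_rw [tensorPairing_tmul, pairNQ_word_monoQSym, mul_ite, mul_one, mul_zero, ← ite_and]
    exact (sum_take_drop_eq I J K 1).symm
  have h1 : ∀ I, (pairNQ k).flip f ∘ₗ LinearMap.mulLeft k (word k I) =
      (tensorPairing (pairNQ k)).flip ((opsQSym k).comul f) ∘ₗ TensorProduct.mk k _ _ (word k I) :=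
    fun I => linearMap_ext_word fun J => LinearMap.congr_fun (h I J) f
  have h2 : (pairNQ k).flip f ∘ₗ LinearMap.mulRight k w =
      (tensorPairing (pairNQ k)).flip ((opsQSym k).comul f) ∘ₗ
        (TensorProduct.mk k _ _).flip w :=
    linearMap_ext_word fun I => LinearMap.congr_fun (h1 I) w
  exact LinearMap.congr_fun h2 v

theorem comul_ι_mul (n : ℕ+) (w : NSymF k) : (opsNSym k).comul (FreeAlgebra.ι k n * w) =
    ∑ p ∈ Finset.HasAntidiagonal.antidiagonal (n : ℕ),
      (genE k p.1 ⊗ₜ[k] genE k p.2) * (opsNSym k).comul w := by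
  change FreeAlgebra.lift k _ _ = _
  rw [map_mul, FreeAlgebra.lift_ι_apply, Finset.sum_mul]
  rfl

theorem tensorPairing_genE_mul (i j : ℕ) (z : NSymF k ⊗[k] NSymF k) (f g : QSymF k) :
    tensorPairing (pairNQ k) ((genE k i ⊗ₜ[k] genE k j) * z) (f ⊗ₜ g) =
      tensorPairing (pairNQ k) z (headQSym k i f ⊗ₜ headQSym k j g) := by
  induction z with
  | zero => simp
  | add x y hx hy => simp only [mul_add, map_add, LinearMap.add_apply, hx, hy]
  | tmul v w => simp [pairNQ_genE_mul]

theorem genE_coe (n : ℕ+) : genE k n = FreeAlgebra.ι k n := by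
  obtain ⟨n, rfl⟩ : ∃ m, Nat.succPNat m = n := ⟨n.natPred, n.succPNat_natPred⟩
  rfl

/-- Induction on the word: removing its first letter `E_a` turns the left side into the product rule
of `headQSym` and the right side into the coproduct of `E_a`. -/
theorem pairNQ_mul_right (w : NSymF k) (f g : QSymF k) :
    pairNQ k w (f * g) = tensorPairing (pairNQ k) ((opsNSym k).comul w) (f ⊗ₜ g) := by
  suffices h : ∀ (I : List ℕ+) (f g : QSymF k), pairNQ k (word k I) (f * g) =
      tensorPairing (pairNQ k) ((opsNSym k).comul (word k I)) (f ⊗ₜ g) by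
    have : (pairNQ k).flip (f * g) =
        (tensorPairing (pairNQ k)).flip (f ⊗ₜ g) ∘ₗ (opsNSym k).comul :=
      linearMap_ext_word fun I => h I f g
    exact LinearMap.congr_fun this w
  intro I
  induction I with
  | nil =>
    intro f g
    have h1 : (opsNSym k).comul (word k []) = 1 ⊗ₜ 1 := by
      change FreeAlgebra.lift k _ _ = _
      rw [word_nil, map_one]
      rfl
    rw [h1, tensorPairing_tmul, ← word_nil, pairNQ_word, pairNQ_word, pairNQ_word]
    simp only [compCoeff_nil]
    exact map_mul (MvPowerSeries.constantCoeff (σ := ℕ) (R := k)) f.1 g.1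
  | cons a I ih =>
    intro f g
    rw [word_cons, comul_ι_mul, ← genE_coe, pairNQ_genE_mul, headQSym_mul, map_sum, map_sum,
      LinearMap.sum_apply]
    refine Finset.sum_congr rfl fun p _ => ?_
    rw [tensorPairing_genE_mul, ih]

theorem isDualPair_pairNQ : IsDualPair (opsNSym k) (opsQSym k) (pairNQ k) where
  one_left f := by
    change pairNQ k 1 f = MvPowerSeries.coeff 0 f.1
    rw [← word_nil, pairNQ_word, compCoeff_nil]
  one_right w := by
    have : (pairNQ k).flip 1 = (opsNSym k).counit := by
      refine linearMap_ext_word fun I => ?_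
      change _ = FreeAlgebra.lift k _ _
      rw [LinearMap.flip_apply]
      cases I with
      | nil =>
        rw [pairNQ_word, compCoeff_nil, word_nil, map_one]
        exact MvPowerSeries.coeff_zero_one
      | cons a I =>
        rw [pairNQ_word, word_cons, map_mul, FreeAlgebra.lift_ι_apply, zero_mul]
        classical
        refine (MvPowerSeries.coeff_one _).trans (if_neg fun h => ?_)
        have h' := congrArg Finsupp.degree h
        rw [degree_expVec, map_zero, Finset.sum_eq_zero_iff] at h'
        exact (PNat.ne_zero a) (h' ⟨0, Nat.succ_pos _⟩ (Finset.mem_univ _))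
    exact LinearMap.congr_fun this w
  mul_left := pairNQ_mul_left
  mul_right := pairNQ_mul_right

theorem comulMul_opsNSym : (opsNSym k).ComulMul := comulMul_ofAlgebra _ _

/-- Multiplicativity of deconcatenation for the product of power series is not computed; it is
transported from `NSym`, where the coproduct is multiplicative by construction. -/
theorem comulMul_opsQSym : (opsQSym k).ComulMul :=
  isDualPair_pairNQ.flip.comulMul_left (LinearMap.flip_separatingLeft.2 separatingRight_pairNQ)
    comulMul_opsNSym

end QSym

/-- Equal multisets of values mean fibres of equal size, and bijections of the fibres glue. It is
used for permuting the parts of a composition and the branches of a tree. -/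
theorem exists_equiv_of_map_univ_eq {ι ι' γ : Type*} [Fintype ι] [Fintype ι'] {f : ι → γ}
    {g : ι' → γ} (h : (Finset.univ : Finset ι).val.map f = (Finset.univ : Finset ι').val.map g) :
    ∃ e : ι ≃ ι', ∀ i, g (e i) = f i := by
  classical
  have hc : ∀ c, Nonempty ({i // f i = c} ≃ {i // g i = c}) := by
    intro c
    refine ⟨Fintype.equivOfCardEq ?_⟩
    have := congrArg (Multiset.count c) h
    rw [Multiset.count_map, Multiset.count_map] at this
    rw [Fintype.card_subtype, Fintype.card_subtype, Finset.card_def, Finset.card_def,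
      Finset.filter_val, Finset.filter_val]
    simpa only [eq_comm] using this
  exact ⟨Equiv.ofFiberEquiv fun c => (hc c).some, fun i => Equiv.ofFiberEquiv_map _ i⟩

/-! ## Homomorphisms out of a free algebra -/

section FreeHom

variable {k : Type*} [Field k] {X B : Type*} [AddCommGroup B] [Module k B]

theorem map_tensor_mul {A : Type*} [Ring A] [Algebra k A] {opB : HopfOps k B} {f : A →ₗ[k] B}
    (hf : ∀ a b, f (a * b) = opB.mul (f a) (f b)) (z z' : A ⊗[k] A) :
    TensorProduct.map f f (z * z') =
      TensorProduct.map₂ opB.mul opB.mul (TensorProduct.map f f z) (TensorProduct.map f f z') := by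
  induction z with
  | zero => simp
  | add x y hx hy => simp only [add_mul, hx, hy, map_add, LinearMap.add_apply]
  | tmul a₁ a₂ =>
    induction z' with
    | zero => simp
    | add x y hx hy => simp only [mul_add, hx, hy, map_add]
    | tmul b₁ b₂ => simp [hf]

/-- A homomorphism of algebras out of a free algebra is a homomorphism of Hopf algebras if it
respects the counit and the coproduct of the generators. -/
theorem isHopfHom_of_generators {ε : FreeAlgebra k X →ₐ[k] k}
    {Δ : FreeAlgebra k X →ₐ[k] FreeAlgebra k X ⊗[k] FreeAlgebra k X} {opB : HopfOps k B}
    {f : FreeAlgebra k X →ₗ[k] B}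
    (hf : IsAlgHom (HopfOps.ofAlgebra ε.toLinearMap Δ.toLinearMap) opB f) (hB : opB.ComulMul)
    (hone : opB.comul opB.one = opB.one ⊗ₜ opB.one) (hcone : opB.counit opB.one = 1)
    (hcmul : ∀ b b', opB.counit (opB.mul b b') = opB.counit b * opB.counit b')
    (hε : ∀ x, opB.counit (f (FreeAlgebra.ι k x)) = ε (FreeAlgebra.ι k x))
    (hΔ : ∀ x, opB.comul (f (FreeAlgebra.ι k x)) =
      TensorProduct.map f f (Δ (FreeAlgebra.ι k x))) :
    IsHopfHom (HopfOps.ofAlgebra ε.toLinearMap Δ.toLinearMap) opB f := by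
  have h1 : f 1 = opB.one := hf.map_one
  have hm : ∀ a b, f (a * b) = opB.mul (f a) (f b) := hf.map_mul
  refine ⟨hf, fun a => ?_, fun a => ?_⟩
  · change _ = ε a
    have : opB.counit ∘ₗ f = ε.toLinearMap := by
      refine linearMap_ext_word fun L => ?_
      simp only [LinearMap.comp_apply, AlgHom.toLinearMap_apply]
      induction L with
      | nil => rw [word_nil, h1, hcone, map_one]
      | cons x L ih => rw [word_cons, hm, hcmul, map_mul, ih, hε]
    exact LinearMap.congr_fun this a
  · change _ = TensorProduct.map f f (Δ a)
    have : opB.comul ∘ₗ f = TensorProduct.map f f ∘ₗ Δ.toLinearMap := by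
      refine linearMap_ext_word fun L => ?_
      simp only [LinearMap.comp_apply, AlgHom.toLinearMap_apply]
      induction L with
      | nil => rw [word_nil, h1, hone, map_one, Algebra.TensorProduct.one_def,
          TensorProduct.map_tmul, h1]
      | cons x L ih => rw [word_cons, hm, hB, map_mul, ih, hΔ, map_tensor_mul hm]
    exact LinearMap.congr_fun this a

end FreeHom

/-! ## Symmetric functions -/

section Sym

variable {k : Type*} [Field k]

theorem symF_le_qsymF : SymF k ≤ QSymF k := fun _ hf => ⟨hf.1, fun l n hn => hf.2 l n hn.injective⟩

variable (k) in
/-- The inclusion of `Sym` in `QSym`. -/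
def symToQSym : SymF k →ₐ[k] QSymF k := Subalgebra.inclusion symF_le_qsymF

theorem coe_symToQSym (f : SymF k) : (symToQSym k f : MvPowerSeries ℕ k) = f := rfl

theorem symToQSym_injective : Function.Injective (symToQSym k) :=
  Subalgebra.inclusion_injective _

/-- A permutation of the exponents is an injective renaming of the variables, under which symmetric
functions are invariant. -/
theorem compCoeff_perm {I J : List ℕ+} (h : I.Perm J) (f : SymF k) :
    compCoeff I (f : MvPowerSeries ℕ k) = compCoeff J (f : MvPowerSeries ℕ k) := by
  obtain ⟨e, he⟩ := exists_equiv_of_map_univ_eq (f := I.get) (g := J.get) (by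
    rw [Fin.univ_val_map, Fin.univ_val_map, List.ofFn_get, List.ofFn_get]
    exact Multiset.coe_eq_coe.2 h)
  have : expVec (fun j : Fin I.length => (j : ℕ)) (fun j => (I.get j : ℕ)) =
      expVec (fun j : Fin J.length => (e.symm j : ℕ)) (fun j => (J.get j : ℕ)) := by
    refine Fintype.sum_equiv e _ _ fun j => ?_
    change Finsupp.single (j : ℕ) (I.get j : ℕ) =
      Finsupp.single (e.symm (e j) : ℕ) (J.get (e j) : ℕ)
    rw [he, Equiv.symm_apply_apply]
  rw [compCoeff, this]
  exact f.2.2 _ _ (Fin.val_injective.comp e.symm.injective) _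

theorem pairNQ_word_symToQSym (I : List ℕ+) (f : SymF k) :
    pairNQ k (word k I) (symToQSym k f) = symCoords k f (I : Multiset ℕ+) := by
  rw [pairNQ_word, coe_symToQSym]
  exact compCoeff_perm (Multiset.coe_eq_coe.1 (Multiset.coe_toList _).symm) f

theorem symCoords_injective : Function.Injective (symCoords k) := fun f g h =>
  symToQSym_injective (qsym_ext fun I => by rw [pairNQ_word_symToQSym, pairNQ_word_symToQSym, h])

theorem coe_expList (m : ℕ →₀ ℕ) : (expList m : Multiset ℕ) = m.support.val.map m := by
  rw [expList, ← Multiset.map_coe, Finset.sort_eq]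

theorem symCoords_monoSym (p : Multiset ℕ+) : symCoords k (monoSym k p) = Finsupp.single p 1 := by
  classical
  ext q
  change (if _ = p.map PNat.val then (1 : k) else 0) = _
  rw [← coe_expList, expList_expVec, ← Multiset.map_coe, Multiset.coe_toList,
    Finsupp.single_apply]
  simp only [(Multiset.map_injective PNat.coe_injective).eq_iff, eq_comm]

variable (k) in
/-- The basis of monomial symmetric functions. -/
def monoBasis : Module.Basis (Multiset ℕ+) k (SymF k) :=
  .ofRepr (.ofBijective (symCoords k) ⟨symCoords_injective, fun c => by
    refine ⟨c.sum fun p a => a • monoSym k p, ?_⟩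
    rw [Finsupp.sum, map_sum]
    simp only [map_smul, symCoords_monoSym, Finsupp.smul_single, smul_eq_mul, mul_one]
    exact c.sum_single⟩)

@[simp] theorem monoBasis_apply (p : Multiset ℕ+) : monoBasis k p = monoSym k p :=
  symCoords_injective (by
    rw [symCoords_monoSym]
    exact (monoBasis k).repr_self p)

variable (k) in
/-- The homomorphism `E_n ↦ e_n`. -/
def tauHom : NSymF k →ₐ[k] SymF k := FreeAlgebra.lift k (elemSym k)

@[simp] theorem tauHom_ι (n : ℕ+) : tauHom k (FreeAlgebra.ι k n) = elemSym k n :=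
  FreeAlgebra.lift_ι_apply _ _

theorem tauHom_word (I : List ℕ+) : tauHom k (word k I) = elemSymProd k (I : Multiset ℕ+) := by
  rw [word, map_list_prod, List.map_map, elemSymProd, Multiset.map_coe, Multiset.prod_coe]
  congr 2
  funext n
  simp

theorem symToQSym_elemSym (n : ℕ+) :
    symToQSym k (elemSym k n) = monoQSym k (List.replicate n 1) := by
  refine Subtype.ext (MvPowerSeries.ext fun m => ?_)
  change (if _ then (1 : k) else 0) = if _ then 1 else 0
  rw [← coe_expList, Multiset.map_replicate, ← Multiset.coe_replicate, List.map_replicate]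
  simp only [Multiset.coe_eq_coe, List.perm_replicate]

theorem monoQSym_nil : monoQSym k [] = 1 := by
  refine qsym_ext fun I => ?_
  rw [pairNQ_word_monoQSym]
  refine Eq.trans ?_ (isDualPair_pairNQ.one_right (word k I)).symm
  change _ = FreeAlgebra.lift k _ _
  cases I <;> simp

variable (k) in
/-- The composite `NSym → Sym → QSym`. -/
def tauQ : NSymF k →ₐ[k] QSymF k := (symToQSym k).comp (tauHom k)

theorem tauQ_genE (n : ℕ) : tauQ k (genE k n) = monoQSym k (List.replicate n 1) := by
  cases n with
  | zero => rw [genE, map_one, List.replicate_zero, monoQSym_nil]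
  | succ n =>
    rw [genE, tauQ, AlgHom.comp_apply, tauHom_ι, symToQSym_elemSym]
    rfl

theorem comul_genE (n : ℕ) : (opsNSym k).comul (genE k n) =
    ∑ p ∈ Finset.HasAntidiagonal.antidiagonal n, genE k p.1 ⊗ₜ[k] genE k p.2 := by
  change FreeAlgebra.lift k _ _ = _
  cases n with
  | zero => simp [genE, Algebra.TensorProduct.one_def]
  | succ n =>
    rw [genE, FreeAlgebra.lift_ι_apply]
    rfl

theorem comul_monoQSym_replicate (n : ℕ) :
    (opsQSym k).comul (monoQSym k (List.replicate n 1)) =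
      ∑ p ∈ Finset.HasAntidiagonal.antidiagonal n,
        monoQSym k (List.replicate p.1 1) ⊗ₜ[k] monoQSym k (List.replicate p.2 1) := by
  rw [comul_monoQSym, List.length_replicate, Finset.Nat.sum_antidiagonal_eq_sum_range_succ
    fun i j => monoQSym k (List.replicate i 1) ⊗ₜ[k] monoQSym k (List.replicate j 1)]
  refine Finset.sum_congr rfl fun a ha => ?_
  rw [List.take_replicate, List.drop_replicate, min_eq_left (Finset.mem_range_succ_iff.1 ha)]

theorem counit_genE (n : ℕ) : (opsNSym k).counit (genE k n) = if n = 0 then 1 else 0 := by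
  change FreeAlgebra.lift k _ _ = _
  cases n <;> simp [genE]

theorem counit_monoQSym (I : List ℕ+) :
    (opsQSym k).counit (monoQSym k I) = if I = [] then 1 else 0 := by
  rw [← isDualPair_pairNQ.one_left]
  change pairNQ k 1 _ = _
  rw [← word_nil, pairNQ_word_monoQSym]
  simp only [eq_comm]

theorem counit_one_opsQSym : (opsQSym k).counit (opsQSym k).one = 1 := by
  change (opsQSym k).counit 1 = 1
  rw [← monoQSym_nil, counit_monoQSym, if_pos rfl]

theorem counit_mul_opsQSym (f g : QSymF k) :
    (opsQSym k).counit (f * g) = (opsQSym k).counit f * (opsQSym k).counit g :=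
  map_mul (MvPowerSeries.constantCoeff (σ := ℕ) (R := k)) f.1 g.1

theorem comul_one_opsQSym : (opsQSym k).comul 1 = 1 ⊗ₜ 1 := by
  rw [← monoQSym_nil, comul_monoQSym]
  simp

/-- In `QSym` the function `e_n` is `M_(1,…,1)`, and deconcatenation shows that these are divided
powers like the `E_n`. The target is `QSym` because multiplicativity of the coproduct is already
known there. -/
theorem isHopfHom_tauQ : IsHopfHom (opsNSym k) (opsQSym k) (tauQ k).toLinearMap := by
  refine isHopfHom_of_generators ⟨map_one (tauQ k), map_mul (tauQ k)⟩ comulMul_opsQSym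
    comul_one_opsQSym counit_one_opsQSym counit_mul_opsQSym (fun n => ?_) fun n => ?_
  · rw [← genE_coe]
    refine Eq.trans ?_ (counit_genE (k := k) n).symm
    rw [AlgHom.toLinearMap_apply, tauQ_genE, counit_monoQSym]
    simp
  · rw [← genE_coe]
    refine Eq.trans ?_ (congrArg _ (comul_genE (k := k) n).symm)
    rw [AlgHom.toLinearMap_apply, tauQ_genE, comul_monoQSym_replicate, map_sum]
    simp [tauQ_genE]

/-- Both `E_n` and `M_(1^n)` are divided powers, so removing a letter from the word expands the two
sides over the same antidiagonal and reduces the claim to single letters. -/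
theorem pairNQ_genE_tauQ_comm (n : ℕ) (v : NSymF k) :
    pairNQ k v (tauQ k (genE k n)) = pairNQ k (genE k n) (tauQ k v) := by
  suffices h : ∀ (I : List ℕ+) (n : ℕ), pairNQ k (word k I) (tauQ k (genE k n)) =
      pairNQ k (genE k n) (tauQ k (word k I)) by
    have h' : (pairNQ k).flip (tauQ k (genE k n)) =
        pairNQ k (genE k n) ∘ₗ (tauQ k).toLinearMap := linearMap_ext_word fun I => h I n
    exact LinearMap.congr_fun h' v
  intro I
  induction I with
  | nil =>
    intro n
    rw [word_nil, map_one (tauQ k)]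
    refine (isDualPair_pairNQ.one_left _).trans (Eq.trans ?_ (isDualPair_pairNQ.one_right _).symm)
    exact isHopfHom_tauQ.map_counit _
  | cons m I ih =>
    intro n
    -- Since `m ≥ 1`, both pairings are `1` when `m = i = 1` and `0` otherwise.
    have h0 : ∀ i, pairNQ k (genE k m) (tauQ k (genE k i)) =
        pairNQ k (genE k i) (tauQ k (genE k m)) := by
      intro i
      obtain ⟨m, rfl⟩ : ∃ l, Nat.succPNat l = m := ⟨m.natPred, m.succPNat_natPred⟩
      have h1 : ∀ j : ℕ, genE k (j + 1) = word k [j.succPNat] := fun j => by simp [genE]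
      cases i with
      | zero =>
        rw [genE, map_one (tauQ k)]
        refine (isDualPair_pairNQ.one_right _).trans
          (Eq.trans ?_ (isDualPair_pairNQ.one_left _).symm)
        exact (isHopfHom_tauQ.map_counit _).symm
      | succ i =>
        rw [Nat.succPNat_coe, Nat.succ_eq_add_one, tauQ_genE, tauQ_genE, h1, h1,
          pairNQ_word_monoQSym, pairNQ_word_monoQSym]
        simp only [List.replicate_succ, List.cons.injEq, List.nil_eq, List.replicate_eq_nil_iff,
          ← PNat.coe_inj, Nat.succPNat_coe, PNat.one_coe]
        congr 1
        simp only [eq_iff_iff]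
        omega
    rw [word_cons, ← genE_coe, map_mul (tauQ k), pairNQ_mul_left, pairNQ_mul_right, comul_genE,
      tauQ_genE, comul_monoQSym_replicate, map_sum, map_sum, LinearMap.sum_apply]
    refine Finset.sum_congr rfl fun p _ => ?_
    rw [tensorPairing_tmul, tensorPairing_tmul, ← tauQ_genE, ← tauQ_genE, h0, ih]

/-- The bilinear form on `NSym` induced by `τ` is symmetric. -/
theorem pairNQ_tauQ_comm (v w : NSymF k) : pairNQ k v (tauQ k w) = pairNQ k w (tauQ k v) := by
  suffices h : ∀ (I : List ℕ+) (v : NSymF k), pairNQ k v (tauQ k (word k I)) =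
      pairNQ k (word k I) (tauQ k v) by
    have h' : pairNQ k v ∘ₗ (tauQ k).toLinearMap = (pairNQ k).flip (tauQ k v) :=
      linearMap_ext_word fun I => h I v
    exact LinearMap.congr_fun h' w
  intro I
  induction I with
  | nil => exact pairNQ_genE_tauQ_comm 0
  | cons n I ih =>
    intro v
    rw [word_cons, map_mul, pairNQ_mul_left, pairNQ_mul_right]
    -- As `τ` respects coproducts, both sides become sums over the terms of `Δ(v)`, one letter
    -- shorter.
    have h1 : (opsQSym k).comul (tauQ k v) = TensorProduct.map (tauQ k).toLinearMap
      (tauQ k).toLinearMap ((opsNSym k).comul v) := isHopfHom_tauQ.map_comul v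
    rw [h1]
    induction (opsNSym k).comul v with
    | zero => simp
    | add x y hx hy => simp only [map_add, LinearMap.add_apply, hx, hy]
    | tmul x y =>
      rw [TensorProduct.map_tmul, tensorPairing_tmul, tensorPairing_tmul, ih, ← genE_coe,
        pairNQ_genE_tauQ_comm]
      rfl

/-- The coefficient of `m_μ` in `e_λ` is symmetric in `λ` and `μ`. It is classically a number of 0-1
matrices, but here it comes from the symmetry of the form on `NSym`. -/
theorem symCoords_elemSymProd_comm (p q : Multiset ℕ+) :
    symCoords k (elemSymProd k p) q = symCoords k (elemSymProd k q) p := by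
  have := pairNQ_tauQ_comm (word k p.toList) (word k q.toList)
  simpa [tauQ, pairNQ_word_symToQSym, tauHom_word] using this.symm

/-! ### The fundamental theorem of symmetric functions -/

variable (k) in
/-- The homomorphism from the polynomial algebra sending the `n`th variable to `e_n`. -/
def elemHom : MvPolynomial ℕ+ k →ₐ[k] SymF k := MvPolynomial.aeval (elemSym k)

theorem elemHom_monomial (s : ℕ+ →₀ ℕ) :
    elemHom k (MvPolynomial.monomial s 1) = elemSymProd k (Finsupp.toMultiset s) := by
  rw [elemHom, MvPolynomial.aeval_monomial, map_one, one_mul, elemSymProd, Finsupp.toMultiset_map,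
    Finsupp.prod_toMultiset, Finsupp.prod_mapDomain_index (by simp) (by simp [pow_add])]

/-- Setting all but `N` variables to zero gives elementary symmetric polynomials, for which
algebraic independence is available. -/
theorem killCompl_elemSym (N : ℕ) (n : ℕ+) :
    MvPowerSeries.killCompl (R := k) (Fin.valEmbedding (n := N)) (elemSym k n : MvPowerSeries ℕ k) =
      (MvPolynomial.esymm (Fin N) k n : MvPolynomial (Fin N) k) := by
  classical
  ext m
  rw [MvPowerSeries.coeff_killCompl, MvPolynomial.coeff_coe, MvPolynomial.esymm_eq_sum_monomial,
    MvPolynomial.coeff_sum]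
  change (if _ then (1 : k) else 0) = _
  rw [expMultiset_embDomain, Multiset.map_replicate]
  simp only [MvPolynomial.coeff_monomial]
  have hind : ∀ (t : Finset (Fin N)) (i : Fin N),
      (∑ j ∈ t, Finsupp.single j 1 : Fin N →₀ ℕ) i = if i ∈ t then 1 else 0 := by
    intro t i
    simp [Finsupp.single_apply]
  have hsupp : ∀ t : Finset (Fin N), (∑ j ∈ t, Finsupp.single j 1 : Fin N →₀ ℕ).support = t := by
    intro t
    ext i
    simp [hind]
  by_cases h : m.support.val.map m = Multiset.replicate n (PNat.val 1)
  · have h1 := Multiset.eq_replicate.1 h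
    rw [if_pos h, Finset.sum_eq_single m.support]
    · rw [if_pos]
      ext i
      rw [hind]
      split_ifs with hi
      · exact (h1.2 _ (Multiset.mem_map_of_mem m hi)).symm
      · exact (Finsupp.notMem_support_iff.1 hi).symm
    · rintro t - ht
      exact if_neg fun hm => ht (by rw [← hm, hsupp])
    · intro ht
      refine absurd (Finset.mem_powersetCard_univ.2 ?_) ht
      rw [← h1.1, Multiset.card_map]
      rfl
  · rw [if_neg h]
    refine (Finset.sum_eq_zero fun t ht => if_neg ?_).symm
    rintro rfl
    refine h (Multiset.eq_replicate.2 ⟨?_, fun b hb => ?_⟩)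
    · rw [Multiset.card_map, hsupp]
      exact Finset.mem_powersetCard_univ.1 ht
    · obtain ⟨i, hi, rfl⟩ := Multiset.mem_map.1 hb
      rw [hsupp] at hi
      exact (hind t i).trans (if_pos hi)

/-- A polynomial relation involves finitely many `e_n`. With `N` at least all of these `n`,
specialization to `N` variables loses nothing, and the finite theorem applies. -/
theorem elemHom_injective : Function.Injective (elemHom k) := by
  rw [injective_iff_map_eq_zero]
  intro p hp
  obtain ⟨n, f, -, q, rfl⟩ := MvPolynomial.exists_fin_rename p
  obtain ⟨N, hN⟩ : ∃ N : ℕ, ∀ i, (f i).natPred < N :=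
    ⟨Finset.univ.sup (fun i => (f i).natPred) + 1, fun i =>
      Nat.lt_succ_of_le (Finset.le_sup (f := fun i => (f i).natPred) (Finset.mem_univ i))⟩
  let g : Fin n → Fin N := fun i => ⟨(f i).natPred, hN i⟩
  have hfg : f = (fun j : Fin N => (j : ℕ).succPNat) ∘ g := by
    funext i
    simp [g]
  have hcomp : (MvPolynomial.coeToMvPowerSeries.algHom k).comp
      ((MvPolynomial.symmetricSubalgebra (Fin N) k).val.comp
        (MvPolynomial.esymmAlgHom (Fin N) k N)) =
      (MvPowerSeries.killCompl Fin.valEmbedding).comp ((SymF k).val.comp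
        ((elemHom k).comp (MvPolynomial.rename fun j : Fin N => (j : ℕ).succPNat))) := by
    refine MvPolynomial.algHom_ext fun j => ?_
    simp only [AlgHom.comp_apply, MvPolynomial.rename_X, elemHom, MvPolynomial.aeval_X]
    refine Eq.trans ?_ (killCompl_elemSym N _).symm
    simp [MvPolynomial.esymmAlgHom]
  have hq : MvPolynomial.esymmAlgHom (Fin N) k N (MvPolynomial.rename g q) = 0 := by
    refine Subtype.ext (MvPolynomial.coe_injective _ _ ?_)
    have := DFunLike.congr_fun hcomp (MvPolynomial.rename g q)
    simp only [AlgHom.comp_apply, MvPolynomial.rename_rename, ← hfg, hp, map_zero] at this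
    simpa using this
  have := MvPolynomial.esymmAlgHom_fin_injective (R := k) le_rfl (hq.trans (map_zero _).symm)
  rw [hfg, ← MvPolynomial.rename_rename, this, map_zero]

theorem linearIndependent_elemSymProd : LinearIndependent k (elemSymProd k) := by
  have h := (MvPolynomial.basisMonomials ℕ+ k).linearIndependent.map' (elemHom k).toLinearMap
    (LinearMap.ker_eq_bot.2 elemHom_injective)
  have h' := h.comp Multiset.toFinsupp Multiset.toFinsupp.injective
  have he : elemSymProd k = ((elemHom k).toLinearMap ∘ MvPolynomial.basisMonomials ℕ+ k) ∘
      Multiset.toFinsupp := by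
    funext p
    simp [elemHom_monomial]
  rw [he]
  exact h'

theorem degree_eq_of_coeff_elemSymProd_ne_zero (p : Multiset ℕ+) {m : ℕ →₀ ℕ}
    (hm : MvPowerSeries.coeff m (elemSymProd k p : MvPowerSeries ℕ k) ≠ 0) :
    m.degree = (p.map PNat.val).sum := by
  classical
  induction p using Multiset.induction_on generalizing m with
  | empty =>
    have : (elemSymProd k 0 : MvPowerSeries ℕ k) = 1 := rfl
    rw [this, MvPowerSeries.coeff_one] at hm
    obtain rfl : m = 0 := by
      by_contra h
      exact hm (if_neg h)
    simp
  | cons n p ih =>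
    have : (elemSymProd k (n ::ₘ p) : MvPowerSeries ℕ k) = elemSym k n * elemSymProd k p := by
      simp [elemSymProd]
    rw [this, MvPowerSeries.coeff_mul] at hm
    obtain ⟨q, hq, hne⟩ := Finset.exists_ne_zero_of_sum_ne_zero hm
    rw [← Finset.HasAntidiagonal.mem_antidiagonal.1 hq, map_add, ih (right_ne_zero_of_mul hne),
      Multiset.map_cons, Multiset.sum_cons]
    congr 1
    have h1 : q.1.support.val.map q.1 = (Multiset.replicate (n : ℕ) (1 : ℕ+)).map PNat.val := by
      by_contra h
      exact left_ne_zero_of_mul hne (if_neg h)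
    rw [← sum_expMultiset, h1]
    simp

theorem symCoords_elemSymProd_eq_zero {p q : Multiset ℕ+}
    (h : (q.map PNat.val).sum ≠ (p.map PNat.val).sum) : symCoords k (elemSymProd k p) q = 0 := by
  by_contra hne
  have := degree_eq_of_coeff_elemSymProd_ne_zero p hne
  rw [degree_expVec] at this
  refine h (Eq.trans ?_ this)
  conv_lhs => rw [← Multiset.coe_toList q, ← List.ofFn_get q.toList, Multiset.map_coe,
    List.map_ofFn, Multiset.sum_coe, List.sum_ofFn]
  rfl

theorem finite_weight_eq (n : ℕ) : {p : Multiset ℕ+ | (p.map PNat.val).sum = n}.Finite := by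
  refine ((finite_sum_le n).image (fun I : List ℕ+ => (I : Multiset ℕ+))).subset fun p hp => ?_
  refine ⟨p.toList, ?_, Multiset.coe_toList p⟩
  rw [Set.mem_ofPred_eq, ← Multiset.sum_coe, ← Multiset.map_coe, Multiset.coe_toList]
  exact le_of_eq hp

/-- No triangularity is needed. The matrix expressing `e_λ` in the `m_μ` preserves the weight, and
the partitions of given weight are finite in number, so injectivity on that block, which is linear
independence, gives surjectivity. -/
theorem span_range_elemSymProd : Submodule.span k (Set.range (elemSymProd k)) = ⊤ := by
  rw [eq_top_iff, ← (monoBasis k).span_eq, Submodule.span_le]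
  rintro _ ⟨q, rfl⟩
  rw [monoBasis_apply]
  let s : Set (Multiset ℕ+) := {p | (p.map PNat.val).sum = (q.map PNat.val).sum}
  have hs : s.Finite := finite_weight_eq _
  let T : (Multiset ℕ+ →₀ k) →ₗ[k] (Multiset ℕ+ →₀ k) :=
    symCoords k ∘ₗ Finsupp.linearCombination k (elemSymProd k)
  have hT : ∀ c ∈ Finsupp.supported k k s, T c ∈ Finsupp.supported k k s := by
    intro c hc
    rw [Finsupp.mem_supported'] at hc ⊢
    intro p hp
    simp only [T, LinearMap.comp_apply, Finsupp.linearCombination_apply, Finsupp.sum, map_sum,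
      map_smul, Finsupp.finsetSum_apply, Finsupp.smul_apply, smul_eq_mul]
    refine Finset.sum_eq_zero fun r _ => ?_
    by_cases hr : r ∈ s
    · rw [symCoords_elemSymProd_eq_zero, mul_zero]
      exact fun h => hp (h.trans hr)
    · rw [hc r hr, zero_mul]
  have hinj : Function.Injective (T.restrict hT) := by
    intro c c' h
    exact Subtype.ext (linearIndependent_elemSymProd (symCoords_injective (congrArg Subtype.val h)))
  have : Finite s := hs
  have : FiniteDimensional k (Finsupp.supported k k s) :=
    Module.Finite.equiv (Finsupp.supportedEquivFinsupp s).symm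
  have hsurj : Function.Surjective (T.restrict hT) := 
    @LinearMap.surjective_of_injective k (Finsupp.supported k k s) _ _ _ _ (T.restrict hT) hinj
  obtain ⟨c, hc⟩ := hsurj ⟨Finsupp.single q 1, Finsupp.single_mem_supported k 1 rfl⟩
  have hc' : Finsupp.linearCombination k (elemSymProd k) c.1 = monoSym k q :=
    symCoords_injective ((congrArg Subtype.val hc).trans (symCoords_monoSym q).symm)
  rw [SetLike.mem_coe, ← hc']
  exact Finsupp.mem_span_range_iff_exists_finsupp.2 ⟨c.1, rfl⟩

variable (k) in
/-- The basis of products of elementary symmetric functions. -/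
def elemBasis : Module.Basis (Multiset ℕ+) k (SymF k) :=
  .mk linearIndependent_elemSymProd span_range_elemSymProd.ge

@[simp] theorem elemBasis_apply (p : Multiset ℕ+) : elemBasis k p = elemSymProd k p :=
  Module.Basis.mk_apply _ _ _

theorem tauHom_surjective : Function.Surjective (tauHom k) := by
  rw [← AlgHom.coe_toLinearMap, ← LinearMap.range_eq_top, eq_top_iff, ← span_range_elemSymProd,
    Submodule.span_le]
  rintro _ ⟨p, rfl⟩
  exact ⟨word k p.toList, by rw [AlgHom.toLinearMap_apply, tauHom_word, Multiset.coe_toList]⟩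

theorem elemHom_bijective : Function.Bijective (elemHom k) := by
  refine ⟨elemHom_injective, ?_⟩
  rw [← AlgHom.coe_toLinearMap, ← LinearMap.range_eq_top, eq_top_iff, ← span_range_elemSymProd,
    Submodule.span_le]
  rintro _ ⟨p, rfl⟩
  exact ⟨MvPolynomial.monomial (Multiset.toFinsupp p) 1, by
    rw [AlgHom.toLinearMap_apply, elemHom_monomial, Multiset.toFinsupp_toMultiset]⟩

/-! ### The inner product -/

variable (k) in
/-- The inner product with `(e_λ, m_μ) = δ_{λ,μ}`. -/
def symForm : SymF k →ₗ[k] SymF k →ₗ[k] k :=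
  (elemBasis k).constr k fun p => Finsupp.lapply p ∘ₗ symCoords k

theorem symForm_elemSymProd (p : Multiset ℕ+) (f : SymF k) :
    symForm k (elemSymProd k p) f = symCoords k f p := by
  rw [symForm, ← elemBasis_apply, Module.Basis.constr_basis]
  rfl

theorem symForm_elemSymProd_monoSym (p q : Multiset ℕ+) :
    symForm k (elemSymProd k p) (monoSym k q) = if p = q then 1 else 0 := by
  rw [symForm_elemSymProd, symCoords_monoSym, Finsupp.single_apply]
  simp only [eq_comm]

theorem symForm_unique {F : SymF k →ₗ[k] SymF k →ₗ[k] k}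
    (h : ∀ p q, F (elemSymProd k p) (monoSym k q) = if p = q then 1 else 0) : F = symForm k :=
  (elemBasis k).ext fun p => (monoBasis k).ext fun q => by
    rw [elemBasis_apply, monoBasis_apply, h, symForm_elemSymProd_monoSym]

/-- This identifies `τ*` with the inclusion of `Sym` in `QSym`. -/
theorem symForm_tauHom (w : NSymF k) (f : SymF k) :
    symForm k (tauHom k w) f = pairNQ k w (symToQSym k f) := by
  have : (symForm k).flip f ∘ₗ (tauHom k).toLinearMap = (pairNQ k).flip (symToQSym k f) :=
    linearMap_ext_word fun I => by
      rw [LinearMap.comp_apply, LinearMap.flip_apply, LinearMap.flip_apply,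
        AlgHom.toLinearMap_apply, tauHom_word, symForm_elemSymProd, pairNQ_word_symToQSym]
  exact LinearMap.congr_fun this w

theorem symForm_comm (f g : SymF k) : symForm k f g = symForm k g f := by
  have : symForm k = (symForm k).flip := (elemBasis k).ext fun p => (elemBasis k).ext fun q => by
    rw [elemBasis_apply, elemBasis_apply, LinearMap.flip_apply, symForm_elemSymProd,
      symForm_elemSymProd, symCoords_elemSymProd_comm]
  exact LinearMap.congr_fun₂ this f g

theorem separatingRight_symForm : (symForm k).SeparatingRight := by
  intro f hf
  refine symCoords_injective (Finsupp.ext fun p => ?_)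
  rw [← symForm_elemSymProd, hf, map_zero, Finsupp.zero_apply]

theorem comul_monoSym (p : Multiset ℕ+) : (opsSym k).comul (monoSym k p) =
    ∑ q ∈ p.antidiagonal.toFinset, monoSym k q.1 ⊗ₜ[k] monoSym k q.2 := by
  change (Finsupp.lsum k _) (symCoords k (monoSym k p)) = _
  rw [symCoords_monoSym, Finsupp.lsum_single, LinearMap.toSpanSingleton_apply, one_smul]

/-- In the dual bases, `e_λ e_μ = e_{λ ∪ μ}` is the transpose of the coproduct on the `m_λ`. -/
theorem symForm_mul_left (f g h : SymF k) :
    symForm k (f * g) h = tensorPairing (symForm k) (f ⊗ₜ g) ((opsSym k).comul h) := by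
  classical
  have h0 : ∀ p q, symForm k (elemSymProd k p * elemSymProd k q) =
      tensorPairing (symForm k) (elemSymProd k p ⊗ₜ elemSymProd k q) ∘ₗ (opsSym k).comul := by
    intro p q
    refine (monoBasis k).ext fun r => ?_
    have : elemSymProd k p * elemSymProd k q = elemSymProd k (p + q) := by
      simp [elemSymProd]
    rw [this, monoBasis_apply, symForm_elemSymProd_monoSym, LinearMap.comp_apply, comul_monoSym,
      map_sum]
    simp_rw [tensorPairing_tmul, symForm_elemSymProd_monoSym, mul_ite, mul_one, mul_zero,
      ← ite_and]
    have : ∀ x : Multiset ℕ+ × Multiset ℕ+, (q = x.2 ∧ p = x.1) = ((p, q) = x) := by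
      rintro ⟨x, y⟩
      simp [and_comm]
    simp_rw [this, Finset.sum_ite_eq, Multiset.mem_toFinset, Multiset.mem_antidiagonal]
  have h1 : ∀ p, (symForm k).flip h ∘ₗ LinearMap.mulLeft k (elemSymProd k p) =
      (tensorPairing (symForm k)).flip ((opsSym k).comul h) ∘ₗ
        TensorProduct.mk k _ _ (elemSymProd k p) := fun p => (elemBasis k).ext fun q => by
    rw [elemBasis_apply]
    exact LinearMap.congr_fun (h0 p q) h
  have h2 : (symForm k).flip h ∘ₗ LinearMap.mulRight k g =
      (tensorPairing (symForm k)).flip ((opsSym k).comul h) ∘ₗ (TensorProduct.mk k _ _).flip g :=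
    (elemBasis k).ext fun p => by
      rw [elemBasis_apply]
      exact LinearMap.congr_fun (h1 p) g
  exact LinearMap.congr_fun h2 f

theorem symForm_one_left (f : SymF k) : symForm k 1 f = (opsSym k).counit f := by
  rw [← map_one (tauHom k), symForm_tauHom]
  exact isDualPair_pairNQ.one_left _

/-- By symmetry of the form, either half of the self-duality yields the other half. -/
theorem isDualPair_symForm : IsDualPair (opsSym k) (opsSym k) (symForm k) where
  one_left := symForm_one_left
  one_right f := (symForm_comm _ _).trans (symForm_one_left f)
  mul_left := symForm_mul_left
  mul_right f g h := by
    refine (symForm_comm _ _).trans ((symForm_mul_left g h f).trans ?_)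
    have : symForm k = (symForm k).flip := LinearMap.ext₂ symForm_comm
    conv_lhs => rw [this, tensorPairing_flip]

theorem symForm_tauHom_toLinearMap (w : NSymF k) (f : SymF k) :
    pairNQ k w ((symToQSym k).toLinearMap f) = symForm k ((tauHom k).toLinearMap w) f :=
  (symForm_tauHom w f).symm

theorem tauHom_toLinearMap_mul (a b : NSymF k) : (tauHom k).toLinearMap ((opsNSym k).mul a b) =
    (opsSym k).mul ((tauHom k).toLinearMap a) ((tauHom k).toLinearMap b) :=
  map_mul (tauHom k) a b

/-- The inclusion is adjoint to `τ`, so it respects coproducts because `τ` respects products. -/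
theorem comul_symToQSym (f : SymF k) : (opsQSym k).comul ((symToQSym k).toLinearMap f) =
    TensorProduct.map (symToQSym k).toLinearMap (symToQSym k).toLinearMap
      ((opsSym k).comul f) :=
  comul_adjoint (p := pairNQ k) (q := symForm k) (opA := opsNSym k) (opA' := opsSym k)
    (f := (tauHom k).toLinearMap) pairNQ_mul_left symForm_mul_left tauHom_toLinearMap_mul
    separatingRight_pairNQ symForm_tauHom_toLinearMap f

theorem symToQSym_toLinearMap_one : (symToQSym k).toLinearMap (opsSym k).one = (opsQSym k).one :=
  map_one (symToQSym k)

theorem symToQSym_toLinearMap_mul (f g : SymF k) : (symToQSym k).toLinearMap ((opsSym k).mul f g) =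
    (opsQSym k).mul ((symToQSym k).toLinearMap f) ((symToQSym k).toLinearMap g) :=
  map_mul (symToQSym k) f g

theorem isHopfHom_symToQSym : IsHopfHom (opsSym k) (opsQSym k) (symToQSym k).toLinearMap where
  map_one := symToQSym_toLinearMap_one
  map_mul := symToQSym_toLinearMap_mul
  map_counit _ := rfl
  map_comul := comul_symToQSym

/-- The composite with the injective Hopf map `Sym → QSym` is already known to be a Hopf map. -/
theorem isHopfHom_tauHom : IsHopfHom (opsNSym k) (opsSym k) (tauHom k).toLinearMap :=
  IsHopfHom.of_comp_injective isHopfHom_tauQ isHopfHom_symToQSym symToQSym_injective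

end Sym

/-! ## Sums over attachments -/

section Splitting

variable {α M : Type*} [AddCommMonoid M]

/-- The sum of `Φ B C` over all `B, C` with `B ++ C = A`. -/
def deconcSum : List α → (List α → List α → M) → M
  | [], Φ => Φ [] []
  | a :: A, Φ => Φ [] (a :: A) + deconcSum A fun B C => Φ (a :: B) C

theorem sum_range_take_drop (A : List α) (Φ : List α → List α → M) :
    ∑ a ∈ Finset.range (A.length + 1), Φ (A.take a) (A.drop a) = deconcSum A Φ := by
  induction A generalizing Φ with
  | nil => simp [deconcSum]
  | cons a A ih =>
    rw [List.length_cons, Finset.sum_range_succ', deconcSum, ← ih, add_comm]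
    simp

theorem deconcSum_eq_of_cons_eq_zero (A : List α) (Φ : List α → List α → M)
    (h : ∀ b B C, Φ (b :: B) C = 0) : deconcSum A Φ = Φ [] A := by
  cases A with
  | nil => rfl
  | cons a A =>
    have : ∀ A : List α, deconcSum A (fun B C => Φ (a :: B) C) = 0 := by
      intro A
      rw [← sum_range_take_drop]
      exact Finset.sum_eq_zero fun i _ => h _ _ _
    rw [deconcSum, this, add_zero]

theorem deconcSum_sum {ι : Type*} (s : Finset ι) (A : List α) (Φ : ι → List α → List α → M) :
    deconcSum A (fun B C => ∑ i ∈ s, Φ i B C) = ∑ i ∈ s, deconcSum A (Φ i) := by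
  simp only [← sum_range_take_drop]
  exact Finset.sum_comm

theorem deconcSum_add (A : List α) (Φ Φ' : List α → List α → M) :
    deconcSum A (fun B C => Φ B C + Φ' B C) = deconcSum A Φ + deconcSum A Φ' := by
  simp only [← sum_range_take_drop, Finset.sum_add_distrib]

theorem deconcSum_mul {R : Type*} [NonUnitalNonAssocSemiring R] (c : R) (A : List α)
    (Φ : List α → List α → R) :
    deconcSum A (fun B C => c * Φ B C) = c * deconcSum A Φ := by
  simp only [← sum_range_take_drop, Finset.mul_sum]

theorem deconcSum_zero (A : List α) : deconcSum A (fun _ _ => (0 : M)) = 0 := by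
  simp only [← sum_range_take_drop, Finset.sum_const_zero]

theorem deconcSum_ite [DecidableEq α] (A I J : List α) (c : M) :
    deconcSum A (fun B C => if J = C ∧ I = B then c else 0) = if I ++ J = A then c else 0 := by
  rw [← sum_take_drop_eq, ← sum_range_take_drop]

end Splitting

/-! ### Distributing the entries of a list over a set of points -/

section Fiber

variable {α P : Type*}

open Classical in
/-- Add `a` in front of the list at `p`. -/
def consAt (p : P) (a : α) (F : P → List α) : P → List α :=
  fun q => if p = q then a :: F q else F q

theorem consAt_comp {Q : Type*} {i : Q → P} (hi : Function.Injective i) (x : Q) (a : α)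
    (F : P → List α) : consAt (i x) a F ∘ i = consAt x a (F ∘ i) := by
  funext y
  by_cases h : x = y
  · subst h
    simp [consAt]
  · have h' : i x ≠ i y := fun h' => h (hi h')
    simp [consAt, h, h']

theorem consAt_comp_of_ne {Q : Type*} {j : Q → P} {p : P} (hj : ∀ y, p ≠ j y) (a : α)
    (F : P → List α) : consAt p a F ∘ j = F ∘ j := by
  funext y
  simp [consAt, hj]

open Classical in
/-- The list of the entries of `A` that `f` sends to `p`, for every `p`. -/
def fiberList (A : List α) (f : Fin A.length → P) : P → List α :=
  fun p => ((List.finRange _).filter fun i => f i = p).map A.get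

/-- An assignment of `a :: A` is a point for `a` and an assignment of `A`; this recursion replaces
sums over functions by sums over lists. -/
theorem fiberList_cons (a : α) (A : List α) (p : P) (f : Fin A.length → P) :
    fiberList (a :: A) (Fin.cons p f : Fin (A.length + 1) → P) = consAt p a (fiberList A f) := by
  funext q
  classical
  have ht : ((List.finRange A.length).filter fun i =>
      decide ((Fin.cons p f : Fin (A.length + 1) → P) i.succ = q)) =
      (List.finRange A.length).filter fun i => decide (f i = q) :=
    List.filter_congr fun i _ => decide_eq_decide.2 Iff.rfl
  have h : fiberList (a :: A) (Fin.cons p f : Fin (A.length + 1) → P) q =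
      (((0 : Fin (A.length + 1)) :: (List.finRange A.length).map Fin.succ).filter fun i =>
        decide ((Fin.cons p f : Fin (A.length + 1) → P) i = q)).map (a :: A).get := by
    rw [← List.finRange_succ, fiberList]
    congr 1
  rw [h, List.filter_cons, List.filter_map, Function.comp_def, ht]
  by_cases hp : p = q <;> simp [consAt, fiberList, hp]

end Fiber

/-! ### Order-preserving distributions -/

section MonoSum

variable {α M P : Type*} [AddCommMonoid M] [Preorder P] [Fintype P]

open Classical in
/-- The sum of `Ψ (fiberList A f)` over all monotone functions `f` with values in `s`. -/
def monoSum (s : P → Prop) : List α → ((P → List α) → M) → M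
  | [], Ψ => Ψ fun _ => []
  | a :: A, Ψ => ∑ p with s p, monoSum (fun q => s q ∧ p ≤ q) A fun F => Ψ (consAt p a F)

-- Once the first entry is at `p`, the later ones must lie above `p`. The predicate `s` carries this
-- restriction through the recursion.
open Classical in
theorem sum_monotone_eq_monoSum (s : P → Prop) (A : List α) (Ψ : (P → List α) → M) :
    ∑ f : Fin A.length → P with Monotone f ∧ ∀ i, s (f i), Ψ (fiberList A f) = monoSum s A Ψ := by
  induction A generalizing s Ψ with
  | nil =>
    have : Unique (Fin ([] : List α).length → P) := inferInstanceAs (Unique (Fin 0 → P))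
    rw [Finset.sum_filter, Fintype.sum_unique, if_pos, monoSum]
    · congr 1
    · exact ⟨fun i => i.elim0, fun i => i.elim0⟩
  | cons a A ih =>
    have hmono : ∀ (p : P) (f : Fin A.length → P),
        (Monotone (Fin.cons p f : Fin (A.length + 1) → P) ∧
          ∀ i, s ((Fin.cons p f : Fin (A.length + 1) → P) i)) ↔
        s p ∧ Monotone f ∧ ∀ i, s (f i) ∧ p ≤ f i := by
      intro p f
      rw [Fin.forall_fin_succ]
      simp only [Fin.cons_zero, Fin.cons_succ]
      constructor
      · rintro ⟨h1, h2, h3⟩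
        refine ⟨h2, fun i j hij => ?_, fun i => ⟨h3 i, ?_⟩⟩
        · simpa using h1 (Fin.succ_le_succ_iff.2 hij)
        · simpa using h1 (Fin.zero_le i.succ)
      · rintro ⟨h1, h2, h3⟩
        refine ⟨fun i j => ?_, h1, fun i => (h3 i).1⟩
        refine Fin.cases ?_ (fun i => ?_) i <;> refine Fin.cases ?_ (fun j => ?_) j
        · simp
        · simpa using (h3 j).2
        · simp
        · simpa using fun h => h2 h
    rw [monoSum, Finset.sum_filter, Finset.sum_filter]
    refine ((Fin.consEquiv fun _ => P).sum_comp _).symm.trans ?_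
    rw [Fintype.sum_prod_type]
    refine Finset.sum_congr rfl fun p _ => ?_
    split_ifs with hp
    · rw [← ih, Finset.sum_filter]
      refine Finset.sum_congr rfl fun f _ => ?_
      have : (Fin.consEquiv fun _ => P) (p, f) = (Fin.cons p f : Fin (A.length + 1) → P) := rfl
      rw [this, fiberList_cons]
      by_cases hf : Monotone f ∧ ∀ i, s (f i) ∧ p ≤ f i
      · exact (if_pos ((hmono p f).2 ⟨hp, hf⟩)).trans (if_pos hf).symm
      · exact (if_neg fun h => hf ((hmono p f).1 h).2).trans (if_neg hf).symm
    · exact Finset.sum_eq_zero fun f _ => if_neg fun h => hp ((hmono p f).1 h).1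

theorem monoSum_false (a : α) (A : List α) (Ψ : (P → List α) → M) :
    monoSum (fun _ => False) (a :: A) Ψ = 0 := by
  rw [monoSum]
  simp

theorem monoSum_zero (s : P → Prop) (A : List α) : monoSum s A (fun _ => (0 : M)) = 0 := by
  classical
  rw [← sum_monotone_eq_monoSum, Finset.sum_const_zero]

theorem monoSum_mul {R : Type*} [NonUnitalNonAssocSemiring R] (c : R) (s : P → Prop) (A : List α)
    (Ψ : (P → List α) → R) : monoSum s A (fun F => c * Ψ F) = c * monoSum s A Ψ := by
  classical
  rw [← sum_monotone_eq_monoSum, ← sum_monotone_eq_monoSum, Finset.mul_sum]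

theorem monoSum_mul_right {R : Type*} [NonUnitalNonAssocSemiring R] (c : R) (s : P → Prop)
    (A : List α) (Ψ : (P → List α) → R) :
    monoSum s A (fun F => Ψ F * c) = monoSum s A Ψ * c := by
  classical
  rw [← sum_monotone_eq_monoSum, ← sum_monotone_eq_monoSum, Finset.sum_mul]

/-- Monotone functions into a linear sum of two ordered sets. -/
theorem monoSum_linearSum {P₁ P₂ : Type*} [Preorder P₁] [Fintype P₁] [Preorder P₂] [Fintype P₂]
    {i : P₁ → P} {j : P₂ → P} (hb : Function.Bijective (Sum.elim i j))
    (hii : ∀ x x', i x ≤ i x' ↔ x ≤ x') (hjj : ∀ y y', j y ≤ j y' ↔ y ≤ y')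
    (hij : ∀ x y, i x ≤ j y) (hji : ∀ x y, ¬j y ≤ i x) (s : P → Prop) (A : List α)
    (Ψ : (P₁ → List α) → (P₂ → List α) → M) :
    monoSum s A (fun F => Ψ (F ∘ i) (F ∘ j)) = deconcSum A fun B C =>
      monoSum (s ∘ i) B fun F => monoSum (s ∘ j) C fun G => Ψ F G := by
  classical
  have hi : Function.Injective i := fun x x' h => by
    simpa using hb.1 (a₁ := .inl x) (a₂ := .inl x') h
  have hj : Function.Injective j := fun x x' h => by
    simpa using hb.1 (a₁ := .inr x) (a₂ := .inr x') h
  have hne : ∀ x y, i x ≠ j y := fun x y h => hji x y h.ge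
  induction A generalizing s Ψ with
  | nil => rfl
  | cons a A ih =>
    rw [monoSum, deconcSum, Finset.sum_filter, ← (Equiv.ofBijective _ hb).sum_comp,
      Fintype.sum_sum_type, add_comm]
    congr 1
    · rw [monoSum, monoSum, Finset.sum_filter]
      refine Finset.sum_congr rfl fun y _ => ?_
      simp only [Equiv.ofBijective_apply, Sum.elim_inr, Function.comp_apply]
      refine if_congr Iff.rfl ?_ rfl
      -- With an entry at `j y`, no later entry can be in the first summand, so only the empty
      -- initial segment contributes.
      have := ih (fun q => s q ∧ j y ≤ q) fun F G => Ψ F (consAt y a G)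
      simp only [← consAt_comp hj] at this
      simp only [consAt_comp_of_ne (fun x => (hne x y).symm)]
      rw [this, deconcSum_eq_of_cons_eq_zero]
      · simp only [monoSum, Function.comp_def, hjj]
      · intro b B C
        have : (fun q => s q ∧ j y ≤ q) ∘ i = fun _ => False := by
          funext x
          simp [hji]
        rw [this, monoSum_false]
    · simp only [monoSum, Finset.sum_filter]
      rw [deconcSum_sum]
      refine Finset.sum_congr rfl fun x _ => ?_
      simp only [Equiv.ofBijective_apply, Sum.elim_inl, Function.comp_apply]
      split_ifs with hx
      · have := ih (fun q => s q ∧ i x ≤ q) fun F G => Ψ (consAt x a F) G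
        simp only [← consAt_comp hi] at this
        simp only [consAt_comp_of_ne (hne x)]
        rw [this]
        simp only [Function.comp_def, hii, hij, and_true]
      · rw [deconcSum_zero]

theorem monoSum_unique [Unique P] {s : P → Prop} (hs : s default) (A : List α) (Ψ : List α → M) :
    monoSum s A (fun F => Ψ (F default)) = Ψ A := by
  classical
  induction A generalizing s Ψ with
  | nil => rfl
  | cons a A ih =>
    rw [monoSum, Finset.sum_filter, Fintype.sum_unique, if_pos hs]
    have := ih (s := fun q => s q ∧ (default : P) ≤ q) ⟨hs, le_rfl⟩ fun L => Ψ (a :: L)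
    rw [← this]
    simp [consAt]

end MonoSum

/-! ## Planar rooted trees -/

namespace PTree

theorem node_congr {m n : ℕ} (h : m = n) {c : Fin m → PTree} {d : Fin n → PTree}
    (hc : ∀ i, c i = d (Fin.cast h i)) : node m c = node n d := by
  subst h
  exact congrArg _ (funext hc)

@[simp] theorem children_ofList (L : List PTree) : (ofList L).children = L := List.ofFn_get L

@[simp] theorem ofList_children : ∀ T : PTree, ofList T.children = T
  | node _ c => node_congr List.length_ofFn fun i => List.get_ofFn c i

theorem ofList_eq_iff {L : List PTree} {T : PTree} : ofList L = T ↔ L = T.children :=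
  ⟨fun h => by rw [← h, children_ofList], fun h => by rw [h, ofList_children]⟩

theorem children_injective : Function.Injective children :=
  Function.LeftInverse.injective ofList_children

/-- Induction on the branches. -/
theorem list_induction {Q : PTree → Prop} (h : ∀ L : List PTree, (∀ T ∈ L, Q T) → Q (ofList L))
    (T : PTree) : Q T := by
  induction T with
  | node n c ih =>
    rw [← ofList_children (node n c)]
    refine h _ fun T hT => ?_
    obtain ⟨i, rfl⟩ := (List.mem_ofFn' c T).1 hT
    exact ih i

/-- The inclusion of the attachment points that come after the first branch. -/
def ptShift {n : ℕ} (c : Fin (n + 1) → PTree) (p : (node n fun i => c i.succ).Pt) :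
    (node (n + 1) c).Pt :=
  WithTop.map (fun q : Σₗ i : Fin n, WithBot (c i.succ).Pt =>
    (toLex ⟨(ofLex q).1.succ, (ofLex q).2⟩ : Σₗ i : Fin (n + 1), WithBot (c i).Pt)) p

/-- The attachment points of the first branch and the point of the root in front of it. -/
def ptFirst {n : ℕ} (c : Fin (n + 1) → PTree) (p : WithBot (c 0).Pt) : (node (n + 1) c).Pt :=
  WithTop.some (toLex ⟨0, p⟩ : Σₗ i : Fin (n + 1), WithBot (c i).Pt)

theorem children_planarGraft_zero (c : Fin 0 → PTree) (F : (node 0 c).Pt → List PTree) :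
    ((node 0 c).planarGraft F).children = F (⊤ : WithTop (Σₗ i : Fin 0, WithBot (c i).Pt)) := by
  rw [planarGraft, children_ofList]
  simp

/-- The new branches are, in order, those attached to the root before the first branch, the modified
first branch, and everything coming from the remaining attachment points. -/
theorem children_planarGraft_succ {n : ℕ} (c : Fin (n + 1) → PTree)
    (F : (node (n + 1) c).Pt → List PTree) :
    ((node (n + 1) c).planarGraft F).children =
      (F ∘ ptFirst c) ⊥ ++ (c 0).planarGraft ((F ∘ ptFirst c) ∘ WithBot.some) ::
        ((node n fun i => c i.succ).planarGraft (F ∘ ptShift c)).children := by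
  rw [planarGraft, planarGraft, children_ofList, children_ofList, List.ofFn_succ]
  simp only [List.flatten_cons, List.append_assoc, List.cons_append]
  rfl

theorem ptFirst_le_ptFirst {n : ℕ} (c : Fin (n + 1) → PTree) (x y : WithBot (c 0).Pt) :
    ptFirst c x ≤ ptFirst c y ↔ x ≤ y := by
  refine WithTop.coe_le_coe.trans (Sigma.Lex.le_def.trans ⟨?_, fun h => Or.inr ⟨rfl, h⟩⟩)
  rintro (h | ⟨_, h⟩)
  · exact absurd h (lt_irrefl _)
  · exact h

theorem ptShift_le_ptShift {n : ℕ} (c : Fin (n + 1) → PTree)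
    (x y : (node n fun i => c i.succ).Pt) : ptShift c x ≤ ptShift c y ↔ x ≤ y := by
  refine WithTop.map_le_iff _ ?_
  rintro ⟨i', y⟩ ⟨i, x⟩
  refine Sigma.Lex.le_def.trans (Iff.trans ⟨?_, ?_⟩ Sigma.Lex.le_def.symm)
  · rintro (h | ⟨h, h'⟩)
    · exact Or.inl (Fin.succ_lt_succ_iff.1 h)
    · obtain rfl : i = i' := Fin.succ_injective _ h
      exact Or.inr ⟨rfl, h'⟩
  · rintro (h | ⟨h, h'⟩)
    · exact Or.inl (Fin.succ_lt_succ_iff.2 h)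
    · obtain rfl : i = i' := h
      exact Or.inr ⟨rfl, h'⟩

theorem ptFirst_lt_ptShift {n : ℕ} (c : Fin (n + 1) → PTree) (x : WithBot (c 0).Pt)
    (y : (node n fun i => c i.succ).Pt) : ptFirst c x < ptShift c y := by
  cases y using WithTop.recTopCoe with
  | top => exact WithTop.coe_lt_top _
  | coe y =>
    obtain ⟨i, y⟩ := y
    exact WithTop.coe_lt_coe.2 (Sigma.Lex.lt_def.2 (Or.inl (Fin.succ_pos i)))

/-- With the order lemmas above, this presents the attachment points as a linear sum of the block of
the first branch and the points of the remaining tree. -/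
theorem bijective_ptFirst_ptShift {n : ℕ} (c : Fin (n + 1) → PTree) :
    Function.Bijective (Sum.elim (ptFirst c) (ptShift c)) := by
  refine ⟨Function.Injective.sumElim (fun x y h => ?_) (fun x y h => ?_)
    fun x y => (ptFirst_lt_ptShift c x y).ne, fun p => ?_⟩
  · exact le_antisymm ((ptFirst_le_ptFirst c x y).1 h.le) ((ptFirst_le_ptFirst c y x).1 h.ge)
  · exact le_antisymm ((ptShift_le_ptShift c x y).1 h.le) ((ptShift_le_ptShift c y x).1 h.ge)
  · cases p using WithTop.recTopCoe with
    | top => exact ⟨Sum.inr (⊤ : WithTop (Σₗ i : Fin n, WithBot (c i.succ).Pt)), rfl⟩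
    | coe p =>
      obtain ⟨i, p⟩ := p
      cases i using Fin.cases with
      | zero => exact ⟨Sum.inl p, rfl⟩
      | succ i =>
        exact ⟨Sum.inr (WithTop.some (toLex ⟨i, p⟩ : Σₗ i : Fin n, WithBot (c i.succ).Pt)), rfl⟩

/-- The sum over all ways of attaching the forest `A` to `T`, in order. -/
def planarSum {M : Type*} [AddCommMonoid M] (A : List PTree) (T : PTree) (Ψ : List PTree → M) : M :=
  monoSum (fun _ : T.Pt => True) A fun F => Ψ (T.planarGraft F).children

theorem planarSum_zero {M : Type*} [AddCommMonoid M] (A : List PTree) (c : Fin 0 → PTree)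
    (Ψ : List PTree → M) : planarSum A (node 0 c) Ψ = Ψ A := by
  let _ : Unique (node 0 c).Pt :=
    inferInstanceAs (Unique (Option (Σ i : Fin 0, Option (c i).Pt)))
  simp only [planarSum, children_planarGraft_zero]
  exact monoSum_unique trivial A Ψ

/-- Two applications of `monoSum_linearSum` cut the attached forest into three consecutive pieces:
in front of the first branch, onto it, and after it. -/
theorem planarSum_succ {M : Type*} [AddCommMonoid M] (A : List PTree) {n : ℕ}
    (c : Fin (n + 1) → PTree) (Ψ : List PTree → M) : planarSum A (node (n + 1) c) Ψ =
      deconcSum A fun B C => deconcSum B fun B₀ B₁ => planarSum B₁ (c 0) fun u =>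
        planarSum C (node n fun i => c i.succ) fun v => Ψ (B₀ ++ ofList u :: v) := by
  simp only [planarSum, children_planarGraft_succ]
  let _ : Fintype (WithBot (c 0).Pt) := inferInstanceAs (Fintype (Option (c 0).Pt))
  rw [monoSum_linearSum (bijective_ptFirst_ptShift c) (ptFirst_le_ptFirst c)
    (ptShift_le_ptShift c) (fun x y => (ptFirst_lt_ptShift c x y).le)
    (fun x y => (ptFirst_lt_ptShift c x y).not_ge) (fun _ => True) A
    fun F G => Ψ (F ⊥ ++ (c 0).planarGraft (F ∘ WithBot.some) ::
      ((node n fun i => c i.succ).planarGraft G).children)]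
  congr 1
  funext B C
  -- The block of the first branch is in turn the linear sum of one point of the root and the points
  -- of that branch.
  have := monoSum_linearSum (P := WithBot (c 0).Pt) (P₁ := Unit) (i := fun _ => ⊥)
    (j := WithBot.some) (s := fun _ => True) (A := B) (M := M) ?_ ?_ ?_ ?_ ?_ fun F G =>
      monoSum (fun _ => True) C fun F' => Ψ (F () ++ (c 0).planarGraft G ::
        ((node n fun i => c i.succ).planarGraft F').children)
  · refine this.trans ?_
    congr 1
    funext B₀ B₁
    simp only [ofList_children]
    exact monoSum_unique (P := Unit) trivial B₀ fun L => monoSum (fun _ => True) B₁ fun G =>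
      monoSum (fun _ => True) C fun F' => Ψ (L ++ (c 0).planarGraft G ::
        ((node n fun i => c i.succ).planarGraft F').children)
  · refine ⟨Function.Injective.sumElim (fun _ _ _ => rfl) WithBot.coe_injective
      fun _ _ => WithBot.bot_ne_coe, fun p => ?_⟩
    cases p using WithBot.recBotCoe with
    | bot => exact ⟨Sum.inl (), rfl⟩
    | coe p => exact ⟨Sum.inr p, rfl⟩
  · simp
  · simp
  · simp
  · simp

end PTree

/-! ## The duality of `kP` and `H_F` -/

section Planar

variable {k : Type*} [Field k]

theorem tensor_word_induction {X : Type*} {p : FreeAlgebra k X ⊗[k] FreeAlgebra k X → Prop}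
    (hadd : ∀ y z, p y → p z → p (y + z)) (hsmul : ∀ (c : k) z, p z → p (c • z))
    (hword : ∀ L L', p (word k L ⊗ₜ word k L')) (z : FreeAlgebra k X ⊗[k] FreeAlgebra k X) :
    p z := by
  have h0 : p 0 := by simpa using hsmul 0 _ (hword [] [])
  induction z with
  | zero => exact h0
  | add y z hy hz => exact hadd y z hy hz
  | tmul a b =>
    have ha : a ∈ Submodule.span k (Set.range (word k (X := X))) :=
      span_range_word k (X := X) ▸ Submodule.mem_top
    have hb : b ∈ Submodule.span k (Set.range (word k (X := X))) :=
      span_range_word k (X := X) ▸ Submodule.mem_top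
    induction ha using Submodule.span_induction with
    | zero => simpa using h0
    | add x y _ _ hx hy => rw [TensorProduct.add_tmul]; exact hadd _ _ hx hy
    | smul c x _ hx => rw [← TensorProduct.smul_tmul']; exact hsmul _ _ hx
    | mem x hx =>
      obtain ⟨L, rfl⟩ := hx
      induction hb using Submodule.span_induction with
      | zero => simpa using h0
      | add x y _ _ hx hy => rw [TensorProduct.tmul_add]; exact hadd _ _ hx hy
      | smul c x _ hx => rw [TensorProduct.tmul_smul]; exact hsmul _ _ hx
      | mem x hx =>
        obtain ⟨L', rfl⟩ := hx
        exact hword L L'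

theorem planarBPlus_word (L : List PTree) :
    planarBPlus k (word k L) = Finsupp.single (PTree.ofList L) 1 := constr_word _ _

theorem inclKP_single (T : PTree) : inclKP k (Finsupp.single T 1) = FreeAlgebra.ι k T := by
  simp [inclKP]

theorem innerKP_single (T : PTree) (x : KP k) : innerKP k (Finsupp.single T 1) x = x T := by
  simp [innerKP]

open Classical in
theorem pairKP_single_word (T : PTree) (L : List PTree) :
    pairKP k (Finsupp.single T 1) (word k L) = if L = T.children then 1 else 0 := by
  rw [pairKP, LinearMap.compl₂_apply, planarBPlus_word, innerKP_single, Finsupp.single_apply]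
  simp only [PTree.ofList_eq_iff]

variable (k) in
/-- The coefficient of `L ⊗ L'` in an element of `H_F ⊗ H_F`. -/
def tensorCoeff (L L' : List PTree) : HF k ⊗[k] HF k →ₗ[k] k :=
  tensorPairing (pairKP k)
    (Finsupp.single (PTree.ofList L) 1 ⊗ₜ Finsupp.single (PTree.ofList L') 1)

open Classical in
theorem tensorCoeff_word (A C L L' : List PTree) : tensorCoeff k A C (word k L ⊗ₜ word k L') =
    if L' = C ∧ L = A then 1 else 0 := by
  rw [tensorCoeff, tensorPairing_tmul, pairKP_single_word, pairKP_single_word,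
    PTree.children_ofList, PTree.children_ofList, mul_ite, mul_one, mul_zero, ← ite_and]

theorem tensorCoeff_ι_mul_nil (x : PTree) (C : List PTree) (z : HF k ⊗[k] HF k) :
    tensorCoeff k [] C ((FreeAlgebra.ι k x ⊗ₜ 1) * z) = 0 := by
  induction z using tensor_word_induction with
  | hadd y z hy hz => rw [mul_add, map_add, hy, hz, add_zero]
  | hsmul c z hz => rw [mul_smul_comm, map_smul, hz, smul_zero]
  | hword L L' =>
    rw [Algebra.TensorProduct.tmul_mul_tmul, one_mul, ← word_cons, tensorCoeff_word, if_neg]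
    simp

-- The left factor of every term starts with `x`, so the coefficient vanishes unless `a = x`;
-- cancelling `x` leaves `z`.
open Classical in
theorem tensorCoeff_ι_mul_cons (x a : PTree) (A C : List PTree) (z : HF k ⊗[k] HF k) :
    tensorCoeff k (a :: A) C ((FreeAlgebra.ι k x ⊗ₜ 1) * z) =
      if a = x then tensorCoeff k A C z else 0 := by
  induction z using tensor_word_induction with
  | hadd y z hy hz =>
    rw [mul_add, map_add, hy, hz]
    split_ifs <;> simp
  | hsmul c z hz =>
    rw [mul_smul_comm, map_smul, hz]
    split_ifs <;> simp
  | hword L L' =>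
    rw [Algebra.TensorProduct.tmul_mul_tmul, one_mul, ← word_cons, tensorCoeff_word,
      tensorCoeff_word, ← ite_and]
    simp only [List.cons.injEq]
    congr 1
    rw [eq_iff_iff]
    tauto

theorem map_bPlus_word (L L' : List PTree) :
    TensorProduct.map LinearMap.id (inclKP k ∘ₗ planarBPlus k) (word k L ⊗ₜ[k] word k L') =
      word k L ⊗ₜ word k [PTree.ofList L'] := by
  simp [planarBPlus_word, inclKP_single]

theorem tensorCoeff_bPlus_mul_nil (A : List PTree) (y z : HF k ⊗[k] HF k) :
    tensorCoeff k A []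
      (TensorProduct.map LinearMap.id (inclKP k ∘ₗ planarBPlus k) y * z) = 0 := by
  induction y using tensor_word_induction with
  | hadd y y' hy hz => rw [map_add, add_mul, map_add, hy, hz, add_zero]
  | hsmul c y hy => rw [map_smul, smul_mul_assoc, map_smul, hy, smul_zero]
  | hword I I' =>
    rw [map_bPlus_word]
    induction z using tensor_word_induction with
    | hadd y z hy hz => rw [mul_add, map_add, hy, hz, add_zero]
    | hsmul c z hz => rw [mul_smul_comm, map_smul, hz, smul_zero]
    | hword L L' =>
      rw [Algebra.TensorProduct.tmul_mul_tmul, ← word_append, ← word_append, tensorCoeff_word,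
        if_neg]
      simp

/-- Every term of the `B_+` factor contributes a single tree on the right, which has to be `c`. On
the left the words concatenate, so `A` is cut in two. -/
theorem tensorCoeff_bPlus_mul_cons (A : List PTree) (c : PTree) (C : List PTree)
    (y z : HF k ⊗[k] HF k) : tensorCoeff k A (c :: C)
      (TensorProduct.map LinearMap.id (inclKP k ∘ₗ planarBPlus k) y * z) =
      deconcSum A fun A₁ A₂ => tensorCoeff k A₁ c.children y * tensorCoeff k A₂ C z := by
  classical
  have hs : ∀ (b : k) (Φ : List PTree → List PTree → k),
      deconcSum A (fun A₁ A₂ => b * Φ A₁ A₂) = b * deconcSum A Φ := fun b Φ => deconcSum_mul b A Φ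
  induction y using tensor_word_induction with
  | hadd y y' hy hz =>
    rw [map_add, add_mul, map_add, hy, hz, ← deconcSum_add]
    simp only [map_add, add_mul]
  | hsmul b y hy =>
    rw [map_smul, smul_mul_assoc, map_smul, hy]
    simp only [map_smul, smul_eq_mul, mul_assoc, hs]
  | hword I I' =>
    rw [map_bPlus_word]
    induction z using tensor_word_induction with
    | hadd y z hy hz =>
      rw [mul_add, map_add, hy, hz, ← deconcSum_add]
      simp only [map_add, mul_add]
    | hsmul b z hz =>
      rw [mul_smul_comm, map_smul, hz]
      simp only [map_smul, smul_eq_mul, mul_left_comm _ b, hs]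
    | hword L L' =>
      rw [Algebra.TensorProduct.tmul_mul_tmul, ← word_append, ← word_append, tensorCoeff_word]
      simp only [tensorCoeff_word, List.singleton_append, List.cons.injEq, PTree.ofList_eq_iff]
      by_cases h : I' = c.children ∧ L' = C
      · simp only [h.1, h.2, true_and, and_self]
        rw [← deconcSum_ite]
        congr 1
        funext A₁ A₂
        by_cases h1 : I = A₁ <;> by_cases h2 : L = A₂ <;> simp [h1, h2]
      · rw [if_neg fun h' => h h'.1]
        symm
        refine (congrArg _ ?_).trans (deconcSum_zero A)
        funext A₁ A₂
        rcases not_and_or.1 h with h | h <;> simp [h]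

/-- The number of ways of attaching the forest `A` to `T` in order that give `B_+(L)`. -/
def planarCount (k : Type*) [Field k] (L A : List PTree) (T : PTree) : k :=
  open Classical in PTree.planarSum A T fun u => if u = L then (1 : k) else 0

open Classical in
theorem planarCount_ofList_nil (L A : List PTree) :
    planarCount k L A (PTree.ofList []) = if A = L then 1 else 0 :=
  PTree.planarSum_zero A _ _

open Classical in
theorem planarCount_ofList_cons (L A : List PTree) (c : PTree) (C : List PTree) :
    planarCount k L A (PTree.ofList (c :: C)) =
      deconcSum A fun A' A₂ => deconcSum A' fun A₀ A₁ => PTree.planarSum A₁ c fun u =>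
        PTree.planarSum A₂ (PTree.ofList C) fun v =>
          if A₀ ++ PTree.ofList u :: v = L then (1 : k) else 0 :=
  PTree.planarSum_succ A _ _

theorem planarCount_nil_cons (A : List PTree) (c : PTree) (C : List PTree) :
    planarCount k [] A (PTree.ofList (c :: C)) = 0 := by
  rw [planarCount_ofList_cons]
  simp [PTree.planarSum, monoSum_zero, deconcSum_zero]

open Classical in
theorem planarSum_mul_planarSum (x : PTree) (L A₁ A₂ : List PTree) (c : PTree) (C : List PTree) :
    (PTree.planarSum A₁ c fun u => PTree.planarSum A₂ (PTree.ofList C) fun v =>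
      if [] ++ PTree.ofList u :: v = x :: L then (1 : k) else 0) =
      planarCount k x.children A₁ c * planarCount k L A₂ (PTree.ofList C) := by
  have h : ∀ u v : List PTree, (if [] ++ PTree.ofList u :: v = x :: L then (1 : k) else 0) =
      (if u = x.children then 1 else 0) * if v = L then 1 else 0 := by
    intro u v
    simp only [List.nil_append, List.cons.injEq, PTree.ofList_eq_iff, ite_and]
    split_ifs <;> simp
  simp only [h, planarCount, PTree.planarSum, monoSum_mul, monoSum_mul_right]

theorem planarCount_cons_nil_cons (x : PTree) (L : List PTree) (c : PTree) (C : List PTree) :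
    planarCount k (x :: L) [] (PTree.ofList (c :: C)) =
      planarCount k x.children [] c * planarCount k L [] (PTree.ofList C) := by
  rw [planarCount_ofList_cons, deconcSum, deconcSum, planarSum_mul_planarSum]

-- The first branch `x` of the result is either the first attached tree `a`, placed at the very
-- beginning, or the modified first branch `c` with nothing attached in front of it.
open Classical in
theorem planarCount_cons_cons_cons (x a : PTree) (L A : List PTree) (c : PTree) (C : List PTree) :
    planarCount k (x :: L) (a :: A) (PTree.ofList (c :: C)) =
      (if a = x then planarCount k L A (PTree.ofList (c :: C)) else 0) +
        deconcSum (a :: A) fun A₁ A₂ =>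
          planarCount k x.children A₁ c * planarCount k L A₂ (PTree.ofList C) := by
  rw [planarCount_ofList_cons, deconcSum, deconcSum, deconcSum, planarSum_mul_planarSum]
  simp only [deconcSum, deconcSum_add, planarSum_mul_planarSum, planarCount_ofList_cons,
    List.cons_append, List.cons.injEq]
  by_cases h : a = x
  · simp only [h, true_and, if_true]
    abel
  · simp [h, PTree.planarSum, monoSum_zero, deconcSum_zero]

variable (k) in
/-- The coproduct of a word in the planar rooted trees. -/
def comulForest (L : List PTree) : HF k ⊗[k] HF k := (L.map (comulHFTree k)).prod

theorem comulHFTree_ofList (L : List PTree) : comulHFTree k (PTree.ofList L) =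
    FreeAlgebra.ι k (PTree.ofList L) ⊗ₜ 1 +
      TensorProduct.map LinearMap.id (inclKP k ∘ₗ planarBPlus k) (comulForest k L) := by
  rw [PTree.ofList, comulHFTree, comulForest]
  congr 3
  refine (List.ofFn_congr rfl _).trans ?_
  conv_rhs => rw [← List.ofFn_get L, List.map_ofFn]
  rfl

theorem comul_word (L : List PTree) : (opsHF k).comul (word k L) = comulForest k L := by
  change FreeAlgebra.lift k _ _ = _
  rw [word, map_list_prod, List.map_map, comulForest]
  congr 2
  funext T
  exact FreeAlgebra.lift_ι_apply _ _

/-- The rule `Δ(x) = x ⊗ 1 + (id ⊗ B_+)Δ(B_-(x))` distinguishes whether the first tree `x` of `L`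
lies entirely in the attached part or arises by attachment to a branch. The counts of attachments
obey the same alternative, so the two recursions coincide. -/
theorem tensorCoeff_comulForest (L A C : List PTree) :
    tensorCoeff k A C (comulForest k L) = planarCount k L A (PTree.ofList C) := by
  classical
  -- The induction is nested: along the list here, with the claim for the forests below the roots
  -- assumed, and then over trees to discharge that assumption.
  have main : ∀ L : List PTree, (∀ T ∈ L, ∀ A C, tensorCoeff k A C (comulForest k T.children) =
      planarCount k T.children A (PTree.ofList C)) →
      ∀ A C, tensorCoeff k A C (comulForest k L) = planarCount k L A (PTree.ofList C) := by
    intro L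
    induction L with
    | nil =>
      intro _ A C
      have : comulForest k [] = word k [] ⊗ₜ word k [] := rfl
      rw [this, tensorCoeff_word]
      cases C with
      | nil => simp [planarCount_ofList_nil, eq_comm]
      | cons c C => simp [planarCount_nil_cons]
    | cons x L ih =>
      intro h A C
      have ih' := ih fun T hT => h T (List.mem_cons_of_mem x hT)
      have hx := h x List.mem_cons_self
      have hprod : comulForest k (x :: L) = (FreeAlgebra.ι k x ⊗ₜ 1) * comulForest k L +
          TensorProduct.map LinearMap.id (inclKP k ∘ₗ planarBPlus k)
            (comulForest k x.children) * comulForest k L := by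
        conv_lhs => rw [← PTree.ofList_children x]
        rw [comulForest, List.map_cons, List.prod_cons, comulHFTree_ofList, add_mul,
          PTree.ofList_children]
        rfl
      rw [hprod, map_add]
      cases C with
      | nil =>
        rw [tensorCoeff_bPlus_mul_nil, add_zero]
        cases A with
        | nil => rw [tensorCoeff_ι_mul_nil, planarCount_ofList_nil, if_neg (by simp)]
        | cons a A =>
          rw [tensorCoeff_ι_mul_cons, ih', planarCount_ofList_nil, planarCount_ofList_nil,
            ← ite_and]
          simp only [List.cons.injEq]
      | cons c C =>
        rw [tensorCoeff_bPlus_mul_cons]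
        simp only [hx, ih', PTree.ofList_children]
        cases A with
        | nil => rw [tensorCoeff_ι_mul_nil, planarCount_cons_nil_cons, zero_add, deconcSum]
        | cons a A => rw [tensorCoeff_ι_mul_cons, planarCount_cons_cons_cons, ih']
  have all : ∀ T : PTree, ∀ A C, tensorCoeff k A C (comulForest k T.children) =
      planarCount k T.children A (PTree.ofList C) := by
    intro T
    induction T using PTree.list_induction with
    | h L ih =>
      rw [PTree.children_ofList]
      exact main L ih
  exact main L (fun T _ => all T) A C

theorem opsKP_mul_single (T T' : PTree) : (opsKP k).mul (Finsupp.single T 1)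
    (Finsupp.single T' 1) = planarGLTree k T T' := by
  simp [opsKP]

theorem opsKP_comul_single (T : PTree) : (opsKP k).comul (Finsupp.single T 1) =
    deconcSum T.children fun A B => (Finsupp.single (PTree.ofList A) (1 : k) : KP k) ⊗ₜ[k]
      (Finsupp.single (PTree.ofList B) (1 : k) : KP k) := by
  simp [opsKP, ← sum_range_take_drop]

theorem pairKP_planarGLTree (T T' : PTree) (L : List PTree) :
    pairKP k (planarGLTree k T T') (word k L) = planarCount k L T.children T' := by
  classical
  rw [planarCount, PTree.planarSum, ← sum_monotone_eq_monoSum, planarGLTree, map_sum,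
    LinearMap.sum_apply]
  refine Finset.sum_congr (by simp) fun f _ => ?_
  rw [pairKP_single_word]
  refine if_congr (eq_comm.trans (iff_of_eq ?_)) rfl rfl
  congr
  funext p
  exact congrArg (List.map _) (List.filter_congr fun i _ => decide_eq_decide.2 Iff.rfl)

theorem linearMap_ext_single {X M : Type*} [AddCommMonoid M] [Module k M] {f g : (X →₀ k) →ₗ[k] M}
    (h : ∀ x, f (Finsupp.single x 1) = g (Finsupp.single x 1)) : f = g :=
  Finsupp.lhom_ext' fun x => LinearMap.ext_ring (h x)

theorem pairKP_mul_left (x y : KP k) (u : HF k) :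
    pairKP k ((opsKP k).mul x y) u = tensorPairing (pairKP k) (x ⊗ₜ y) ((opsHF k).comul u) := by
  have h : (opsKP k).mul.compr₂ (pairKP k) = (TensorProduct.mk k _ _).compr₂
      ((tensorPairing (pairKP k)).compl₂ (opsHF k).comul) := by
    refine linearMap_ext_single fun T => linearMap_ext_single fun T' => linearMap_ext_word fun L => ?_
    simp only [LinearMap.compr₂_apply, LinearMap.compl₂_apply, TensorProduct.mk_apply]
    rw [opsKP_mul_single, pairKP_planarGLTree, comul_word]
    have := tensorCoeff_comulForest (k := k) L T.children T'.children
    rw [PTree.ofList_children, tensorCoeff, PTree.ofList_children, PTree.ofList_children] at this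
    exact this.symm
  exact LinearMap.congr_fun (LinearMap.congr_fun₂ h x y) u

theorem pairKP_mul_right (x : KP k) (u v : HF k) :
    pairKP k x (u * v) = tensorPairing (pairKP k) ((opsKP k).comul x) (u ⊗ₜ v) := by
  classical
  have h : ∀ L L' : List PTree, (pairKP k).flip (word k L * word k L') =
      (tensorPairing (pairKP k)).flip (word k L ⊗ₜ word k L') ∘ₗ (opsKP k).comul := by
    intro L L'
    refine linearMap_ext_single fun T => ?_
    rw [LinearMap.flip_apply, LinearMap.comp_apply, LinearMap.flip_apply, ← word_append,
      pairKP_single_word, opsKP_comul_single, ← sum_range_take_drop, map_sum, LinearMap.sum_apply]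
    simp only [tensorPairing_tmul, pairKP_single_word, PTree.children_ofList, mul_ite, mul_one,
      mul_zero, ← ite_and]
    rw [← sum_take_drop_eq]
  have h1 : ∀ L, pairKP k x ∘ₗ LinearMap.mulLeft k (word k L) =
      tensorPairing (pairKP k) ((opsKP k).comul x) ∘ₗ TensorProduct.mk k _ _ (word k L) :=
    fun L => linearMap_ext_word fun L' => LinearMap.congr_fun (h L L') x
  have h2 : pairKP k x ∘ₗ LinearMap.mulRight k v =
      tensorPairing (pairKP k) ((opsKP k).comul x) ∘ₗ (TensorProduct.mk k _ _).flip v :=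
    linearMap_ext_word fun L => LinearMap.congr_fun (h1 L) v
  exact LinearMap.congr_fun h2 u

theorem isDualPair_pairKP : IsDualPair (opsKP k) (opsHF k) (pairKP k) where
  one_left u := by
    classical
    have : pairKP k (Finsupp.single (PTree.ladder 0) 1) = (opsHF k).counit := by
      refine linearMap_ext_word fun L => ?_
      rw [pairKP_single_word, PTree.ladder, PTree.children_ofList]
      change _ = FreeAlgebra.lift k _ _
      cases L <;> simp
    exact LinearMap.congr_fun this u
  one_right x := by
    classical
    have : (pairKP k).flip (word k []) = (opsKP k).counit := by
      refine linearMap_ext_single fun T => ?_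
      rw [LinearMap.flip_apply, pairKP_single_word]
      change _ = (Finsupp.single T (1 : k)) (PTree.ladder 0)
      rw [Finsupp.single_apply, PTree.ladder]
      simp only [eq_comm (a := T), PTree.ofList_eq_iff]
    exact LinearMap.congr_fun this x
  mul_left := pairKP_mul_left
  mul_right := pairKP_mul_right

theorem separatingLeft_pairKP : (pairKP k).SeparatingLeft := by
  classical
  intro x hx
  refine Finsupp.ext fun T => ?_
  have h : (pairKP k).flip (word k T.children) = Finsupp.lapply T := by
    refine linearMap_ext_single fun T' => ?_
    rw [LinearMap.flip_apply, pairKP_single_word, Finsupp.lapply_apply, Finsupp.single_apply]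
    simp only [PTree.children_injective.eq_iff, eq_comm]
  exact (LinearMap.congr_fun h x).symm.trans (hx _)

end Planar

/-! ## Isomorphisms of rooted trees -/

section SigmaIso

variable {ι κ : Type*} {α : ι → Type*} {β : κ → Type*} [∀ i, PartialOrder (α i)]
  [∀ j, PartialOrder (β j)]

/-- The isomorphism of disjoint unions given by isomorphisms of the summands. -/
def sigmaOrderIso (s : Σ σ : ι ≃ κ, ∀ i, α i ≃o β (σ i)) : (Σ i, α i) ≃o Σ j, β j where
  toEquiv := Equiv.sigmaCongr s.1 fun i => (s.2 i).toEquiv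
  map_rel_iff' := by
    rintro ⟨i, a⟩ ⟨j, b⟩
    constructor
    · intro h
      obtain ⟨h1, h2⟩ := Sigma.le_def.1 h
      obtain rfl : i = j := s.1.injective h1
      exact Sigma.mk_le_mk_iff.2 ((s.2 i).le_iff_le.1 h2)
    · intro h
      obtain ⟨h1, h2⟩ := Sigma.le_def.1 h
      obtain rfl : i = j := h1
      exact Sigma.mk_le_mk_iff.2 ((s.2 i).le_iff_le.2 h2)

/-- Every element of a summand lies below its top, and comparable elements share a summand. Hence an
isomorphism moves each summand into a single one, named by the image of the top. The tops also make
every summand nonempty, which determines the bijection of indices. -/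
theorem sigmaOrderIso_bijective [∀ i, OrderTop (α i)] [∀ j, OrderTop (β j)] :
    Function.Bijective (sigmaOrderIso (α := α) (β := β)) := by
  constructor
  · rintro ⟨σ, e⟩ ⟨τ, f⟩ h
    have h' : ∀ i a, (⟨σ i, e i a⟩ : Σ j, β j) = ⟨τ i, f i a⟩ := fun i a =>
      DFunLike.congr_fun h ⟨i, a⟩
    obtain rfl : σ = τ := Equiv.ext fun i => congrArg Sigma.fst (h' i ⊤)
    obtain rfl : e = f := funext fun i => OrderIso.ext (funext fun a => by simpa using h' i a)
    rfl
  · intro g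
    have hfst : ∀ (g : (Σ i, α i) ≃o Σ j, β j) i a, (g ⟨i, a⟩).1 = (g ⟨i, ⊤⟩).1 := fun g i a =>
      (Sigma.le_def.1 (g.monotone (Sigma.mk_le_mk_iff.2 (le_top (a := a))))).1
    have hfst' : ∀ (g : (Σ j, β j) ≃o Σ i, α i) j b, (g ⟨j, b⟩).1 = (g ⟨j, ⊤⟩).1 := fun g i a =>
      (Sigma.le_def.1 (g.monotone (Sigma.mk_le_mk_iff.2 (le_top (a := a))))).1
    let σ : ι ≃ κ :=
      { toFun := fun i => (g ⟨i, ⊤⟩).1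
        invFun := fun j => (g.symm ⟨j, ⊤⟩).1
        left_inv := fun i => (hfst' g.symm _ (g ⟨i, ⊤⟩).2).symm.trans (by simp)
        right_inv := fun j => (hfst g _ (g.symm ⟨j, ⊤⟩).2).symm.trans (by simp) }
    have h1 : ∀ i a, ∃ b : β (σ i), g ⟨i, a⟩ = ⟨σ i, b⟩ := fun i a => by
      obtain ⟨⟨j, b⟩, h⟩ : ∃ y, g ⟨i, a⟩ = y := ⟨_, rfl⟩
      have hj := hfst g i a
      rw [h] at hj
      change j = σ i at hj
      subst hj
      exact ⟨b, h⟩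
    choose F hF using h1
    have hmono : ∀ i a a', F i a ≤ F i a' ↔ a ≤ a' := fun i a a' => by
      rw [← Sigma.mk_le_mk_iff (i := σ i), ← hF, ← hF, g.le_iff_le, Sigma.mk_le_mk_iff]
    have hsurj : ∀ i, Function.Surjective (F i) := fun i b => by
      have hi : (g.symm ⟨σ i, b⟩).1 = i := (hfst' g.symm _ b).trans (σ.left_inv i)
      obtain ⟨⟨i', a⟩, h⟩ : ∃ x, g.symm ⟨σ i, b⟩ = x := ⟨_, rfl⟩
      rw [h] at hi
      obtain rfl : i' = i := hi
      refine ⟨a, ?_⟩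
      have := hF i' a
      rw [← h, g.apply_symm_apply] at this
      simpa using this.symm
    refine ⟨⟨σ, fun i => RelIso.ofSurjective (OrderEmbedding.ofMapLEIff (F i) (hmono i))
      (hsurj i)⟩, OrderIso.ext (funext fun x => ?_)⟩
    obtain ⟨i, a⟩ := x
    exact (hF i a).symm

theorem withTopCongr_bijective {A B : Type*} [PartialOrder A] [PartialOrder B] :
    Function.Bijective (OrderIso.withTopCongr : (A ≃o B) → (WithTop A ≃o WithTop B)) := by
  constructor
  · intro e f h
    exact OrderIso.ext (funext fun a => WithTop.coe_injective (DFunLike.congr_fun h (a : WithTop A)))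
  · intro g
    have h1 : ∀ a : A, ∃ b : B, (b : WithTop B) = g a := fun a =>
      WithTop.ne_top_iff_exists.1 fun h => WithTop.coe_ne_top ((map_eq_top_iff g).1 h)
    choose F hF using h1
    have hmono : ∀ a a', F a ≤ F a' ↔ a ≤ a' := fun a a' => by
      rw [← WithTop.coe_le_coe, hF, hF, g.le_iff_le, WithTop.coe_le_coe]
    have hsurj : Function.Surjective F := fun b => by
      obtain ⟨a, ha⟩ := (WithTop.ne_top_iff_exists (x := g.symm (b : WithTop B))).1
        fun h => WithTop.coe_ne_top ((map_eq_top_iff g.symm).1 h)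
      refine ⟨a, WithTop.coe_injective ?_⟩
      rw [hF, ha, g.apply_symm_apply]
    refine ⟨RelIso.ofSurjective (OrderEmbedding.ofMapLEIff F hmono) hsurj,
      OrderIso.ext (funext fun x => ?_)⟩
    cases x using WithTop.recTopCoe with
    | top => exact (map_top g).symm
    | coe a => exact hF a

end SigmaIso

namespace PTree

instance vertOrderTop : (T : PTree) → OrderTop T.Vert
  | node n c => inferInstanceAs (OrderTop (WithTop (Σ i : Fin n, (c i).Vert)))

instance finite_vert_iso (S T : PTree) : Finite (S.Vert ≃o T.Vert) := DFunLike.finite _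

/-- The isomorphisms of the vertex posets are given by a matching of the branches and isomorphisms of
the matched branches. -/
def nodeIsoEquiv {n m : ℕ} (c : Fin n → PTree) (d : Fin m → PTree) :
    (Σ σ : Fin n ≃ Fin m, ∀ i, (c i).Vert ≃o (d (σ i)).Vert) ≃
      ((node n c).Vert ≃o (node m d).Vert) :=
  (Equiv.ofBijective _ (sigmaOrderIso_bijective (α := fun i => (c i).Vert)
    (β := fun j => (d j).Vert))).trans (Equiv.ofBijective _ withTopCongr_bijective)

theorem ofPlanar_eq_iff {S T : PTree} : RTree.ofPlanar S = RTree.ofPlanar T ↔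
    Nonempty (S.Vert ≃o T.Vert) := Quotient.eq

theorem ofPlanar_node_eq_iff {n m : ℕ} (c : Fin n → PTree) (d : Fin m → PTree) :
    RTree.ofPlanar (node n c) = RTree.ofPlanar (node m d) ↔
      ∃ σ : Fin n ≃ Fin m, ∀ i, RTree.ofPlanar (d (σ i)) = RTree.ofPlanar (c i) := by
  rw [ofPlanar_eq_iff]
  constructor
  · rintro ⟨e⟩
    obtain ⟨σ, e⟩ := (nodeIsoEquiv c d).symm e
    exact ⟨σ, fun i => (ofPlanar_eq_iff.2 ⟨e i⟩).symm⟩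
  · rintro ⟨σ, h⟩
    exact ⟨nodeIsoEquiv c d ⟨σ, fun i => (ofPlanar_eq_iff.1 (h i).symm).some⟩⟩

theorem map_get_univ {α β : Type*} (L : List α) (f : α → β) :
    (Finset.univ : Finset (Fin L.length)).val.map (fun i => f (L.get i)) = (L.map f : List β) := by
  rw [Fin.univ_val_map]
  conv_rhs => rw [← List.ofFn_get L, List.map_ofFn]
  rfl

/-- A rooted tree is thereby the same thing as the multiset of its branches, which makes the choice
of planar representatives immaterial. -/
theorem ofPlanar_ofList_eq_iff {L L' : List PTree} :
    RTree.ofPlanar (ofList L) = RTree.ofPlanar (ofList L') ↔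
      (L.map RTree.ofPlanar : Multiset RTree) = (L'.map RTree.ofPlanar : List RTree) := by
  rw [ofList, ofList, ofPlanar_node_eq_iff, ← map_get_univ, ← map_get_univ]
  constructor
  · rintro ⟨σ, h⟩
    rw [← Finset.map_univ_equiv σ, Finset.map_val, Multiset.map_map]
    exact Multiset.map_congr rfl fun i _ => (h i).symm
  · intro h
    obtain ⟨e, he⟩ := exists_equiv_of_map_univ_eq h
    exact ⟨e, he⟩

end PTree

/-! ### Rooted trees as multisets of branches, and their symmetries -/

namespace RTree

theorem ofPlanar_surjective : Function.Surjective ofPlanar := Quotient.mk_surjective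

@[simp] theorem ofPlanar_toPlanar (t : RTree) : ofPlanar t.toPlanar = t := Quotient.out_eq t

theorem children_ofPlanar (T : PTree) :
    (ofPlanar T).children = (T.children.map ofPlanar : List RTree) := by
  rw [children, ← PTree.ofPlanar_ofList_eq_iff]
  simp

theorem map_ofPlanar_map_toPlanar (L : List RTree) : (L.map toPlanar).map ofPlanar = L := by
  simp [Function.comp_def]

@[simp] theorem children_ofMultiset (s : Multiset RTree) : (ofMultiset s).children = s := by
  rw [ofMultiset, children_ofPlanar, PTree.children_ofList, map_ofPlanar_map_toPlanar,
    Multiset.coe_toList]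

theorem ofMultiset_coe_map (L : List PTree) :
    ofMultiset (L.map ofPlanar : List RTree) = ofPlanar (PTree.ofList L) := by
  rw [ofMultiset, PTree.ofPlanar_ofList_eq_iff, map_ofPlanar_map_toPlanar, Multiset.coe_toList]

@[simp] theorem ofMultiset_children (t : RTree) : ofMultiset t.children = t := by
  obtain ⟨T, rfl⟩ := ofPlanar_surjective t
  rw [children_ofPlanar, ofMultiset_coe_map, PTree.ofList_children]

theorem ofMultiset_injective : Function.Injective ofMultiset :=
  Function.LeftInverse.injective children_ofMultiset

theorem bullet_eq : bullet = ofMultiset 0 := (ofMultiset_coe_map []).symm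

/-- When there is an isomorphism, composing with its inverse identifies all isomorphisms with the
automorphisms of `S`. -/
theorem nat_card_iso (S T : PTree) : Nat.card (S.Vert ≃o T.Vert) =
    open Classical in if ofPlanar S = ofPlanar T then (ofPlanar S).symOrder else 0 := by
  split_ifs with h
  · obtain ⟨e⟩ := PTree.ofPlanar_eq_iff.1 h
    exact Nat.card_congr
      { toFun := fun f => f.trans e.symm
        invFun := fun f => f.trans e
        left_inv := fun f => by ext; simp
        right_inv := fun f => by ext; simp }
  · rw [Nat.card_eq_zero]
    exact Or.inl ⟨fun e => h (PTree.ofPlanar_eq_iff.2 ⟨e⟩)⟩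

theorem symOrder_pos (t : RTree) : 0 < t.symOrder := by
  obtain ⟨T, rfl⟩ := ofPlanar_surjective t
  exact Nat.card_pos (α := T.Vert ≃o T.Vert)

-- An automorphism permutes the branches and maps each one isomorphically to its image. The
-- permutation must preserve isomorphism classes, and then leaves `∏ |Sym|` choices; such
-- permutations form a product of symmetric groups, one for each class.
open Classical in
theorem symOrder_node {n : ℕ} (c : Fin n → PTree) : (ofPlanar (.node n c)).symOrder =
    (∏ i, (ofPlanar (c i)).symOrder) *
      ∏ t ∈ Finset.univ.image fun i => ofPlanar (c i),
        (Fintype.card {i // ofPlanar (c i) = t}).factorial := by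
  have h : (ofPlanar (.node n c)).symOrder =
      ∑ σ : Equiv.Perm (Fin n), ∏ i, Nat.card ((c i).Vert ≃o (c (σ i)).Vert) := by
    refine (Nat.card_congr (PTree.nodeIsoEquiv c c).symm).trans ?_
    rw [Nat.card_sigma]
    exact Finset.sum_congr rfl fun σ _ => Nat.card_pi
  have h2 : ∀ σ : Equiv.Perm (Fin n), ∏ i, Nat.card ((c i).Vert ≃o (c (σ i)).Vert) =
      if (fun i => ofPlanar (c i)) ∘ σ = fun i => ofPlanar (c i) then
        ∏ i, (ofPlanar (c i)).symOrder else 0 := by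
    intro σ
    simp only [nat_card_iso]
    split_ifs with hσ
    · exact Finset.prod_congr rfl fun i _ => if_pos (congrFun hσ i).symm
    · obtain ⟨i, hi⟩ := Function.ne_iff.1 hσ
      exact Finset.prod_eq_zero (Finset.mem_univ i) (if_neg fun h => hi h.symm)
  rw [h, Finset.sum_congr rfl fun σ _ => h2 σ, ← Finset.sum_filter, Finset.sum_const, smul_eq_mul,
    mul_comm, ← DomMulAct.stabilizer_card', Fintype.card_subtype]

open Classical in
theorem symOrder_ofMultiset (s : Multiset RTree) : (ofMultiset s).symOrder =
    (s.map symOrder).prod * ∏ t ∈ s.toFinset, (s.count t).factorial := by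
  obtain ⟨L, rfl⟩ : ∃ L : List PTree, s = (L.map ofPlanar : List RTree) :=
    ⟨s.toList.map toPlanar, by rw [map_ofPlanar_map_toPlanar, Multiset.coe_toList]⟩
  rw [ofMultiset_coe_map, PTree.ofList, symOrder_node, ← PTree.map_get_univ]
  congr 1
  · rw [Multiset.map_map]
    rfl
  · refine Finset.prod_congr ?_ fun t _ => ?_
    · ext t
      simp
    · rw [Multiset.count_map, Fintype.card_subtype]
      congr 2
      simp only [eq_comm (a := t)]
      rfl

-- The factor `s.count x + 1` is the number of ways to remove a copy of `x` again. This makes the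
-- weighted pairing of `kT` with `H_K` compatible with products.
open Classical in
theorem symOrder_ofMultiset_cons (x : RTree) (s : Multiset RTree) :
    (ofMultiset (x ::ₘ s)).symOrder =
      x.symOrder * (s.count x + 1) * (ofMultiset s).symOrder := by
  have h : ∏ t ∈ s.toFinset, (s.count t).factorial =
      ∏ t ∈ insert x s.toFinset, (s.count t).factorial := by
    refine Finset.prod_subset (Finset.subset_insert _ _) fun t _ ht => ?_
    rw [Multiset.mem_toFinset] at ht
    rw [Multiset.count_eq_zero_of_notMem ht, Nat.factorial_zero]
  have h2 : ∏ t ∈ insert x s.toFinset, ((x ::ₘ s).count t).factorial =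
      (s.count x + 1) * ∏ t ∈ insert x s.toFinset, (s.count t).factorial := by
    rw [← Finset.mul_prod_erase _ _ (Finset.mem_insert_self x _),
      ← Finset.mul_prod_erase _ _ (Finset.mem_insert_self x s.toFinset), Multiset.count_cons_self,
      Nat.factorial_succ, mul_assoc]
    congr 2
    refine Finset.prod_congr rfl fun t ht => ?_
    rw [Multiset.count_cons_of_ne (Finset.ne_of_mem_erase ht)]
  rw [symOrder_ofMultiset, symOrder_ofMultiset, Multiset.toFinset_cons, h, h2, Multiset.map_cons,
    Multiset.prod_cons]
  ring

end RTree

/-! ## The number of vertices -/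

namespace PTree

theorem size_node {n : ℕ} (c : Fin n → PTree) : (node n c).size = ∑ i, (c i).size + 1 := by
  let _ : ∀ i : Fin n, Fintype (c i).Vert := fun i => vertFintype (c i)
  refine (Fintype.card_option (α := Σ i : Fin n, (c i).Vert)).trans ?_
  rw [Fintype.card_sigma]
  rfl

theorem size_ofList (L : List PTree) : (ofList L).size = (L.map size).sum + 1 := by
  rw [ofList, size_node, ← List.sum_ofFn]
  congr 2
  conv_rhs => rw [← List.ofFn_get L, List.map_ofFn]
  rfl

theorem size_children (T : PTree) : (T.children.map size).sum + 1 = T.size := by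
  rw [← size_ofList, ofList_children]

theorem size_graft (T : PTree) (F : T.Vert → List PTree) :
    (T.graft F).size = T.size + ∑ v, ((F v).map size).sum := by
  induction T with
  | node n c ih =>
    let _ : ∀ i : Fin n, Fintype (c i).Vert := fun i => vertFintype (c i)
    have h : ∑ v, ((F v).map size).sum =
        ((F (⊤ : WithTop (Σ i : Fin n, (c i).Vert))).map size).sum +
          ∑ i, ∑ v : (c i).Vert, ((F ((⟨i, v⟩ : Σ i : Fin n, (c i).Vert) :
            WithTop (Σ i : Fin n, (c i).Vert))).map size).sum := by
      refine (Fintype.sum_option (α := Σ i : Fin n, (c i).Vert) _).trans ?_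
      rw [Fintype.sum_sigma]
      rfl
    rw [h, graft, size_ofList, List.map_append, List.sum_append, List.map_ofFn, List.sum_ofFn,
      size_node]
    simp only [Function.comp_apply, ih, Finset.sum_add_distrib]
    ring

/-- A tree with at most `n + 1` vertices has at most `n` branches, each with at most `n` vertices.
-/
theorem finite_size_le (n : ℕ) : {T : PTree | T.size ≤ n}.Finite := by
  induction n with
  | zero =>
    refine Set.finite_empty.subset fun T hT => ?_
    have : T.size ≤ 0 := hT
    rw [← size_children] at this
    omega
  | succ n ih =>
    have : Finite {T : PTree | T.size ≤ n} := ih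
    refine ((List.finite_length_le {T : PTree | T.size ≤ n} n).image
      fun L => ofList (L.map Subtype.val)).subset fun T hT => ?_
    have hT' : T.size ≤ n + 1 := hT
    rw [← size_children] at hT'
    have hsum : (T.children.map size).sum ≤ n := by omega
    have hmem : ∀ S ∈ T.children, S.size ≤ n := fun S hS =>
      (List.le_sum_of_mem (List.mem_map_of_mem hS)).trans hsum
    refine ⟨T.children.attach.map fun S => ⟨S.1, hmem S.1 S.2⟩, ?_, ?_⟩
    · rw [Set.mem_ofPred_eq, List.length_map, List.length_attach]
      refine le_trans ?_ hsum
      have := List.card_nsmul_le_sum (T.children.map size) 1 (by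
        intro x hx
        obtain ⟨S, -, rfl⟩ := List.mem_map.1 hx
        rw [← size_children]
        omega)
      simpa using this
    · simp

end PTree

namespace RTree

theorem size_ofPlanar (T : PTree) : (ofPlanar T).size = T.size := rfl

theorem finite_size_eq (n : ℕ) : {t : RTree | t.size = n}.Finite := by
  refine ((PTree.finite_size_le n).image ofPlanar).subset fun t ht => ?_
  have ht' : t.size = n := ht
  refine ⟨t.toPlanar, ?_, ofPlanar_toPlanar t⟩
  rw [Set.mem_ofPred_eq, ← size_ofPlanar, ofPlanar_toPlanar, ht']

theorem finite_ofPlanar_eq (t : RTree) : {T : PTree | ofPlanar T = t}.Finite := by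
  refine (PTree.finite_size_le t.size).subset fun T hT => ?_
  have hT' : ofPlanar T = t := hT
  rw [Set.mem_ofPred_eq, ← size_ofPlanar, hT']

end RTree

/-! ## Sums over splittings of a list -/

section Shuffle

variable {α M : Type*} [AddCommMonoid M]

/-- The sum of `Φ B C` over all ways to split `A` into two complementary subsequences `B`, `C`. -/
def splitSum : List α → (List α → List α → M) → M
  | [], Φ => Φ [] []
  | a :: A, Φ => splitSum A (fun B C => Φ B (a :: C)) + splitSum A fun B C => Φ (a :: B) C

/-- The sum of `Φ a B` over all ways to remove an entry `a` from `A`, leaving `B`. -/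
def removeSum : List α → (α → List α → M) → M
  | [], _ => 0
  | a :: A, Φ => Φ a A + removeSum A fun b B => Φ b (a :: B)

theorem map_splitSum {N F : Type*} [AddCommMonoid N] [FunLike F M N] [AddMonoidHomClass F M N]
    (f : F) (A : List α) (Φ : List α → List α → M) :
    f (splitSum A Φ) = splitSum A fun B C => f (Φ B C) := by
  induction A generalizing Φ with
  | nil => rfl
  | cons a A ih => rw [splitSum, splitSum, map_add, ih, ih]

theorem map_removeSum {N F : Type*} [AddCommMonoid N] [FunLike F M N] [AddMonoidHomClass F M N]
    (f : F) (A : List α) (Φ : α → List α → M) :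
    f (removeSum A Φ) = removeSum A fun b B => f (Φ b B) := by
  induction A generalizing Φ with
  | nil => exact map_zero f
  | cons a A ih => rw [removeSum, removeSum, map_add, ih]

theorem splitSum_add (A : List α) (Φ Ψ : List α → List α → M) :
    splitSum A (fun B C => Φ B C + Ψ B C) = splitSum A Φ + splitSum A Ψ := by
  induction A generalizing Φ Ψ with
  | nil => rfl
  | cons a A ih => rw [splitSum, splitSum, splitSum, ih, ih, add_add_add_comm]

theorem splitSum_zero (A : List α) : splitSum A (fun _ _ => (0 : M)) = 0 := by
  induction A with
  | nil => rfl
  | cons a A ih => rw [splitSum, ih, add_zero]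

theorem removeSum_add (A : List α) (Φ Ψ : α → List α → M) :
    removeSum A (fun b B => Φ b B + Ψ b B) = removeSum A Φ + removeSum A Ψ := by
  induction A generalizing Φ Ψ with
  | nil => exact (add_zero 0).symm
  | cons a A ih => rw [removeSum, removeSum, removeSum, ih, add_add_add_comm]

theorem removeSum_zero (A : List α) : removeSum A (fun _ _ => (0 : M)) = 0 := by
  induction A with
  | nil => rfl
  | cons a A ih => rw [removeSum, ih, add_zero]

theorem splitSum_sum {ι : Type*} (s : Finset ι) (A : List α) (Φ : ι → List α → List α → M) :
    splitSum A (fun B C => ∑ i ∈ s, Φ i B C) = ∑ i ∈ s, splitSum A (Φ i) := by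
  induction A generalizing Φ with
  | nil => rfl
  | cons a A ih => simp only [splitSum, ih, Finset.sum_add_distrib]

theorem splitSum_removeSum {β : Type*} (A : List α) (C : List β)
    (Φ : List α → List α → β → List β → M) :
    splitSum A (fun A₁ A₂ => removeSum C fun c C' => Φ A₁ A₂ c C') =
      removeSum C fun c C' => splitSum A fun A₁ A₂ => Φ A₁ A₂ c C' := by
  induction C generalizing Φ with
  | nil => exact splitSum_zero A
  | cons c C ih => simp only [removeSum, splitSum_add, ih]

/-- Marking an entry of one part of a splitting is the same as marking an entry of `A` first and
splitting the rest. -/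
theorem splitSum_removeSum_right (A : List α) (Φ : α → List α → List α → M) :
    splitSum A (fun A₁ A₂ => removeSum A₂ fun a A₂' => Φ a A₁ A₂') =
      removeSum A fun a A' => splitSum A' (Φ a) := by
  induction A generalizing Φ with
  | nil => rfl
  | cons a A ih =>
    simp only [splitSum, removeSum, splitSum_add, removeSum_add, ih]
    rw [add_assoc]

theorem splitSum_removeSum_left (A : List α) (Φ : α → List α → List α → M) :
    splitSum A (fun A₁ A₂ => removeSum A₁ fun a A₁' => Φ a A₁' A₂) =
      removeSum A fun a A' => splitSum A' (Φ a) := by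
  induction A generalizing Φ with
  | nil => rfl
  | cons a A ih =>
    simp only [splitSum, removeSum, splitSum_add, removeSum_add, ih]
    rw [add_left_comm]

/-- Both sides run over the distributions of `A` into three labelled parts. -/
theorem splitSum_splitSum_right_comm (A : List α) (Φ : List α → List α → List α → M) :
    splitSum A (fun A₁ A₂ => splitSum A₂ fun A₃ A₄ => Φ A₁ A₃ A₄) =
      splitSum A fun A₃ A₂ => splitSum A₂ fun A₁ A₄ => Φ A₁ A₃ A₄ := by
  induction A generalizing Φ with
  | nil => rfl
  | cons a A ih =>
    simp only [splitSum, splitSum_add]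
    rw [ih, ih fun A₁ A₃ A₄ => Φ A₁ (a :: A₃) A₄, ih fun A₁ A₃ A₄ => Φ (a :: A₁) A₃ A₄]
    abel

theorem splitSum_eq_of_cons_left_eq_zero (A : List α) (Φ : List α → List α → M)
    (h : ∀ b B C, Φ (b :: B) C = 0) : splitSum A Φ = Φ [] A := by
  induction A generalizing Φ with
  | nil => rfl
  | cons a A ih =>
    rw [splitSum, ih (fun B C => Φ B (a :: C)) fun b B C => h b B _]
    simp only [h, splitSum_zero, add_zero]

/-- `Multiset.antidiagonal` repeats a pair once for each set of positions producing it, exactly as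
splittings of a list do. -/
theorem antidiagonal_map_sum {β : Type*} (f : α → β) (A : List α)
    (Φ : Multiset β → Multiset β → M) :
    (((A.map f : List β) : Multiset β).antidiagonal.map fun p => Φ p.1 p.2).sum =
      splitSum A fun B C => Φ (B.map f : List β) (C.map f : List β) := by
  induction A generalizing Φ with
  | nil => simp [splitSum]
  | cons a A ih =>
    rw [List.map_cons, ← Multiset.cons_coe, Multiset.antidiagonal_cons, Multiset.map_add,
      Multiset.sum_add, Multiset.map_map, Multiset.map_map, splitSum]
    exact congrArg₂ _ (ih fun s t => Φ s (f a ::ₘ t)) (ih fun s t => Φ (f a ::ₘ s) t)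

variable {P : Type*} [Fintype P]

/-- The sum of `Ψ (fiberList A f)` over all functions `f`. -/
def allSum : List α → ((P → List α) → M) → M
  | [], Ψ => Ψ fun _ => []
  | a :: A, Ψ => ∑ p, allSum A fun F => Ψ (consAt p a F)

theorem sum_eq_allSum (A : List α) (Ψ : (P → List α) → M) :
    open Classical in ∑ f : Fin A.length → P, Ψ (fiberList A f) = allSum A Ψ := by
  classical
  induction A generalizing Ψ with
  | nil =>
    have : Unique (Fin ([] : List α).length → P) := inferInstanceAs (Unique (Fin 0 → P))
    rw [Fintype.sum_unique, allSum]
    congr 1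
  | cons a A ih =>
    refine ((Fin.consEquiv fun _ => P).sum_comp _).symm.trans ?_
    rw [Fintype.sum_prod_type, allSum]
    refine Finset.sum_congr rfl fun p _ => ?_
    rw [← ih]
    exact Finset.sum_congr rfl fun f _ => congrArg Ψ (fiberList_cons a A p f)

/-- A function into a disjoint union is a splitting of its domain together with a function on each
part. -/
theorem allSum_sum {P₁ P₂ : Type*} [Fintype P₁] [Fintype P₂] {i : P₁ → P} {j : P₂ → P}
    (hb : Function.Bijective (Sum.elim i j)) (A : List α)
    (Ψ : (P₁ → List α) → (P₂ → List α) → M) :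
    allSum A (fun F => Ψ (F ∘ i) (F ∘ j)) = splitSum A fun B C =>
      allSum B fun F => allSum C fun G => Ψ F G := by
  have hi : Function.Injective i := fun x x' h => by
    simpa using hb.1 (a₁ := .inl x) (a₂ := .inl x') h
  have hj : Function.Injective j := fun x x' h => by
    simpa using hb.1 (a₁ := .inr x) (a₂ := .inr x') h
  have hne : ∀ x y, i x ≠ j y := fun x y h => by
    simpa using hb.1 (a₁ := .inl x) (a₂ := .inr y) h
  -- The choice for the first entry has to be moved outside the sum over the assignments of the
  -- other part.
  have hswap : ∀ (B : List α) (Φ : P₂ → (P₁ → List α) → M),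
      allSum B (fun F => ∑ y, Φ y F) = ∑ y, allSum B (Φ y) := by
    intro B
    induction B with
    | nil => exact fun _ => rfl
    | cons b B ih =>
      intro Φ
      simp only [allSum, ih]
      exact Finset.sum_comm
  induction A generalizing Ψ with
  | nil => rfl
  | cons a A ih =>
    simp only [allSum, splitSum, hswap, splitSum_sum]
    rw [← (Equiv.ofBijective _ hb).sum_comp, Fintype.sum_sum_type, add_comm]
    congr 1
    · refine Finset.sum_congr rfl fun y _ => ?_
      simp only [Equiv.ofBijective_apply, Sum.elim_inr, consAt_comp hj,
        consAt_comp_of_ne (fun x => (hne x y).symm)]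
      exact ih fun F G => Ψ F (consAt y a G)
    · refine Finset.sum_congr rfl fun x _ => ?_
      simp only [Equiv.ofBijective_apply, Sum.elim_inl, consAt_comp hi, consAt_comp_of_ne (hne x)]
      exact ih fun F G => Ψ (consAt x a F) G

theorem allSum_unique [Unique P] (A : List α) (Ψ : List α → M) :
    allSum A (fun F : P → List α => Ψ (F default)) = Ψ A := by
  induction A generalizing Ψ with
  | nil => rfl
  | cons a A ih =>
    rw [allSum, Fintype.sum_unique, ← ih fun L => Ψ (a :: L)]
    simp [consAt]

theorem map_allSum {N F : Type*} [AddCommMonoid N] [FunLike F M N] [AddMonoidHomClass F M N]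
    (f : F) (A : List α) (Ψ : (P → List α) → M) :
    f (allSum A Ψ) = allSum A fun F => f (Ψ F) := by
  induction A generalizing Ψ with
  | nil => rfl
  | cons a A ih => simp only [allSum, map_sum, ih]

end Shuffle

/-! ### Vertices of the first branch and the remaining vertices -/

namespace PTree

/-- The inclusion of the vertices of the first branch. -/
def vertFirst {n : ℕ} (c : Fin (n + 1) → PTree) (v : (c 0).Vert) : (node (n + 1) c).Vert :=
  WithTop.some (⟨0, v⟩ : Σ i : Fin (n + 1), (c i).Vert)

/-- The inclusion of the vertices that are not in the first branch. -/
def vertShift {n : ℕ} (c : Fin (n + 1) → PTree) (v : (node n fun i => c i.succ).Vert) :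
    (node (n + 1) c).Vert :=
  WithTop.map (fun q : Σ i : Fin n, (c i.succ).Vert =>
    (⟨q.1.succ, q.2⟩ : Σ i : Fin (n + 1), (c i).Vert)) v

theorem bijective_vertFirst_vertShift {n : ℕ} (c : Fin (n + 1) → PTree) :
    Function.Bijective (Sum.elim (vertFirst c) (vertShift c)) := by
  refine ⟨Function.Injective.sumElim (fun x y h => ?_) ?_ fun x y => ?_, fun p => ?_⟩
  · simpa using WithTop.coe_injective h
  · refine WithTop.map_injective ?_
    rintro ⟨i, x⟩ ⟨j, y⟩ h
    obtain rfl : i = j := Fin.succ_injective _ (congrArg Sigma.fst h)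
    simpa using h
  · cases y using WithTop.recTopCoe with
    | top => exact WithTop.coe_ne_top
    | coe y => exact fun h => (Fin.succ_ne_zero y.1).symm (congrArg Sigma.fst (WithTop.coe_injective h))
  · cases p using WithTop.recTopCoe with
    | top => exact ⟨Sum.inr (⊤ : WithTop (Σ i : Fin n, (c i.succ).Vert)), rfl⟩
    | coe p =>
      obtain ⟨i, p⟩ := p
      cases i using Fin.cases with
      | zero => exact ⟨Sum.inl p, rfl⟩
      | succ i => exact ⟨Sum.inr (WithTop.some (⟨i, p⟩ : Σ i : Fin n, (c i.succ).Vert)), rfl⟩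

theorem children_graft_zero (c : Fin 0 → PTree) (F : (node 0 c).Vert → List PTree) :
    ((node 0 c).graft F).children = F (⊤ : WithTop (Σ i : Fin 0, (c i).Vert)) := by
  rw [graft, children_ofList]
  simp

/-- The trees attached to the root are listed in front of the first branch, which is moved past
them. A permutation is harmless in the commutative algebra `H_K`. -/
theorem children_graft_succ_perm {n : ℕ} (c : Fin (n + 1) → PTree)
    (F : (node (n + 1) c).Vert → List PTree) :
    ((node (n + 1) c).graft F).children.Perm
      ((c 0).graft (F ∘ vertFirst c) ::
        ((node n fun i => c i.succ).graft (F ∘ vertShift c)).children) := by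
  rw [graft, graft, children_ofList, children_ofList, List.ofFn_succ]
  exact List.perm_middle

end PTree

/-! ## The duality of `kT` and `H_K` -/

section Rooted

variable {k : Type*} [Field k]

variable (k) in
/-- The monomial of a forest. -/
def forest (L : List PTree) : HK k := (L.map fun T => MvPolynomial.X (RTree.ofPlanar T)).prod

theorem forest_nil : forest k [] = 1 := rfl

theorem forest_cons (T : PTree) (L : List PTree) :
    forest k (T :: L) = MvPolynomial.X (RTree.ofPlanar T) * forest k L := List.prod_cons

theorem forest_perm {L L' : List PTree} (h : L.Perm L') : forest k L = forest k L' :=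
  (h.map _).prod_eq

open Classical in
theorem forest_eq_monomial (L : List PTree) : forest k L =
    MvPolynomial.monomial (Multiset.toFinsupp (L.map RTree.ofPlanar : List RTree)) 1 := by
  induction L with
  | nil => simp [forest_nil]
  | cons T L ih =>
    rw [forest_cons, ih, MvPolynomial.X, MvPolynomial.monomial_mul, one_mul, List.map_cons,
      ← Multiset.cons_coe, ← Multiset.singleton_add, map_add, Multiset.toFinsupp_singleton]

theorem monomial_eq_forest (s : RTree →₀ ℕ) : (MvPolynomial.monomial s 1 : HK k) =
    forest k ((Finsupp.toMultiset s).toList.map RTree.toPlanar) := by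
  classical
  rw [forest_eq_monomial, RTree.map_ofPlanar_map_toPlanar, Multiset.coe_toList,
    Finsupp.toMultiset_toFinsupp]

theorem linearMap_ext_forest {M : Type*} [AddCommMonoid M] [Module k M] {f g : HK k →ₗ[k] M}
    (h : ∀ L, f (forest k L) = g (forest k L)) : f = g := by
  refine (MvPolynomial.basisMonomials RTree k).ext fun s => ?_
  change f (MvPolynomial.monomial s 1) = g (MvPolynomial.monomial s 1)
  rw [monomial_eq_forest]
  exact h _

theorem bPlus_forest (L : List PTree) :
    bPlus k (forest k L) = Finsupp.single (RTree.ofPlanar (PTree.ofList L)) 1 := by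
  classical
  rw [forest_eq_monomial]
  refine ((MvPolynomial.basisMonomials RTree k).constr_basis k _ _).trans ?_
  rw [Multiset.toFinsupp_toMultiset, RTree.ofMultiset_coe_map]

theorem inclKT_single (t : RTree) : inclKT k (Finsupp.single t 1) = MvPolynomial.X t := by
  simp [inclKT]

theorem inclKT_bPlus_forest (T : PTree) :
    inclKT k (bPlus k (forest k T.children)) = MvPolynomial.X (RTree.ofPlanar T) := by
  rw [bPlus_forest, inclKT_single, PTree.ofList_children]

/-- The weight of a pair of trees: the number of isomorphisms. -/
def isoWeight (k : Type*) [Field k] (t x : RTree) : k :=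
  open Classical in if t = x then (t.symOrder : k) else 0

theorem innerKT_single (t : RTree) (x : KT k) :
    innerKT k (Finsupp.single t 1) x = t.symOrder * x t := by
  simp [innerKT]

theorem innerKT_single_single (t x : RTree) :
    innerKT k (Finsupp.single t 1) (Finsupp.single x 1) = isoWeight k t x := by
  classical
  rw [innerKT_single, Finsupp.single_apply, isoWeight, mul_ite, mul_one, mul_zero]
  exact if_congr eq_comm rfl rfl

theorem pairKT_single_forest (t : RTree) (L : List PTree) : pairKT k (Finsupp.single t 1)
    (forest k L) = isoWeight k t (RTree.ofPlanar (PTree.ofList L)) := by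
  rw [pairKT, LinearMap.compl₂_apply, bPlus_forest, innerKT_single_single]

/-- Only entries isomorphic to `x` have nonzero weight, and each of them contributes the same
amount. -/
theorem removeSum_isoWeight (x : RTree) (A : List PTree) (φ : Multiset RTree → k) :
    open Classical in
    removeSum A (fun a A' => isoWeight k (RTree.ofPlanar a) x *
      φ (A'.map RTree.ofPlanar : List RTree)) =
      ((A.map RTree.ofPlanar : List RTree) : Multiset RTree).count x * (x.symOrder *
        φ (((A.map RTree.ofPlanar : List RTree) : Multiset RTree).erase x)) := by
  classical
  induction A generalizing φ with
  | nil => simp [removeSum]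
  | cons b A ih =>
    have ih' := ih fun s => φ (RTree.ofPlanar b ::ₘ s)
    rw [removeSum, List.map_cons, ← Multiset.cons_coe]
    refine (congrArg₂ _ rfl ih').trans ?_
    by_cases hb : RTree.ofPlanar b = x
    · rw [hb, Multiset.count_cons_self, Multiset.erase_cons_head, isoWeight, if_pos rfl]
      by_cases hx : x ∈ ((A.map RTree.ofPlanar : List RTree) : Multiset RTree)
      · rw [Multiset.cons_erase hx]
        push_cast
        ring
      · rw [Multiset.count_eq_zero_of_notMem hx]
        simp
    · rw [isoWeight, if_neg hb, zero_mul, zero_add, Multiset.count_cons_of_ne (Ne.symm hb),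
        Multiset.erase_cons_tail _ hb]

/-- The number of copies of `x` that can be removed from `A`, times `|Sym(x)|`, is exactly the
factor by which the symmetry order grows in `symOrder_ofMultiset_cons`. -/
theorem pairKT_forest_cons (A : List PTree) (x : PTree) (L : List PTree) :
    pairKT k (Finsupp.single (RTree.ofPlanar (PTree.ofList A)) 1) (forest k (x :: L)) =
      removeSum A fun a A' => isoWeight k (RTree.ofPlanar a) (RTree.ofPlanar x) *
        pairKT k (Finsupp.single (RTree.ofPlanar (PTree.ofList A')) 1) (forest k L) := by
  classical
  simp only [pairKT_single_forest, ← RTree.ofMultiset_coe_map]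
  rw [removeSum_isoWeight (RTree.ofPlanar x) A fun s => isoWeight k (RTree.ofMultiset s)
    (RTree.ofMultiset (L.map RTree.ofPlanar : List RTree))]
  rw [List.map_cons, ← Multiset.cons_coe]
  simp only [isoWeight, RTree.ofMultiset_injective.eq_iff]
  generalize ((A.map RTree.ofPlanar : List RTree) : Multiset RTree) = s
  generalize ((L.map RTree.ofPlanar : List RTree) : Multiset RTree) = t
  by_cases h : s = RTree.ofPlanar x ::ₘ t
  · rw [if_pos h, h, Multiset.erase_cons_head, if_pos rfl, Multiset.count_cons_self,
      RTree.symOrder_ofMultiset_cons]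
    push_cast
    ring
  · rw [if_neg h]
    by_cases hx : RTree.ofPlanar x ∈ s
    · rw [if_neg, mul_zero, mul_zero]
      rintro rfl
      exact h (Multiset.cons_erase hx).symm
    · rw [Multiset.count_eq_zero_of_notMem hx, Nat.cast_zero, zero_mul]

theorem pairKT_X_mul (A : List PTree) (x : RTree) (u : HK k) :
    pairKT k (Finsupp.single (RTree.ofPlanar (PTree.ofList A)) 1) (MvPolynomial.X x * u) =
      removeSum A fun a A' => isoWeight k (RTree.ofPlanar a) x *
        pairKT k (Finsupp.single (RTree.ofPlanar (PTree.ofList A')) 1) u := by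
  obtain ⟨x, rfl⟩ := RTree.ofPlanar_surjective x
  -- Forming the sum in the space of functionals makes linearity in `u` automatic, so that forests
  -- suffice.
  let f : List PTree → HK k →ₗ[k] k := fun A => removeSum A fun a A' =>
    isoWeight k (RTree.ofPlanar a) (RTree.ofPlanar x) •
      pairKT k (Finsupp.single (RTree.ofPlanar (PTree.ofList A')) 1)
  have hf : ∀ u, f A u = removeSum A fun a A' => isoWeight k (RTree.ofPlanar a) (RTree.ofPlanar x) *
      pairKT k (Finsupp.single (RTree.ofPlanar (PTree.ofList A')) 1) u := fun u =>
    map_removeSum (LinearMap.applyₗ u) A _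
  rw [← hf]
  have : pairKT k (Finsupp.single (RTree.ofPlanar (PTree.ofList A)) 1) ∘ₗ
      LinearMap.mulLeft k (MvPolynomial.X (RTree.ofPlanar x)) = f A := by
    refine linearMap_ext_forest fun L => ?_
    rw [hf, LinearMap.comp_apply, LinearMap.mulLeft_apply, ← forest_cons, pairKT_forest_cons]
  exact LinearMap.congr_fun this u

theorem pairKT_single_one (A : List PTree) :
    pairKT k (Finsupp.single (RTree.ofPlanar (PTree.ofList A)) 1) 1 =
      open Classical in if A = [] then 1 else 0 := by
  classical
  rw [← forest_nil, pairKT_single_forest, isoWeight, ← RTree.ofMultiset_coe_map,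
    ← RTree.ofMultiset_coe_map, RTree.ofMultiset_injective.eq_iff]
  cases A with
  | nil => simp [RTree.symOrder_ofMultiset]
  | cons a A => simp

/-- Induction on `u`, one tree at a time. Each tree removes a branch, and removing from the left
part of a splitting commutes with splitting. -/
theorem pairKT_single_mul (A : List PTree) (u v : HK k) :
    pairKT k (Finsupp.single (RTree.ofPlanar (PTree.ofList A)) 1) (u * v) =
      splitSum A fun A₁ A₂ => pairKT k (Finsupp.single (RTree.ofPlanar (PTree.ofList A₁)) 1) u *
        pairKT k (Finsupp.single (RTree.ofPlanar (PTree.ofList A₂)) 1) v := by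
  classical
  induction u using MvPolynomial.induction_on generalizing A with
  | C c =>
    rw [splitSum_eq_of_cons_left_eq_zero]
    · rw [← MvPolynomial.smul_eq_C_mul, map_smul, ← mul_one (MvPolynomial.C c),
        ← MvPolynomial.smul_eq_C_mul, map_smul, pairKT_single_one]
      simp
    · intro b B C
      rw [← mul_one (MvPolynomial.C c), ← MvPolynomial.smul_eq_C_mul, map_smul, pairKT_single_one]
      simp
  | add u u' hu hu' => simp only [add_mul, map_add, hu, hu', splitSum_add]
  | mul_X u x hu =>
    rw [mul_comm u, mul_assoc, pairKT_X_mul]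
    simp only [hu, pairKT_X_mul]
    have h1 : ∀ (c : k) (A : List PTree) (Φ : List PTree → List PTree → k),
        c * splitSum A Φ = splitSum A fun B C => c * Φ B C := fun c A Φ =>
      map_splitSum (AddMonoidHom.mulLeft c) A Φ
    have h2 : ∀ (c : k) (A : List PTree) (Φ : PTree → List PTree → k),
        removeSum A Φ * c = removeSum A fun B C => Φ B C * c := fun c A Φ =>
      map_removeSum (AddMonoidHom.mulRight c) A Φ
    simp only [h1, h2]
    rw [splitSum_removeSum_left]
    simp only [mul_assoc]

end Rooted

/-! ### Derivations of `H_K` and the Grossman–Larson product -/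

section Rooted

variable {k : Type*} [Field k]

/-- The derivation `|Sym(x)| ∂/∂x` of `H_K`. -/
def symDeriv (k : Type*) [Field k] (x : RTree) : Derivation k (HK k) (HK k) :=
  (x.symOrder : k) • MvPolynomial.pderiv x

theorem symDeriv_X (x t : RTree) :
    symDeriv k x (MvPolynomial.X t) = MvPolynomial.C (isoWeight k t x) := by
  classical
  rw [symDeriv, Derivation.smul_apply, MvPolynomial.pderiv_X, isoWeight]
  by_cases h : t = x
  · subst h
    simp [MvPolynomial.smul_eq_C_mul]
  · simp [h]

theorem symDeriv_forest (x : RTree) (A : List PTree) : symDeriv k x (forest k A) =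
    removeSum A fun a A' => isoWeight k (RTree.ofPlanar a) x • forest k A' := by
  induction A with
  | nil => exact (symDeriv k x).map_one_eq_zero
  | cons a A ih =>
    rw [forest_cons, Derivation.leibniz, ih, symDeriv_X, removeSum, add_comm, smul_eq_mul,
      smul_eq_mul, mul_comm (forest k A), ← MvPolynomial.smul_eq_C_mul]
    congr 1
    refine (map_removeSum (AddMonoidHom.mulLeft (MvPolynomial.X (RTree.ofPlanar a))) A _).trans ?_
    simp only [AddMonoidHom.coe_mulLeft, mul_smul_comm, forest_cons]

variable (k) in
/-- The symmetric bilinear form on `H_K` given by `⟨B_+(u), v⟩`. -/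
def formHK : HK k →ₗ[k] HK k →ₗ[k] k := pairKT k ∘ₗ bPlus k

theorem formHK_forest (A : List PTree) (u : HK k) : formHK k (forest k A) u =
    pairKT k (Finsupp.single (RTree.ofPlanar (PTree.ofList A)) 1) u := by
  rw [formHK, LinearMap.comp_apply, bPlus_forest]

/-- The derivation deletes an occurrence of `x` with weight `|Sym(x)|`, which is what multiplication
by `x` requires on the other side of the pairing. -/
theorem formHK_X_mul (w u : HK k) (x : RTree) :
    formHK k w (MvPolynomial.X x * u) = formHK k (symDeriv k x w) u := by
  have : (formHK k).flip (MvPolynomial.X x * u) = (formHK k).flip u ∘ₗ (symDeriv k x).toLinearMap := by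
    refine linearMap_ext_forest fun A => ?_
    rw [LinearMap.comp_apply, Derivation.coeFn_coe, symDeriv_forest, map_removeSum,
      LinearMap.flip_apply, formHK_forest, pairKT_X_mul]
    simp only [map_smul, LinearMap.flip_apply, formHK_forest, smul_eq_mul]
  exact LinearMap.congr_fun this w

/-- The derivative of a single tree is a constant counting its isomorphisms with `x`, and these are
counted by pairing the forests below the two roots. -/
theorem symDeriv_inclKT_bPlus (x : PTree) (w : HK k) :
    symDeriv k (RTree.ofPlanar x) (inclKT k (bPlus k w)) =
      MvPolynomial.C (formHK k w (forest k x.children)) := by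
  have : (symDeriv k (RTree.ofPlanar x)).toLinearMap ∘ₗ inclKT k ∘ₗ bPlus k =
      (Algebra.linearMap k (HK k)) ∘ₗ (formHK k).flip (forest k x.children) := by
    refine linearMap_ext_forest fun A => ?_
    simp only [LinearMap.comp_apply, Derivation.coeFn_coe, LinearMap.flip_apply, bPlus_forest,
      inclKT_single, symDeriv_X, formHK_forest, pairKT_single_forest, PTree.ofList_children]
    rfl
  exact LinearMap.congr_fun this w

variable (k) in
/-- The forest obtained by attaching the trees in `A` to the vertices of `T` in all ways and then
removing the root. -/
def graftSum (A : List PTree) (T : PTree) : HK k :=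
  allSum A fun F : T.Vert → List PTree => forest k (T.graft F).children

theorem graftSum_ofList_nil (A : List PTree) :
    graftSum k A (PTree.ofList []) = forest k A := by
  have h : ∀ c : Fin 0 → PTree, graftSum k A (.node 0 c) = forest k A := by
    intro c
    let _ : Unique (PTree.node 0 c).Vert := inferInstanceAs (Unique (Option (Σ i : Fin 0, (c i).Vert)))
    simp only [graftSum, PTree.children_graft_zero]
    exact allSum_unique A (forest k)
  exact h _

/-- Each attached tree goes either to a vertex of the first branch or to a vertex outside it, and
the two choices are independent. -/
theorem graftSum_ofList_cons (A : List PTree) (c : PTree) (C : List PTree) :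
    graftSum k A (PTree.ofList (c :: C)) = splitSum A fun A₁ A₂ =>
      inclKT k (bPlus k (graftSum k A₁ c)) * graftSum k A₂ (PTree.ofList C) := by
  have h : ∀ {n : ℕ} (c : Fin (n + 1) → PTree), graftSum k A (.node (n + 1) c) =
      splitSum A fun A₁ A₂ => inclKT k (bPlus k (graftSum k A₁ (c 0))) *
        graftSum k A₂ (.node n fun i => c i.succ) := by
    intro n c
    have h1 : ∀ F : (PTree.node (n + 1) c).Vert → List PTree,
        forest k ((PTree.node (n + 1) c).graft F).children =
          inclKT k (bPlus k (forest k ((c 0).graft (F ∘ PTree.vertFirst c)).children)) *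
            forest k ((PTree.node n fun i => c i.succ).graft (F ∘ PTree.vertShift c)).children := by
      intro F
      rw [forest_perm (PTree.children_graft_succ_perm c F), forest_cons, inclKT_bPlus_forest]
    simp only [graftSum, h1]
    rw [allSum_sum (PTree.bijective_vertFirst_vertShift c) A fun F G =>
      inclKT k (bPlus k (forest k ((c 0).graft F).children)) *
        forest k ((PTree.node n fun i => c i.succ).graft G).children]
    congr 1
    funext A₁ A₂
    have h2 : ∀ u : HK k, allSum A₂ (fun G => u *
        forest k ((PTree.node n fun i => c i.succ).graft G).children) = u * allSum A₂ fun G =>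
          forest k ((PTree.node n fun i => c i.succ).graft G).children := fun u =>
      (map_allSum (AddMonoidHom.mulLeft u) A₂ _).symm
    simp only [h2]
    rw [map_allSum, map_allSum]
    exact (map_allSum (AddMonoidHom.mulRight _) A₁ _).symm
  exact h _

/-- By the Leibniz rule, a branch of the grafted tree isomorphic to `x` is either a tree of `A`
attached to the root or an original branch `c` carrying a part `A₁` of `A`. -/
theorem symDeriv_graftSum (x : PTree) (A C : List PTree) :
    symDeriv k (RTree.ofPlanar x) (graftSum k A (PTree.ofList C)) =
      (removeSum A fun a A' => isoWeight k (RTree.ofPlanar a) (RTree.ofPlanar x) •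
        graftSum k A' (PTree.ofList C)) +
      removeSum C fun c C' => splitSum A fun A₁ A₂ =>
        formHK k (graftSum k A₁ c) (forest k x.children) • graftSum k A₂ (PTree.ofList C') := by
  induction C generalizing A with
  | nil =>
    simp only [graftSum_ofList_nil, symDeriv_forest, removeSum, add_zero]
  | cons c C ih =>
    have hmul : ∀ (u : HK k) (A : List PTree) (Φ : PTree → List PTree → HK k),
        u * removeSum A Φ = removeSum A fun B C => u * Φ B C := fun u A Φ =>
      map_removeSum (AddMonoidHom.mulLeft u) A Φ
    have hmul' : ∀ (u : HK k) (A : List PTree) (Φ : List PTree → List PTree → HK k),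
        u * splitSum A Φ = splitSum A fun B C => u * Φ B C := fun u A Φ =>
      map_splitSum (AddMonoidHom.mulLeft u) A Φ
    have hsmul : ∀ (u : k) (A : List PTree) (Φ : List PTree → List PTree → HK k),
        u • splitSum A Φ = splitSum A fun B C => u • Φ B C := fun u A Φ =>
      map_splitSum (LinearMap.lsmul k (HK k) u) A Φ
    rw [graftSum_ofList_cons, map_splitSum]
    simp only [Derivation.leibniz, symDeriv_inclKT_bPlus, ih, smul_eq_mul, mul_add, hmul, hmul',
      splitSum_add, removeSum, graftSum_ofList_cons, hsmul, mul_smul_comm,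
      mul_comm _ (MvPolynomial.C _), ← MvPolynomial.smul_eq_C_mul]
    rw [splitSum_removeSum_right A fun a A₁ A₂ =>
      isoWeight k (RTree.ofPlanar a) (RTree.ofPlanar x) •
        (inclKT k (bPlus k (graftSum k A₁ c)) * graftSum k A₂ (PTree.ofList C)),
      splitSum_removeSum A C fun A₁ A₂ d C' => splitSum A₂ fun A₃ A₄ =>
        formHK k (graftSum k A₃ d) (forest k x.children) •
          (inclKT k (bPlus k (graftSum k A₁ c)) * graftSum k A₄ (PTree.ofList C')),
      add_assoc, add_comm (removeSum C _)]
    congr 2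
    congr 1
    funext d C'
    exact splitSum_splitSum_right_comm A fun A₁ A₃ A₄ =>
      formHK k (graftSum k A₃ d) (forest k x.children) •
        (inclKT k (bPlus k (graftSum k A₁ c)) * graftSum k A₄ (PTree.ofList C'))

variable (k) in
/-- The functional on `H_K ⊗ H_K` given by pairing with `B_+(A) ⊗ B_+(C)`. -/
def pairForests (A C : List PTree) : HK k ⊗[k] HK k →ₗ[k] k :=
  tensorPairing (pairKT k) (Finsupp.single (RTree.ofPlanar (PTree.ofList A)) 1 ⊗ₜ
    Finsupp.single (RTree.ofPlanar (PTree.ofList C)) 1)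

theorem pairForests_tmul (A C : List PTree) (u v : HK k) : pairForests k A C (u ⊗ₜ v) =
    pairKT k (Finsupp.single (RTree.ofPlanar (PTree.ofList A)) 1) u *
      pairKT k (Finsupp.single (RTree.ofPlanar (PTree.ofList C)) 1) v := tensorPairing_tmul _ _ _ _ _

theorem splitSum_mul {α : Type*} (u : k) (A : List α) (Φ : List α → List α → k) :
    splitSum A Φ * u = splitSum A fun B C => Φ B C * u := map_splitSum (AddMonoidHom.mulRight u) A Φ

theorem mul_removeSum {α : Type*} (u : k) (A : List α) (Φ : α → List α → k) :
    u * removeSum A Φ = removeSum A fun B C => u * Φ B C :=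
  map_removeSum (AddMonoidHom.mulLeft u) A Φ

theorem removeSum_mul {α : Type*} (u : k) (A : List α) (Φ : α → List α → k) :
    removeSum A Φ * u = removeSum A fun B C => Φ B C * u :=
  map_removeSum (AddMonoidHom.mulRight u) A Φ

theorem pairForests_X_mul (x : RTree) (A C : List PTree) (z : HK k ⊗[k] HK k) :
    pairForests k A C ((MvPolynomial.X x ⊗ₜ 1) * z) = removeSum A fun a A' =>
      isoWeight k (RTree.ofPlanar a) x * pairForests k A' C z := by
  induction z with
  | zero => simp [removeSum_zero]
  | add y z hy hz => simp only [mul_add, map_add, hy, hz, removeSum_add]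
  | tmul u v =>
    rw [Algebra.TensorProduct.tmul_mul_tmul, one_mul, pairForests_tmul, pairKT_X_mul, removeSum_mul]
    simp only [pairForests_tmul, mul_assoc]

/-- The right factor of each `B_+` term is one tree and consumes one branch `c` of `C`; on the left,
duality of product and coproduct splits `A`. -/
theorem pairForests_bPlus_mul (A C : List PTree) (y z : HK k ⊗[k] HK k) :
    pairForests k A C (TensorProduct.map LinearMap.id (inclKT k ∘ₗ bPlus k) y * z) =
      removeSum C fun c C' => splitSum A fun A₁ A₂ =>
        pairForests k A₁ c.children y * pairForests k A₂ C' z := by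
  induction y with
  | zero => simp [removeSum_zero, splitSum_zero]
  | add y y' hy hy' => simp only [map_add, add_mul, hy, hy', removeSum_add, splitSum_add]
  | tmul u v =>
    induction z with
    | zero => simp [removeSum_zero, splitSum_zero]
    | add z z' hz hz' => simp only [map_add, mul_add, hz, hz', removeSum_add, splitSum_add]
    | tmul u' v' =>
      have h : pairKT k (Finsupp.single (RTree.ofPlanar (PTree.ofList C)) 1)
          (inclKT k (bPlus k v) * v') = removeSum C fun c C' =>
            pairKT k (Finsupp.single (RTree.ofPlanar c) 1) v *
              pairKT k (Finsupp.single (RTree.ofPlanar (PTree.ofList C')) 1) v' := by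
        let f : HK k →ₗ[k] k := removeSum C fun c C' =>
          pairKT k (Finsupp.single (RTree.ofPlanar (PTree.ofList C')) 1) v' •
            pairKT k (Finsupp.single (RTree.ofPlanar c) 1)
        have hf : ∀ v, f v = removeSum C fun c C' =>
            pairKT k (Finsupp.single (RTree.ofPlanar c) 1) v *
              pairKT k (Finsupp.single (RTree.ofPlanar (PTree.ofList C')) 1) v' := by
          intro v
          refine (map_removeSum (LinearMap.applyₗ v) C _).trans ?_
          congr 1
          funext c C'
          exact mul_comm _ _
        rw [← hf]
        have : pairKT k (Finsupp.single (RTree.ofPlanar (PTree.ofList C)) 1) ∘ₗ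
            LinearMap.mulRight k v' ∘ₗ inclKT k ∘ₗ bPlus k = f := by
          refine linearMap_ext_forest fun L => ?_
          simp only [LinearMap.comp_apply, LinearMap.mulRight_apply, bPlus_forest, inclKT_single,
            pairKT_X_mul, hf, pairKT_single_forest]
        exact LinearMap.congr_fun this v
      rw [TensorProduct.map_tmul, Algebra.TensorProduct.tmul_mul_tmul, pairForests_tmul,
        LinearMap.id_apply, LinearMap.comp_apply, h, pairKT_single_mul, mul_removeSum]
      simp only [pairForests_tmul, splitSum_mul, PTree.ofList_children]
      congr 1
      funext c C'
      congr 1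
      funext A₁ A₂
      ring

variable (k) in
/-- The coproduct of a forest. -/
def comulHKForest (L : List PTree) : HK k ⊗[k] HK k := (L.map (comulHKTree k)).prod

theorem comulHKTree_ofList (L : List PTree) : comulHKTree k (PTree.ofList L) =
    MvPolynomial.X (RTree.ofPlanar (PTree.ofList L)) ⊗ₜ 1 +
      TensorProduct.map LinearMap.id (inclKT k ∘ₗ bPlus k) (comulHKForest k L) := by
  rw [PTree.ofList, comulHKTree, comulHKForest]
  congr 2
  rw [← List.prod_ofFn]
  congr 1
  conv_rhs => rw [← List.ofFn_get L, List.map_ofFn]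
  rfl

theorem comulHKForest_cons (x : PTree) (L : List PTree) : comulHKForest k (x :: L) =
    (MvPolynomial.X (RTree.ofPlanar x) ⊗ₜ 1) * comulHKForest k L +
      TensorProduct.map LinearMap.id (inclKT k ∘ₗ bPlus k) (comulHKForest k x.children) *
        comulHKForest k L := by
  have h := comulHKTree_ofList (k := k) x.children
  rw [PTree.ofList_children] at h
  rw [← add_mul, ← h]
  exact List.prod_cons

/-- Removing a tree `x` from `L` produces the two terms of `symDeriv_graftSum` on the left. On the
right they correspond to `x ⊗ 1` and `(id ⊗ B_+)Δ(B_-(x))`. This is the duality of the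
Grossman–Larson product and the coproduct of `H_K`. -/
theorem formHK_graftSum (L A C : List PTree) :
    formHK k (graftSum k A (PTree.ofList C)) (forest k L) =
      pairForests k A C (comulHKForest k L) := by
  classical
  have main : ∀ L : List PTree, (∀ T ∈ L, ∀ A C, formHK k (graftSum k A (PTree.ofList C))
      (forest k T.children) = pairForests k A C (comulHKForest k T.children)) →
      ∀ A C, formHK k (graftSum k A (PTree.ofList C)) (forest k L) =
        pairForests k A C (comulHKForest k L) := by
    intro L
    induction L with
    | nil =>
      intro _ A C
      have h1 : comulHKForest k [] = 1 ⊗ₜ 1 := rfl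
      rw [h1, pairForests_tmul, pairKT_single_one, pairKT_single_one, forest_nil]
      cases C with
      | nil => rw [graftSum_ofList_nil, formHK_forest, pairKT_single_one, if_pos rfl, mul_one]
      | cons c C =>
        rw [graftSum_ofList_cons, if_neg (List.cons_ne_nil c C), mul_zero, map_splitSum]
        -- Pairing with `1` sees only the empty forest, whereas every term here contains a tree.
        have h2 : ∀ u v : HK k, formHK k (inclKT k (bPlus k u) * v) 1 = 0 := by
          intro u v
          have : ((formHK k).flip 1 ∘ₗ LinearMap.mulRight k v) ∘ₗ inclKT k ∘ₗ bPlus k = 0 := by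
            refine linearMap_ext_forest fun A => ?_
            have : ((formHK k).flip 1 ∘ₗ
                LinearMap.mulLeft k (inclKT k (bPlus k (forest k A)))) = 0 := by
              refine linearMap_ext_forest fun B => ?_
              rw [LinearMap.comp_apply, LinearMap.mulLeft_apply, bPlus_forest, inclKT_single,
                ← forest_cons, LinearMap.flip_apply, formHK_forest, pairKT_single_one,
                if_neg (List.cons_ne_nil _ _), LinearMap.zero_apply]
            exact LinearMap.congr_fun this v
          exact LinearMap.congr_fun this u
        have h3 : ∀ A₁ A₂ : List PTree, formHK k (inclKT k (bPlus k (graftSum k A₁ c)) *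
          graftSum k A₂ (PTree.ofList C)) 1 = 0 := fun A₁ A₂ => h2 _ _
        have h4 := map_splitSum (LinearMap.applyₗ (1 : HK k)) A fun A₁ A₂ =>
          formHK k (inclKT k (bPlus k (graftSum k A₁ c)) * graftSum k A₂ (PTree.ofList C))
        refine h4.trans ?_
        simp only [LinearMap.applyₗ_apply_apply, h3, splitSum_zero]
    | cons x L ih =>
      intro h A C
      have ih' := ih fun T hT => h T (List.mem_cons_of_mem x hT)
      have hx : ∀ A c, formHK k (graftSum k A c) (forest k x.children) =
          pairForests k A c.children (comulHKForest k x.children) := fun A c => by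
        have := h x List.mem_cons_self A c.children
        rwa [PTree.ofList_children] at this
      rw [forest_cons, formHK_X_mul, symDeriv_graftSum, comulHKForest_cons,
        map_add (pairForests k A C), pairForests_X_mul, pairForests_bPlus_mul,
        ← LinearMap.flip_apply, map_add, map_removeSum, map_removeSum]
      simp only [map_splitSum, map_smul, LinearMap.flip_apply, ih', hx, smul_eq_mul]
  have all : ∀ T : PTree, ∀ A C, formHK k (graftSum k A (PTree.ofList C)) (forest k T.children) =
      pairForests k A C (comulHKForest k T.children) := by
    intro T
    induction T using PTree.list_induction with
    | h L ih =>
      rw [PTree.children_ofList]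
      exact main L ih
  exact main L (fun T _ => all T) A C

/-- The recursion takes a commutative product over the branches, so a matching of isomorphic
branches does not change it. Hence the representatives chosen in `opsHK` do not matter. -/
theorem comulHKTree_eq_of_ofPlanar_eq {S T : PTree} (h : RTree.ofPlanar S = RTree.ofPlanar T) :
    comulHKTree k S = comulHKTree k T := by
  induction S generalizing T with
  | node n c ih =>
    obtain ⟨m, d⟩ := T
    rw [comulHKTree, comulHKTree, h]
    obtain ⟨σ, hσ⟩ := (PTree.ofPlanar_node_eq_iff c d).1 h
    rw [← σ.prod_comp]
    congr 3
    funext i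
    exact ih i (hσ i).symm

theorem opsHK_comul_X (T : PTree) :
    (opsHK k).comul (MvPolynomial.X (RTree.ofPlanar T)) = comulHKTree k T := by
  refine (MvPolynomial.aeval_X _ _).trans (comulHKTree_eq_of_ofPlanar_eq ?_)
  rw [RTree.ofPlanar_toPlanar]

theorem comul_forest (L : List PTree) : (opsHK k).comul (forest k L) = comulHKForest k L := by
  change MvPolynomial.aeval _ _ = _
  rw [forest, map_list_prod, List.map_map, comulHKForest]
  congr 2
  funext T
  exact opsHK_comul_X T

theorem opsKT_mul_single (S T : PTree) : (opsKT k).mul (Finsupp.single (RTree.ofPlanar S) 1)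
    (Finsupp.single (RTree.ofPlanar T) 1) =
    glTree k (RTree.ofPlanar S) (RTree.ofPlanar T) := by
  simp [opsKT]

theorem glTree_eq (t t' : RTree) : glTree k t t' =
    bPlus k (graftSum k t.toPlanar.children t'.toPlanar) := by
  classical
  rw [graftSum, map_allSum, ← sum_eq_allSum, glTree]
  refine Finset.sum_congr (by congr) fun f _ => ?_
  rw [bPlus_forest, PTree.ofList_children]
  congr

theorem opsKT_comul_single (A : List PTree) :
    (opsKT k).comul (Finsupp.single (RTree.ofPlanar (PTree.ofList A)) 1) =
      splitSum A fun B C => (Finsupp.single (RTree.ofPlanar (PTree.ofList B)) (1 : k) : KT k) ⊗ₜ[k]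
        (Finsupp.single (RTree.ofPlanar (PTree.ofList C)) (1 : k) : KT k) := by
  simp only [opsKT, Finsupp.lift_apply, zero_smul, Finsupp.sum_single_index, one_smul]
  rw [RTree.children_ofPlanar, PTree.children_ofList, antidiagonal_map_sum RTree.ofPlanar A
    fun s t => (Finsupp.single (RTree.ofMultiset s) (1 : k) : KT k) ⊗ₜ[k]
        (Finsupp.single (RTree.ofMultiset t) (1 : k) : KT k)]
  simp only [RTree.ofMultiset_coe_map]

theorem linearMap_ext_ofPlanar {M : Type*} [AddCommMonoid M] [Module k M] {f g : KT k →ₗ[k] M}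
    (h : ∀ A : List PTree, f (Finsupp.single (RTree.ofPlanar (PTree.ofList A)) 1) =
      g (Finsupp.single (RTree.ofPlanar (PTree.ofList A)) 1)) : f = g := by
  refine linearMap_ext_single fun t => ?_
  obtain ⟨T, rfl⟩ := RTree.ofPlanar_surjective t
  rw [← PTree.ofList_children T]
  exact h _

theorem pairKT_mul_left (x y : KT k) (u : HK k) :
    pairKT k ((opsKT k).mul x y) u = tensorPairing (pairKT k) (x ⊗ₜ y) ((opsHK k).comul u) := by
  have h : (opsKT k).mul.compr₂ (pairKT k) = (TensorProduct.mk k _ _).compr₂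
      ((tensorPairing (pairKT k)).compl₂ (opsHK k).comul) := by
    refine linearMap_ext_single fun t => linearMap_ext_single fun t' => linearMap_ext_forest fun L => ?_
    simp only [LinearMap.compr₂_apply, LinearMap.compl₂_apply, TensorProduct.mk_apply]
    have h1 := opsKT_mul_single (k := k) t.toPlanar t'.toPlanar
    have h2 := formHK_graftSum (k := k) L t.toPlanar.children t'.toPlanar.children
    rw [RTree.ofPlanar_toPlanar, RTree.ofPlanar_toPlanar] at h1
    rw [PTree.ofList_children, pairForests, PTree.ofList_children, PTree.ofList_children,
      RTree.ofPlanar_toPlanar, RTree.ofPlanar_toPlanar] at h2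
    rw [h1, glTree_eq, comul_forest, ← h2]
    rfl
  exact LinearMap.congr_fun (LinearMap.congr_fun₂ h x y) u

theorem pairKT_mul_right (x : KT k) (u v : HK k) :
    pairKT k x (u * v) = tensorPairing (pairKT k) ((opsKT k).comul x) (u ⊗ₜ v) := by
  have h : (pairKT k).flip (u * v) = (tensorPairing (pairKT k)).flip (u ⊗ₜ v) ∘ₗ (opsKT k).comul := by
    refine linearMap_ext_ofPlanar fun A => ?_
    rw [LinearMap.flip_apply, LinearMap.comp_apply, opsKT_comul_single, pairKT_single_mul,
      map_splitSum]
    simp only [LinearMap.flip_apply, tensorPairing_tmul]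
  exact LinearMap.congr_fun h x

theorem isDualPair_pairKT : IsDualPair (opsKT k) (opsHK k) (pairKT k) where
  one_left u := by
    classical
    have : pairKT k (Finsupp.single (RTree.ofPlanar (PTree.ofList [])) 1) = (opsHK k).counit := by
      refine linearMap_ext_forest fun L => ?_
      change _ = MvPolynomial.aeval _ _
      cases L with
      | nil => rw [forest_nil, pairKT_single_one, if_pos rfl, map_one]
      | cons x L =>
        rw [forest_cons, map_mul (MvPolynomial.aeval fun _ : RTree => (0 : k)), MvPolynomial.aeval_X, zero_mul, pairKT_X_mul, removeSum]
    exact LinearMap.congr_fun this u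
  one_right x := by
    classical
    have : (pairKT k).flip 1 = (opsKT k).counit := by
      refine linearMap_ext_ofPlanar fun A => ?_
      rw [LinearMap.flip_apply, pairKT_single_one]
      change _ = (Finsupp.single (RTree.ofPlanar (PTree.ofList A)) (1 : k)) RTree.bullet
      rw [Finsupp.single_apply]
      refine if_congr ?_ rfl rfl
      rw [RTree.bullet_eq, ← RTree.ofMultiset_coe_map, RTree.ofMultiset_injective.eq_iff]
      simp
    exact LinearMap.congr_fun this x
  mul_left := pairKT_mul_left
  mul_right := pairKT_mul_right

theorem pairKT_forest_children (x : KT k) (T : PTree) :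
    pairKT k x (forest k T.children) = (RTree.ofPlanar T).symOrder * x (RTree.ofPlanar T) := by
  have : (pairKT k).flip (forest k T.children) =
      ((RTree.ofPlanar T).symOrder : k) • Finsupp.lapply (RTree.ofPlanar T) := by
    classical
    refine linearMap_ext_single fun t => ?_
    rw [LinearMap.flip_apply, pairKT_single_forest, PTree.ofList_children, LinearMap.smul_apply,
      Finsupp.lapply_apply, Finsupp.single_apply, isoWeight]
    by_cases h : t = RTree.ofPlanar T
    · simp [h]
    · simp [h]
  exact LinearMap.congr_fun this x

variable [CharZero k]

theorem symOrder_ne_zero (t : RTree) : (t.symOrder : k) ≠ 0 :=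
  Nat.cast_ne_zero.2 t.symOrder_pos.ne'

/-- Pairing with `B_-(T)` recovers the coefficient at `T` multiplied by `|Sym(T)|`, which is
invertible in characteristic `0`. -/
theorem separatingLeft_pairKT : (pairKT k).SeparatingLeft := by
  intro x hx
  refine Finsupp.ext fun t => ?_
  obtain ⟨T, rfl⟩ := RTree.ofPlanar_surjective t
  have := (pairKT_forest_children x T).symm.trans (hx _)
  exact (mul_eq_zero.1 this).resolve_left (symOrder_ne_zero _)

end Rooted

/-! ## Associativity by duality -/

section Assoc

variable {k A B : Type*} [Field k] [AddCommGroup A] [Module k A] [AddCommGroup B] [Module k B]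
  {opA : HopfOps k A} {opB : HopfOps k B} {p : A →ₗ[k] B →ₗ[k] k}

theorem IsDualPair.tensorPairing_mul_tmul (hp : IsDualPair opA opB p) (x y z : A) (s : B ⊗[k] B) :
    tensorPairing p (opA.mul x y ⊗ₜ z) s =
      TensorProduct.lid k k (TensorProduct.map (p x) (tensorPairing p (y ⊗ₜ z))
        (TensorProduct.assoc k _ _ _ (TensorProduct.map opB.comul LinearMap.id s))) := by
  induction s with
  | zero => simp
  | add s t hs ht => simp only [map_add, hs, ht]
  | tmul u v =>
    rw [tensorPairing_tmul, hp.mul_left, TensorProduct.map_tmul, LinearMap.id_apply]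
    induction opB.comul u with
    | zero => simp
    | add s t hs ht => simp only [map_add, TensorProduct.add_tmul, add_mul, hs, ht]
    | tmul a b => simp [mul_assoc]

theorem IsDualPair.tensorPairing_tmul_mul (hp : IsDualPair opA opB p) (x y z : A) (s : B ⊗[k] B) :
    tensorPairing p (x ⊗ₜ opA.mul y z) s =
      TensorProduct.lid k k (TensorProduct.map (p x) (tensorPairing p (y ⊗ₜ z))
        (TensorProduct.map LinearMap.id opB.comul s)) := by
  induction s with
  | zero => simp
  | add s t hs ht => simp only [map_add, hs, ht]
  | tmul u v =>
    rw [tensorPairing_tmul, hp.mul_left, TensorProduct.map_tmul, TensorProduct.map_tmul]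
    rfl

/-- Both bracketings pair with `u` as `x ⊗ y ⊗ z` with an iterated coproduct of `u`, so
associativity is dual to coassociativity. -/
theorem IsDualPair.mul_assoc_left (hp : IsDualPair opA opB p) (hs : p.SeparatingLeft)
    (h : ∀ u, TensorProduct.assoc k _ _ _ (TensorProduct.map opB.comul LinearMap.id (opB.comul u)) =
      TensorProduct.map LinearMap.id opB.comul (opB.comul u)) (x y z : A) :
    opA.mul (opA.mul x y) z = opA.mul x (opA.mul y z) := by
  refine sub_eq_zero.1 (hs _ fun u => ?_)
  rw [map_sub, LinearMap.sub_apply, hp.mul_left, hp.mul_left x, hp.tensorPairing_mul_tmul,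
    hp.tensorPairing_tmul_mul, h, sub_self]

theorem IsDualPair.one_mul_left (hp : IsDualPair opA opB p) (hs : p.SeparatingLeft)
    (h : ∀ u, TensorProduct.lid k _ (TensorProduct.map opB.counit LinearMap.id (opB.comul u)) = u)
    (x : A) : opA.mul opA.one x = x := by
  refine sub_eq_zero.1 (hs _ fun u => ?_)
  rw [map_sub, LinearMap.sub_apply, sub_eq_zero, hp.mul_left]
  conv_rhs => rw [← h u]
  induction opB.comul u with
  | zero => simp
  | add s t hs ht => simp only [map_add, hs, ht]
  | tmul a b => simp [hp.one_left]

theorem IsDualPair.mul_one_left (hp : IsDualPair opA opB p) (hs : p.SeparatingLeft)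
    (h : ∀ u, TensorProduct.rid k _ (TensorProduct.map LinearMap.id opB.counit (opB.comul u)) = u)
    (x : A) : opA.mul x opA.one = x := by
  refine sub_eq_zero.1 (hs _ fun u => ?_)
  rw [map_sub, LinearMap.sub_apply, sub_eq_zero, hp.mul_left]
  conv_rhs => rw [← h u]
  induction opB.comul u with
  | zero => simp
  | add s t hs ht => simp only [map_add, hs, ht]
  | tmul a b => simp [hp.one_left, mul_comm]

end Assoc

/-! ## The bialgebra axioms for `H_K` and `kT` -/

section Axioms

variable {k : Type*} [Field k]

variable (k) in
/-- The coproduct of `H_K` as a homomorphism of algebras. -/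
def comulHK : HK k →ₐ[k] HK k ⊗[k] HK k :=
  MvPolynomial.aeval fun t : RTree => comulHKTree k t.toPlanar

variable (k) in
/-- The counit of `H_K` as a homomorphism of algebras. -/
def counitHK : HK k →ₐ[k] k := MvPolynomial.aeval fun _ : RTree => (0 : k)

theorem comulMul_opsHK : (opsHK k).ComulMul := comulMul_ofAlgebra _ (comulHK k)

variable (k) in
/-- `B_+` as an operator on `H_K`. -/
def graftHK : HK k →ₗ[k] HK k := inclKT k ∘ₗ bPlus k

theorem graftHK_forest (L : List PTree) :
    graftHK k (forest k L) = MvPolynomial.X (RTree.ofPlanar (PTree.ofList L)) := by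
  rw [graftHK, LinearMap.comp_apply, bPlus_forest, inclKT_single]

/-- This is the cocycle property of `B_+`, extended from forests to all of `H_K` so that inductions
can go through `B_+`. -/
theorem comulHK_graftHK (u : HK k) : comulHK k (graftHK k u) =
    graftHK k u ⊗ₜ 1 + TensorProduct.map LinearMap.id (graftHK k) (comulHK k u) := by
  have : (comulHK k).toLinearMap ∘ₗ graftHK k = (TensorProduct.mk k _ _).flip 1 ∘ₗ graftHK k +
      TensorProduct.map LinearMap.id (graftHK k) ∘ₗ (comulHK k).toLinearMap := by
    refine linearMap_ext_forest fun L => ?_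
    simp only [LinearMap.comp_apply, LinearMap.add_apply, AlgHom.toLinearMap_apply, graftHK_forest,
      LinearMap.flip_apply, TensorProduct.mk_apply]
    rw [show comulHK k (forest k L) = _ from comul_forest L,
      show comulHK k (MvPolynomial.X _) = _ from opsHK_comul_X _, comulHKTree_ofList]
    rfl
  exact LinearMap.congr_fun this u

/-- Two homomorphisms of algebras on `H_K` agree if the equality on a forest implies that on the tree
obtained by adding a root. -/
theorem algHom_ext_graftHK {R : Type*} [Ring R] [Algebra k R] {f g : HK k →ₐ[k] R}
    (h : ∀ u, f u = g u → f (graftHK k u) = g (graftHK k u)) : f = g := by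
  refine MvPolynomial.algHom_ext fun t => ?_
  obtain ⟨T, rfl⟩ := RTree.ofPlanar_surjective t
  induction T using PTree.list_induction with
  | h L ih =>
    rw [← graftHK_forest]
    refine h _ ?_
    rw [forest, map_list_prod, map_list_prod, List.map_map, List.map_map]
    exact congrArg _ (List.map_congr_left ih)

theorem counitHK_graftHK (u : HK k) : counitHK k (graftHK k u) = 0 := by
  have : (counitHK k).toLinearMap ∘ₗ graftHK k = 0 := by
    refine linearMap_ext_forest fun L => ?_
    rw [LinearMap.comp_apply, graftHK_forest]
    exact MvPolynomial.aeval_X _ _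
  exact LinearMap.congr_fun this u

theorem counitHK_forest (L : List PTree) :
    counitHK k (forest k L) = open Classical in if L = [] then 1 else 0 := by
  classical
  cases L with
  | nil => rw [forest_nil, map_one, if_pos rfl]
  | cons x L =>
    rw [forest_cons, map_mul, if_neg (List.cons_ne_nil x L), counitHK, MvPolynomial.aeval_X, zero_mul]

theorem counit_comulHK (u : HK k) :
    TensorProduct.lid k _ (TensorProduct.map (counitHK k).toLinearMap LinearMap.id (comulHK k u)) =
      u := by
  have : ((Algebra.TensorProduct.lid k (HK k)).toAlgHom.comp
      (Algebra.TensorProduct.map (counitHK k) (AlgHom.id k (HK k)))).comp (comulHK k) =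
        AlgHom.id k (HK k) := by
    refine algHom_ext_graftHK fun u hu => ?_
    have h : ∀ z : HK k ⊗[k] HK k, Algebra.TensorProduct.lid k (HK k)
        (Algebra.TensorProduct.map (counitHK k) (AlgHom.id k (HK k))
          (TensorProduct.map LinearMap.id (graftHK k) z)) =
        graftHK k (Algebra.TensorProduct.lid k (HK k)
          (Algebra.TensorProduct.map (counitHK k) (AlgHom.id k (HK k)) z)) := by
      intro z
      induction z with
      | zero => simp
      | add y z hy hz => simp only [map_add, hy, hz]
      | tmul a b => simp
    have hu' : Algebra.TensorProduct.lid k (HK k)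
      (Algebra.TensorProduct.map (counitHK k) (AlgHom.id k (HK k)) (comulHK k u)) = u := hu
    change Algebra.TensorProduct.lid k (HK k)
      (Algebra.TensorProduct.map (counitHK k) (AlgHom.id k (HK k)) (comulHK k (graftHK k u))) = _
    rw [comulHK_graftHK, map_add, map_add, h, hu', Algebra.TensorProduct.map_tmul, counitHK_graftHK]
    simp
  exact DFunLike.congr_fun this u

theorem comul_counitHK (u : HK k) :
    TensorProduct.rid k _ (TensorProduct.map LinearMap.id (counitHK k).toLinearMap (comulHK k u)) =
      u := by
  have : ((Algebra.TensorProduct.rid k k (HK k)).toAlgHom.comp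
      (Algebra.TensorProduct.map (AlgHom.id k (HK k)) (counitHK k))).comp (comulHK k) =
        AlgHom.id k (HK k) := by
    refine algHom_ext_graftHK fun u hu => ?_
    have h : ∀ z : HK k ⊗[k] HK k, Algebra.TensorProduct.map (AlgHom.id k (HK k)) (counitHK k)
          (TensorProduct.map LinearMap.id (graftHK k) z) = 0 := by
      intro z
      induction z with
      | zero => simp
      | add y z hy hz => simp only [map_add, hy, hz, add_zero]
      | tmul a b => simp [counitHK_graftHK]
    change Algebra.TensorProduct.rid k k (HK k)
      (Algebra.TensorProduct.map (AlgHom.id k (HK k)) (counitHK k) (comulHK k (graftHK k u))) = _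
    rw [comulHK_graftHK, map_add, h]
    simp
  exact DFunLike.congr_fun this u

/-- Both sides are homomorphisms of algebras, so the step from `u` to `B_+(u)` suffices. The cocycle
property yields `B_+(u) ⊗ 1 ⊗ 1`, the term `(id ⊗ B_+)Δ(u)` followed by `⊗ 1`, and `id ⊗ id ⊗ B_+`
applied to the two sides for `u`, which agree by hypothesis. -/
theorem coassoc_comulHK (u : HK k) :
    TensorProduct.assoc k _ _ _
      (TensorProduct.map (comulHK k).toLinearMap LinearMap.id (comulHK k u)) =
      TensorProduct.map LinearMap.id (comulHK k).toLinearMap (comulHK k u) := by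
  have : ((Algebra.TensorProduct.assoc k k k (HK k) (HK k) (HK k)).toAlgHom.comp
      (Algebra.TensorProduct.map (comulHK k) (AlgHom.id k (HK k)))).comp (comulHK k) =
        (Algebra.TensorProduct.map (AlgHom.id k (HK k)) (comulHK k)).comp (comulHK k) := by
    refine algHom_ext_graftHK fun u hu => ?_
    have h1 : ∀ z : HK k ⊗[k] HK k, Algebra.TensorProduct.assoc k k k (HK k) (HK k) (HK k)
        (Algebra.TensorProduct.map (comulHK k) (AlgHom.id k (HK k))
          (TensorProduct.map LinearMap.id (graftHK k) z)) =
        TensorProduct.map LinearMap.id (TensorProduct.map LinearMap.id (graftHK k))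
          (Algebra.TensorProduct.assoc k k k (HK k) (HK k) (HK k)
            (Algebra.TensorProduct.map (comulHK k) (AlgHom.id k (HK k)) z)) := by
      intro z
      induction z with
      | zero => simp
      | add y z hy hz => simp only [map_add, hy, hz]
      | tmul a b =>
        simp only [TensorProduct.map_tmul, Algebra.TensorProduct.map_tmul, LinearMap.id_apply,
          AlgHom.id_apply]
        induction comulHK k a with
        | zero => simp
        | add y z hy hz => simp only [TensorProduct.add_tmul, map_add, hy, hz]
        | tmul c d => simp
    have h2 : ∀ z : HK k ⊗[k] HK k, Algebra.TensorProduct.map (AlgHom.id k (HK k)) (comulHK k)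
          (TensorProduct.map LinearMap.id (graftHK k) z) =
        Algebra.TensorProduct.assoc k k k (HK k) (HK k) (HK k)
          (TensorProduct.map LinearMap.id (graftHK k) z ⊗ₜ 1) +
        TensorProduct.map LinearMap.id (TensorProduct.map LinearMap.id (graftHK k))
          (Algebra.TensorProduct.map (AlgHom.id k (HK k)) (comulHK k) z) := by
      intro z
      induction z with
      | zero => simp
      | add y z hy hz =>
        simp only [map_add, TensorProduct.add_tmul, hy, hz]
        abel
      | tmul a b => simp [comulHK_graftHK, TensorProduct.tmul_add]
    have hu' : Algebra.TensorProduct.assoc k k k (HK k) (HK k) (HK k)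
      (Algebra.TensorProduct.map (comulHK k) (AlgHom.id k (HK k)) (comulHK k u)) =
        Algebra.TensorProduct.map (AlgHom.id k (HK k)) (comulHK k) (comulHK k u) := hu
    change Algebra.TensorProduct.assoc k k k (HK k) (HK k) (HK k)
      (Algebra.TensorProduct.map (comulHK k) (AlgHom.id k (HK k)) (comulHK k (graftHK k u))) =
        Algebra.TensorProduct.map (AlgHom.id k (HK k)) (comulHK k) (comulHK k (graftHK k u))
    conv_lhs => rw [comulHK_graftHK, map_add, map_add, h1, hu']
    conv_rhs => rw [comulHK_graftHK, map_add, h2]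
    rw [Algebra.TensorProduct.map_tmul, comulHK_graftHK, TensorProduct.add_tmul, map_add, ← add_assoc]
    simp [Algebra.TensorProduct.one_def]
  exact DFunLike.congr_fun this u

variable [CharZero k]

theorem KT_ext {x y : KT k} (h : ∀ u, pairKT k x u = pairKT k y u) : x = y :=
  sub_eq_zero.1 (separatingLeft_pairKT _ fun u => by
    rw [map_sub, LinearMap.sub_apply, h, sub_self])

theorem opsKT_mul_assoc (x y z : KT k) : (opsKT k).mul ((opsKT k).mul x y) z =
    (opsKT k).mul x ((opsKT k).mul y z) :=
  isDualPair_pairKT.mul_assoc_left separatingLeft_pairKT coassoc_comulHK x y z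

theorem opsKT_one_mul (x : KT k) : (opsKT k).mul (opsKT k).one x = x :=
  isDualPair_pairKT.one_mul_left separatingLeft_pairKT counit_comulHK x

theorem opsKT_mul_one (x : KT k) : (opsKT k).mul x (opsKT k).one = x :=
  isDualPair_pairKT.mul_one_left separatingLeft_pairKT comul_counitHK x

theorem comulMul_opsKT : (opsKT k).ComulMul :=
  isDualPair_pairKT.comulMul_left separatingLeft_pairKT comulMul_opsHK

theorem tensor_KT_ext {y z : KT k ⊗[k] KT k} (h : ∀ u v, tensorPairing (pairKT k) y (u ⊗ₜ v) =
    tensorPairing (pairKT k) z (u ⊗ₜ v)) : y = z := by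
  have hs := separatingRight_tensorPairing (LinearMap.flip_separatingRight.2
    (separatingLeft_pairKT (k := k)))
  refine sub_eq_zero.1 (hs _ fun x => ?_)
  rw [tensorPairing_flip]
  have : tensorPairing (pairKT k) (y - z) = 0 := by
    refine TensorProduct.ext' fun u v => ?_
    rw [map_sub, LinearMap.sub_apply, h, sub_self, LinearMap.zero_apply]
  rw [this, LinearMap.zero_apply]

end Axioms

/-! ## The elements `κ_n` and `ε_n` -/

section Eps

variable {k : Type*} [Field k]

theorem kappa_apply (n : ℕ) (t : RTree) :
    kappa k n t = if t.size = n + 1 then (t.symOrder : k)⁻¹ else 0 := by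
  classical
  rw [kappa, finsum_mem_eq_finite_toFinset_sum _ (RTree.finite_size_eq (n + 1)),
    Finsupp.finsetSum_apply]
  simp only [Finsupp.single_apply, Finset.sum_ite_eq', Set.Finite.mem_toFinset, Set.mem_ofPred_eq]

variable (k) in
/-- The character of `H_K` with `T ↦ (-X)^|T|`. -/
def kappaChar : HK k →ₐ[k] Polynomial k :=
  MvPolynomial.aeval fun t : RTree => (-Polynomial.X) ^ t.size

variable (k) in
/-- The character of `H_K` with `• ↦ X`, and `T ↦ 0` if `T ≠ •`. -/
def epsChar : HK k →ₐ[k] Polynomial k :=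
  open Classical in MvPolynomial.aeval fun t : RTree => if t = RTree.bullet then Polynomial.X else 0

theorem kappaChar_forest (L : List PTree) :
    kappaChar k (forest k L) = (-Polynomial.X) ^ (L.map PTree.size).sum := by
  induction L with
  | nil => rw [forest_nil, map_one, List.map_nil, List.sum_nil, pow_zero]
  | cons x L ih =>
    rw [forest_cons, map_mul, ih, kappaChar, MvPolynomial.aeval_X, List.map_cons, List.sum_cons,
      pow_add]
    rfl

/-- `B_+` of a forest is `•` only for the empty forest, which the counit detects. -/
theorem epsChar_graftHK (u : HK k) :
    epsChar k (graftHK k u) = Polynomial.X * Polynomial.C (counitHK k u) := by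
  classical
  have : (epsChar k).toLinearMap ∘ₗ graftHK k = LinearMap.mulLeft k Polynomial.X ∘ₗ
      Algebra.linearMap k (Polynomial k) ∘ₗ (counitHK k).toLinearMap := by
    refine linearMap_ext_forest fun L => ?_
    simp only [LinearMap.comp_apply, AlgHom.toLinearMap_apply, graftHK_forest, counitHK_forest]
    refine (MvPolynomial.aeval_X _ _).trans ?_
    rw [RTree.bullet_eq, ← RTree.ofMultiset_coe_map]
    simp only [RTree.ofMultiset_injective.eq_iff]
    cases L <;> simp
  exact LinearMap.congr_fun this u

/-- On a tree `T = B_+(u)` the convolution is `(-X)^|T| + X (-X)^|u|`, by the cocycle property and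
because the second character sees only the counit below a root. This vanishes since `|T| = |u| + 1`.
-/
theorem kappaChar_mul_epsChar (u : HK k) :
    Algebra.TensorProduct.productMap (kappaChar k) (epsChar k) (comulHK k u) =
      Polynomial.C (counitHK k u) := by
  have : (Algebra.TensorProduct.productMap (kappaChar k) (epsChar k)).comp (comulHK k) =
      (Algebra.ofId k (Polynomial k)).comp (counitHK k) := by
    refine MvPolynomial.algHom_ext fun t => ?_
    obtain ⟨T, rfl⟩ := RTree.ofPlanar_surjective t
    have hT := graftHK_forest (k := k) T.children
    rw [PTree.ofList_children] at hT
    have h : ∀ z : HK k ⊗[k] HK k, Algebra.TensorProduct.productMap (kappaChar k) (epsChar k)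
        (TensorProduct.map LinearMap.id (graftHK k) z) = Polynomial.X * kappaChar k
          (TensorProduct.rid k _ (TensorProduct.map LinearMap.id (counitHK k).toLinearMap z)) := by
      intro z
      induction z with
      | zero => simp
      | add y z hy hz => simp only [map_add, hy, hz, mul_add]
      | tmul a b =>
        simp only [TensorProduct.map_tmul, LinearMap.id_apply,
          Algebra.TensorProduct.productMap_apply_tmul, epsChar_graftHK, AlgHom.toLinearMap_apply,
          TensorProduct.rid_tmul, map_smul, Polynomial.smul_eq_C_mul]
        ring
    rw [← hT]
    change Algebra.TensorProduct.productMap (kappaChar k) (epsChar k) (comulHK k (graftHK k _)) =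
      algebraMap k (Polynomial k) (counitHK k (graftHK k _))
    rw [comulHK_graftHK, map_add, h, comul_counitHK, counitHK_graftHK, map_zero, hT,
      Algebra.TensorProduct.productMap_apply_tmul, map_one, mul_one, kappaChar_forest, kappaChar,
      MvPolynomial.aeval_X, RTree.size_ofPlanar, ← PTree.size_children, pow_succ]
    ring
  exact DFunLike.congr_fun this u

variable [CharZero k]

/-- The weights `1/|Sym(t)|` cancel the symmetry factors of the pairing, so `⟨κ_n, u⟩` is `1` on
forests with `n` vertices and `0` on the others. -/
theorem pairKT_kappa (n : ℕ) (u : HK k) :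
    (kappaChar k u).coeff n = (-1) ^ n * pairKT k (kappa k n) u := by
  have : Polynomial.lcoeff k n ∘ₗ (kappaChar k).toLinearMap =
      (-1 : k) ^ n • pairKT k (kappa k n) := by
    refine linearMap_ext_forest fun L => ?_
    have h := pairKT_forest_children (kappa k n) (PTree.ofList L)
    rw [PTree.children_ofList, kappa_apply, RTree.size_ofPlanar, PTree.size_ofList] at h
    have h1 : ∀ m : ℕ, (-Polynomial.X : Polynomial k) ^ m =
        Polynomial.C ((-1) ^ m) * Polynomial.X ^ m := fun m => by
      rw [neg_pow]
      simp
    rw [LinearMap.smul_apply, h, LinearMap.comp_apply, AlgHom.toLinearMap_apply, kappaChar_forest,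
      Polynomial.lcoeff_apply, h1, Polynomial.coeff_C_mul_X_pow]
    by_cases hn : n = (L.map PTree.size).sum
    · rw [if_pos hn, if_pos (by omega), mul_inv_cancel₀ (symOrder_ne_zero _), hn]
      simp
    · rw [if_neg hn, if_neg (by omega), mul_zero, smul_zero]
  exact LinearMap.congr_fun this u

theorem kappa_zero : kappa k 0 = (opsKT k).one := by
  refine KT_ext fun u => ?_
  have h := pairKT_kappa (k := k) 0 u
  rw [pow_zero, one_mul] at h
  rw [← h, isDualPair_pairKT.one_left]
  have : Polynomial.lcoeff k 0 ∘ₗ (kappaChar k).toLinearMap = (opsHK k).counit := by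
    refine linearMap_ext_forest fun L => ?_
    change _ = counitHK k (forest k L)
    rw [counitHK_forest, LinearMap.comp_apply, AlgHom.toLinearMap_apply, kappaChar_forest,
      Polynomial.lcoeff_apply]
    cases L with
    | nil => simp
    | cons x L =>
      rw [if_neg (List.cons_ne_nil x L), List.map_cons, List.sum_cons, ← PTree.size_children x,
        add_right_comm, pow_succ]
      simp
  exact LinearMap.congr_fun this u

/-- The coefficient of a positive power of `X` in the convolution identity vanishes. As `κ_0` is the
unit, solving for the `κ_0` term gives the recursion of `ε_n`. -/
theorem pairKT_eps (n : ℕ) (u : HK k) : pairKT k (eps k n) u = (epsChar k u).coeff n := by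
  induction n using Nat.strong_induction_on generalizing u with
  | _ n ih =>
    cases n with
    | zero =>
      rw [eps]
      refine (isDualPair_pairKT.one_left u).trans ?_
      have : Polynomial.lcoeff k 0 ∘ₗ (epsChar k).toLinearMap = (opsHK k).counit := by
        refine linearMap_ext_forest fun L => ?_
        change _ = counitHK k (forest k L)
        rw [counitHK_forest, LinearMap.comp_apply, AlgHom.toLinearMap_apply,
          Polynomial.lcoeff_apply]
        cases L with
        | nil => rw [forest_nil, map_one, Polynomial.coeff_one_zero, if_pos rfl]
        | cons x L =>
          have hx := graftHK_forest (k := k) x.children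
          rw [PTree.ofList_children] at hx
          rw [if_neg (List.cons_ne_nil x L), forest_cons, map_mul, ← hx, epsChar_graftHK]
          simp [Polynomial.mul_coeff_zero]
      exact (LinearMap.congr_fun this u).symm
    | succ n =>
      -- `F i j` pairs the left factor with `κ_i` and takes the coefficient of `X^j` of the second
      -- character on the right factor.
      let F : ℕ → ℕ → HK k ⊗[k] HK k →ₗ[k] k := fun i j => LinearMap.mul' k k ∘ₗ
        TensorProduct.map (pairKT k (kappa k i)) (Polynomial.lcoeff k j ∘ₗ (epsChar k).toLinearMap)
      have h1 : ∀ z, (Algebra.TensorProduct.productMap (kappaChar k) (epsChar k) z).coeff (n + 1) =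
          ∑ p ∈ Finset.HasAntidiagonal.antidiagonal (n + 1), (-1) ^ p.1 * F p.1 p.2 z := by
        intro z
        induction z with
        | zero => simp
        | add y z hy hz =>
          simp only [map_add, Polynomial.coeff_add, hy, hz, mul_add, Finset.sum_add_distrib]
        | tmul a b =>
          rw [Algebra.TensorProduct.productMap_apply_tmul, Polynomial.coeff_mul]
          refine Finset.sum_congr rfl fun p _ => ?_
          simp [F, pairKT_kappa, mul_assoc]
      have h2 : F 0 (n + 1) (comulHK k u) = (epsChar k u).coeff (n + 1) := by
        conv_rhs => rw [← counit_comulHK u]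
        induction comulHK k u with
        | zero => simp
        | add y z hy hz => simp only [map_add, Polynomial.coeff_add, hy, hz]
        | tmul a b =>
          simp only [F, kappa_zero, LinearMap.comp_apply, TensorProduct.map_tmul,
            LinearMap.mul'_apply, isDualPair_pairKT.one_left, TensorProduct.lid_tmul,
            LinearMap.id_apply, AlgHom.toLinearMap_apply, map_smul, Polynomial.coeff_smul,
            Polynomial.lcoeff_apply, smul_eq_mul]
          rfl
      have h3 : ∀ j : Fin (n + 1), pairKT k ((opsKT k).mul (kappa k (j + 1)) (eps k (n - j))) u =
          F (j + 1) (n - j) (comulHK k u) := by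
        intro j
        rw [pairKT_mul_left]
        change tensorPairing (pairKT k) _ (comulHK k u) = _
        induction comulHK k u with
        | zero => simp
        | add y z hy hz => simp only [map_add, hy, hz]
        | tmul a b => simp [F, ih (n - j) (by omega)]
      have h4 := h1 (comulHK k u)
      rw [kappaChar_mul_epsChar, Polynomial.coeff_C_succ, Finset.Nat.antidiagonal_succ,
        Finset.sum_cons, Finset.sum_map, pow_zero, one_mul, h2,
        Finset.Nat.sum_antidiagonal_eq_sum_range_succ_mk] at h4
      -- The term with `κ_0` is minus the sum of the others, which turns `(-1)^(j+1)` into the sign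
      -- `(-1)^j` of the recursion.
      rw [eq_neg_of_add_eq_zero_left h4.symm, eps, map_sum, LinearMap.sum_apply]
      refine Eq.trans ?_ (congrArg Neg.neg (Fin.sum_univ_eq_sum_range
        (fun i => (-1 : k) ^ (i + 1) * F (i + 1) (n - i) (comulHK k u)) (n + 1)))
      rw [← Finset.sum_neg_distrib]
      refine Finset.sum_congr rfl fun j _ => ?_
      rw [map_smul, LinearMap.smul_apply, h3, smul_eq_mul, pow_succ]
      ring

/-- The functionals `⟨ε_n, ·⟩` are the coefficients of a multiplicative map to polynomials; the rule
for the coefficients of a product says dually that the `ε_n` are divided powers. -/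
theorem comul_eps (n : ℕ) : (opsKT k).comul (eps k n) =
    ∑ p ∈ Finset.HasAntidiagonal.antidiagonal n, eps k p.1 ⊗ₜ[k] eps k p.2 := by
  refine tensor_KT_ext fun u v => ?_
  rw [← pairKT_mul_right, pairKT_eps, map_mul, Polynomial.coeff_mul, map_sum, LinearMap.sum_apply]
  simp only [tensorPairing_tmul, pairKT_eps]

theorem counit_eps (n : ℕ) : (opsKT k).counit (eps k n) = if n = 0 then 1 else 0 := by
  rw [← isDualPair_pairKT.one_right, pairKT_eps]
  change (epsChar k 1).coeff n = _
  rw [map_one, Polynomial.coeff_one]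

end Eps

/-! ## The homomorphisms `Φ`, `ρ`, `φ` and `Z` -/

section Homs

variable {k : Type*} [Field k]

theorem IsHopfHom.of_comp_surjective {A B C : Type*} [AddCommGroup A] [Module k A] [AddCommGroup B]
    [Module k B] [AddCommGroup C] [Module k C] {opA : HopfOps k A} {opB : HopfOps k B}
    {opC : HopfOps k C} {f : A →ₗ[k] B} {g : B →ₗ[k] C} (hgf : IsHopfHom opA opC (g ∘ₗ f))
    (hf : IsHopfHom opA opB f) (hsurj : Function.Surjective f) : IsHopfHom opB opC g where
  map_one := by rw [← hf.map_one]; exact hgf.map_one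
  map_mul b b' := by
    obtain ⟨a, rfl⟩ := hsurj b
    obtain ⟨a', rfl⟩ := hsurj b'
    rw [← hf.map_mul]
    exact hgf.map_mul a a'
  map_counit b := by
    obtain ⟨a, rfl⟩ := hsurj b
    rw [hf.map_counit]
    exact hgf.map_counit a
  map_comul b := by
    obtain ⟨a, rfl⟩ := hsurj b
    have h := hgf.map_comul a
    rw [TensorProduct.map_comp] at h
    rw [hf.map_comul]
    exact h

theorem IsHopfHom.comp {A B C : Type*} [AddCommGroup A] [Module k A] [AddCommGroup B]
    [Module k B] [AddCommGroup C] [Module k C] {opA : HopfOps k A} {opB : HopfOps k B}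
    {opC : HopfOps k C} {f : A →ₗ[k] B} {g : B →ₗ[k] C} (hg : IsHopfHom opB opC g)
    (hf : IsHopfHom opA opB f) : IsHopfHom opA opC (g ∘ₗ f) where
  map_one := by rw [LinearMap.comp_apply, hf.map_one, hg.map_one]
  map_mul a a' := by simp only [LinearMap.comp_apply, hf.map_mul, hg.map_mul]
  map_counit a := by rw [LinearMap.comp_apply, hg.map_counit, hf.map_counit]
  map_comul a := by
    rw [LinearMap.comp_apply, hg.map_comul, hf.map_comul, TensorProduct.map_comp,
      LinearMap.comp_apply]

theorem isHopfHom_algHom {X R : Type*} [Ring R] [Algebra k R] {ε : FreeAlgebra k X →ₐ[k] k}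
    {Δ : FreeAlgebra k X →ₐ[k] FreeAlgebra k X ⊗[k] FreeAlgebra k X} {ε' : R →ₐ[k] k}
    {Δ' : R →ₐ[k] R ⊗[k] R} (f : FreeAlgebra k X →ₐ[k] R)
    (hε : ∀ x, ε' (f (FreeAlgebra.ι k x)) = ε (FreeAlgebra.ι k x))
    (hΔ : ∀ x, Δ' (f (FreeAlgebra.ι k x)) =
      Algebra.TensorProduct.map f f (Δ (FreeAlgebra.ι k x))) :
    IsHopfHom (HopfOps.ofAlgebra ε.toLinearMap Δ.toLinearMap)
      (HopfOps.ofAlgebra ε'.toLinearMap Δ'.toLinearMap) f.toLinearMap :=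
  isHopfHom_of_generators ⟨map_one f, map_mul f⟩ (comulMul_ofAlgebra _ Δ') (map_one Δ') (map_one ε')
    (map_mul ε') hε hΔ

variable (k) in
/-- `ρ` sends a planar rooted tree to the underlying rooted tree. -/
def rhoHom : HF k →ₐ[k] HK k :=
  FreeAlgebra.lift k fun T : PTree => MvPolynomial.X (RTree.ofPlanar T)

theorem rhoHom_ι (T : PTree) :
    rhoHom k (FreeAlgebra.ι k T) = MvPolynomial.X (RTree.ofPlanar T) := FreeAlgebra.lift_ι_apply _ _

theorem rhoHom_word (L : List PTree) : rhoHom k (word k L) = forest k L := by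
  induction L with
  | nil => exact map_one _
  | cons x L ih => rw [word_cons, forest_cons, map_mul, ih, rhoHom_ι]

/-- `ρ` intertwines the two operators `B_+`, and the two coproducts satisfy the same recursion. -/
theorem map_rhoHom_comulForest (L : List PTree) :
    Algebra.TensorProduct.map (rhoHom k) (rhoHom k) (comulForest k L) = comulHKForest k L := by
  have hB : ∀ z : HF k ⊗[k] HF k, Algebra.TensorProduct.map (rhoHom k) (rhoHom k)
      (TensorProduct.map LinearMap.id (inclKP k ∘ₗ planarBPlus k) z) =
      TensorProduct.map LinearMap.id (graftHK k)
        (Algebra.TensorProduct.map (rhoHom k) (rhoHom k) z) := by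
    intro z
    induction z using tensor_word_induction with
    | hadd y z hy hz => simp only [map_add, hy, hz]
    | hsmul c z hz => simp only [map_smul, hz]
    | hword L L' =>
      rw [map_bPlus_word, Algebra.TensorProduct.map_tmul, Algebra.TensorProduct.map_tmul,
        TensorProduct.map_tmul, rhoHom_word, rhoHom_word, rhoHom_word, graftHK_forest, forest_cons,
        forest_nil, mul_one, LinearMap.id_apply]
  have main : ∀ L : List PTree, (∀ T ∈ L, Algebra.TensorProduct.map (rhoHom k) (rhoHom k)
      (comulHFTree k T) = comulHKTree k T) →
      Algebra.TensorProduct.map (rhoHom k) (rhoHom k) (comulForest k L) = comulHKForest k L := by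
    intro L h
    rw [comulForest, comulHKForest, map_list_prod, List.map_map]
    exact congrArg _ (List.map_congr_left h)
  have all : ∀ T : PTree, Algebra.TensorProduct.map (rhoHom k) (rhoHom k)
      (comulHFTree k T) = comulHKTree k T := by
    intro T
    induction T using PTree.list_induction with
    | h L ih =>
      rw [comulHFTree_ofList, comulHKTree_ofList, map_add, hB, main L ih,
        Algebra.TensorProduct.map_tmul, rhoHom_ι, map_one]
      rfl
  exact main L fun T _ => all T

theorem isHopfHom_rhoHom : IsHopfHom (opsHF k) (opsHK k) (rhoHom k).toLinearMap := by
  refine isHopfHom_algHom (rhoHom k) (fun T => ?_) fun T => ?_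
  · rw [rhoHom_ι, MvPolynomial.aeval_X, FreeAlgebra.lift_ι_apply]
  · have h := map_rhoHom_comulForest (k := k) [T]
    rw [comulForest, comulHKForest, List.map_singleton, List.map_singleton, List.prod_singleton,
      List.prod_singleton] at h
    rw [rhoHom_ι, FreeAlgebra.lift_ι_apply, h]
    exact opsHK_comul_X T

variable (k) in
/-- `Φ` sends `E_n` to the ladder with `n` vertices. -/
def PhiHom : NSymF k →ₐ[k] HF k :=
  FreeAlgebra.lift k fun n : ℕ+ => FreeAlgebra.ι k (PTree.ladder n.natPred)

theorem PhiHom_ι (n : ℕ+) : PhiHom k (FreeAlgebra.ι k n) =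
    FreeAlgebra.ι k (PTree.ladder n.natPred) := FreeAlgebra.lift_ι_apply _ _

theorem PhiHom_word (I : List ℕ+) :
    PhiHom k (word k I) = word k (I.map fun n => PTree.ladder n.natPred) := by
  induction I with
  | nil => exact map_one _
  | cons n I ih => rw [word_cons, map_mul, ih, PhiHom_ι, List.map_cons, word_cons]

/-- Below the root of `ladder i` is the ladder with `i` vertices, which is `Φ(E_i)`; for `i = 0` it
is the empty forest, in agreement with `E_0 = 1`. -/
theorem comulHFTree_ladder (i : ℕ) : comulHFTree k (PTree.ladder i) =
    FreeAlgebra.ι k (PTree.ladder i) ⊗ₜ 1 +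
      TensorProduct.map LinearMap.id (inclKP k ∘ₗ planarBPlus k)
        ((opsHF k).comul (PhiHom k (genE k i))) := by
  cases i with
  | zero =>
    rw [PTree.ladder, comulHFTree_ofList, genE, map_one, ← comul_word]
    rfl
  | succ i =>
    rw [PTree.ladder, comulHFTree_ofList, genE, PhiHom_ι, ← comul_word, word_cons, word_nil, mul_one,
      Nat.natPred_succPNat]

theorem comul_PhiHom_genE (n : ℕ) : (opsHF k).comul (PhiHom k (genE k n)) =
    ∑ p ∈ Finset.HasAntidiagonal.antidiagonal n,
      PhiHom k (genE k p.1) ⊗ₜ[k] PhiHom k (genE k p.2) := by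
  have hB : ∀ n, (inclKP k ∘ₗ planarBPlus k) (PhiHom k (genE k n)) = PhiHom k (genE k (n + 1)) := by
    intro n
    rw [genE.eq_2, PhiHom_ι, Nat.natPred_succPNat, LinearMap.comp_apply]
    cases n with
    | zero => rw [genE, map_one, ← word_nil, planarBPlus_word, inclKP_single, PTree.ladder]
    | succ n =>
      have : PhiHom k (genE k (n + 1)) = word k [PTree.ladder n] := by
        rw [genE, PhiHom_ι, Nat.natPred_succPNat, word_cons, word_nil, mul_one]
      rw [this, planarBPlus_word, inclKP_single, PTree.ladder]
  induction n with
  | zero =>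
    rw [Finset.Nat.antidiagonal_zero, Finset.sum_singleton, genE, map_one]
    exact comul_word []
  | succ n ih =>
    have h : (opsHF k).comul (PhiHom k (genE k (n + 1))) = comulHFTree k (PTree.ladder n) := by
      rw [genE, PhiHom_ι, Nat.natPred_succPNat]
      exact FreeAlgebra.lift_ι_apply _ _
    -- The term `ℓ_{n+1} ⊗ 1` is the pair `(n + 1, 0)`. In the others `B_+` raises the second index
    -- by one.
    rw [h, comulHFTree_ladder, ih, Finset.Nat.antidiagonal_succ', Finset.sum_cons, Finset.sum_map,
      map_sum]
    congr 1
    · rw [genE.eq_2, PhiHom_ι, Nat.natPred_succPNat, genE.eq_1, map_one]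
    · refine Finset.sum_congr rfl fun p _ => ?_
      rw [TensorProduct.map_tmul, hB]
      rfl

theorem isHopfHom_PhiHom : IsHopfHom (opsNSym k) (opsHF k) (PhiHom k).toLinearMap := by
  refine isHopfHom_algHom (PhiHom k) (fun n => ?_) fun n => ?_
  · rw [PhiHom_ι, FreeAlgebra.lift_ι_apply, FreeAlgebra.lift_ι_apply]
  · rw [FreeAlgebra.lift_ι_apply, map_sum, ← genE_coe]
    refine (comul_PhiHom_genE (n : ℕ)).trans (Finset.sum_congr rfl fun p _ => ?_)
    rw [Algebra.TensorProduct.map_tmul]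

variable (k) in
/-- `φ` sends `e_n` to the ladder with `n` vertices. -/
def phiHom : SymF k →ₐ[k] HK k :=
  (MvPolynomial.aeval fun n : ℕ+ => MvPolynomial.X (RTree.ofPlanar (PTree.ladder n.natPred))).comp
    (AlgEquiv.ofBijective (elemHom k) elemHom_bijective).symm.toAlgHom

theorem phiHom_elemSym (n : ℕ+) :
    phiHom k (elemSym k n) = MvPolynomial.X (RTree.ofPlanar (PTree.ladder n.natPred)) := by
  have h : (AlgEquiv.ofBijective (elemHom k) elemHom_bijective).symm (elemSym k n) =
      MvPolynomial.X n := by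
    rw [AlgEquiv.symm_apply_eq]
    exact (MvPolynomial.aeval_X _ _).symm
  exact (congrArg _ h).trans (MvPolynomial.aeval_X _ _)

theorem phiHom_comp_tauHom : (phiHom k).comp (tauHom k) = (rhoHom k).comp (PhiHom k) := by
  refine FreeAlgebra.hom_ext (funext fun n => ?_)
  simp only [Function.comp_apply, AlgHom.comp_apply]
  rw [tauHom_ι, phiHom_elemSym, PhiHom_ι, rhoHom_ι]

theorem phiHom_tauHom (w : NSymF k) : phiHom k (tauHom k w) = rhoHom k (PhiHom k w) :=
  DFunLike.congr_fun phiHom_comp_tauHom w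

/-- The composite `φτ = ρΦ` is a Hopf map and `τ` is a surjective one, so the properties descend to
`φ`. -/
theorem isHopfHom_phiHom : IsHopfHom (opsSym k) (opsHK k) (phiHom k).toLinearMap := by
  refine IsHopfHom.of_comp_surjective (opA := opsNSym k) (f := (tauHom k).toLinearMap) ?_
    isHopfHom_tauHom tauHom_surjective
  have h : (phiHom k).toLinearMap ∘ₗ (tauHom k).toLinearMap =
      (rhoHom k).toLinearMap ∘ₗ (PhiHom k).toLinearMap := LinearMap.ext phiHom_tauHom
  rw [h]
  exact isHopfHom_rhoHom.comp isHopfHom_PhiHom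

variable (k) in
/-- The action of `NSym` on `kT` in which `E_n` acts by multiplication with `ε_n`. -/
def ZAction : NSymF k →ₐ[k] Module.End k (KT k) :=
  FreeAlgebra.lift k fun n : ℕ+ => (opsKT k).mul (eps k n)

variable (k) in
/-- `Z` sends `E_n` to `ε_n`. -/
def ZMap : NSymF k →ₗ[k] KT k := LinearMap.applyₗ (opsKT k).one ∘ₗ (ZAction k).toLinearMap

theorem ZMap_one : ZMap k 1 = (opsKT k).one := by
  rw [ZMap, LinearMap.comp_apply, AlgHom.toLinearMap_apply, map_one]
  rfl

theorem ZMap_ι_mul (n : ℕ+) (w : NSymF k) :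
    ZMap k (FreeAlgebra.ι k n * w) = (opsKT k).mul (eps k n) (ZMap k w) := by
  rw [ZMap, LinearMap.comp_apply, AlgHom.toLinearMap_apply, map_mul, ZAction,
    FreeAlgebra.lift_ι_apply]
  rfl

variable [CharZero k]

theorem ZMap_ι (n : ℕ+) : ZMap k (FreeAlgebra.ι k n) = eps k n := by
  rw [← mul_one (FreeAlgebra.ι k n), ZMap_ι_mul, ZMap_one, opsKT_mul_one]

/-- A word acts on the unit by successive left multiplications; associativity and the unit law of
the Grossman–Larson product make this multiplicative. -/
theorem ZMap_mul (v w : NSymF k) : ZMap k (v * w) = (opsKT k).mul (ZMap k v) (ZMap k w) := by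
  have : ZMap k ∘ₗ LinearMap.mulRight k w = (opsKT k).mul.flip (ZMap k w) ∘ₗ ZMap k := by
    refine linearMap_ext_word fun I => ?_
    simp only [LinearMap.comp_apply, LinearMap.mulRight_apply, LinearMap.flip_apply]
    induction I with
    | nil => rw [word_nil, one_mul, ZMap_one, opsKT_one_mul]
    | cons n I ih => rw [word_cons, mul_assoc, ZMap_ι_mul, ih, ZMap_ι_mul, opsKT_mul_assoc]
  exact LinearMap.congr_fun this v

theorem ZMap_genE (n : ℕ) : ZMap k (genE k n) = eps k n := by
  cases n with
  | zero =>
    rw [eps]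
    exact ZMap_one (k := k)
  | succ n => exact ZMap_ι _

theorem isHopfHom_ZMap : IsHopfHom (opsNSym k) (opsKT k) (ZMap k) := by
  refine isHopfHom_of_generators ⟨ZMap_one, ZMap_mul⟩ (comulMul_opsKT (k := k)) ?_ ?_ ?_ ?_ ?_
  · have := comul_eps (k := k) 0
    rw [Finset.Nat.antidiagonal_zero, Finset.sum_singleton, eps] at this
    exact this
  · have := counit_eps (k := k) 0
    rw [eps, if_pos rfl] at this
    exact this
  · intro x y
    rw [← isDualPair_pairKT.one_right, pairKT_mul_left,
      show (opsHK k).comul (opsHK k).one = 1 ⊗ₜ 1 from comul_forest [], tensorPairing_tmul,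
      ← isDualPair_pairKT.one_right, ← isDualPair_pairKT.one_right]
    rfl
  · intro n
    rw [← genE_coe, ZMap_genE, counit_eps (k := k)]
    exact (counit_genE (k := k) n).symm
  · intro n
    rw [← genE_coe]
    refine Eq.trans ?_ (congrArg _ (comul_genE (k := k) n).symm)
    rw [ZMap_genE, comul_eps, map_sum]
    simp only [TensorProduct.map_tmul, ZMap_genE]

end Homs

/-! ## The dual maps -/

section Duals

variable {k : Type*} [Field k]

theorem size_ladder (i : ℕ) : (PTree.ladder i).size = i + 1 := by
  induction i with
  | zero => rw [PTree.ladder, PTree.size_ofList]; rfl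
  | succ i ih => rw [PTree.ladder, PTree.size_ofList, List.map_singleton, List.sum_singleton, ih]

theorem ofPlanar_ladder_injective :
    Function.Injective fun n : ℕ+ => RTree.ofPlanar (PTree.ladder n.natPred) := fun m n h => by
  have h' := congrArg RTree.size h
  simp only [RTree.size_ofPlanar, size_ladder] at h'
  exact PNat.natPred_injective (Nat.succ_injective h')

theorem ladder_injective : Function.Injective fun n : ℕ+ => PTree.ladder n.natPred :=
  Function.Injective.of_comp (f := RTree.ofPlanar) ofPlanar_ladder_injective

/-- `Φ*(T) = M_I` if the branches of `T` are, in order, ladders of sizes `I`, and `Φ*(T) = 0`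
otherwise. -/
theorem exists_PhiDual : ∃ g : KP k →ₗ[k] QSymF k, ∀ w x, pairNQ k w (g x) = pairKP k x (PhiHom k w) := by
  classical
  refine exists_adjoint (p := pairNQ k) separatingRight_pairNQ
    (fun w => (pairKP k).flip (PhiHom k w))
    (Set.range fun T => Finsupp.single T 1) (Finsupp.basisSingleOne (R := k)).span_eq ?_
  rintro _ ⟨T, rfl⟩
  by_cases h : ∃ I : List ℕ+, I.map (fun n => PTree.ladder n.natPred) = T.children
  · obtain ⟨I, hI⟩ := h
    refine ⟨monoQSym k I, LinearMap.congr_fun (f := (pairNQ k).flip (monoQSym k I))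
      (g := pairKP k (Finsupp.single T 1) ∘ₗ (PhiHom k).toLinearMap) (linearMap_ext_word fun J => ?_)⟩
    rw [LinearMap.flip_apply, LinearMap.comp_apply, AlgHom.toLinearMap_apply, PhiHom_word,
      pairKP_single_word, pairNQ_word_monoQSym, ← hI]
    simp only [(List.map_injective_iff.2 ladder_injective).eq_iff]
  · refine ⟨0, LinearMap.congr_fun (f := (pairNQ k).flip 0)
      (g := pairKP k (Finsupp.single T 1) ∘ₗ (PhiHom k).toLinearMap) (linearMap_ext_word fun J => ?_)⟩
    rw [map_zero, LinearMap.zero_apply, LinearMap.comp_apply, AlgHom.toLinearMap_apply, PhiHom_word,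
      pairKP_single_word, if_neg fun hJ => h ⟨J, hJ⟩]

theorem pairKP_word (x : KP k) (L : List PTree) : pairKP k x (word k L) = x (PTree.ofList L) := by
  classical
  have h : (pairKP k).flip (word k L) = Finsupp.lapply (PTree.ofList L) := by
    refine linearMap_ext_single fun T' => ?_
    rw [LinearMap.flip_apply, pairKP_single_word, Finsupp.lapply_apply, Finsupp.single_apply]
    simp only [eq_comm (a := T'), PTree.ofList_eq_iff]
  exact LinearMap.congr_fun h x

/-- `ρ*(t)` is `|Sym(t)|` times the sum of the finitely many planar trees with underlying rooted
tree `t`. -/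
theorem exists_rhoDual : ∃ g : KT k →ₗ[k] KP k, ∀ u x, pairKP k (g x) u = pairKT k x (rhoHom k u) := by
  classical
  refine exists_adjoint (p := (pairKP k).flip) (LinearMap.flip_separatingRight.2 separatingLeft_pairKP)
    (fun u => (pairKT k).flip (rhoHom k u))
    (Set.range fun t => Finsupp.single t 1) (Finsupp.basisSingleOne (R := k)).span_eq ?_
  rintro _ ⟨t, rfl⟩
  let y : KP k := Finsupp.ofSupportFinite (fun T => isoWeight k t (RTree.ofPlanar T))
    ((RTree.finite_ofPlanar_eq t).subset fun T hT => by
      by_contra h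
      exact hT (if_neg fun h' => h h'.symm))
  refine ⟨y, LinearMap.congr_fun (f := pairKP k y)
      (g := pairKT k (Finsupp.single t 1) ∘ₗ (rhoHom k).toLinearMap) (linearMap_ext_word fun L => ?_)⟩
  rw [pairKP_word, LinearMap.comp_apply, AlgHom.toLinearMap_apply, rhoHom_word,
    pairKT_single_forest]
  rfl

theorem phiHom_elemSymProd (p : Multiset ℕ+) : phiHom k (elemSymProd k p) =
    forest k (p.toList.map fun n => PTree.ladder n.natPred) := by
  obtain ⟨I, rfl⟩ : ∃ I : List ℕ+, p = I := ⟨p.toList, (Multiset.coe_toList p).symm⟩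
  rw [← tauHom_word, phiHom_tauHom, PhiHom_word, rhoHom_word]
  exact forest_perm ((Multiset.coe_eq_coe.1 (Multiset.coe_toList _)).symm.map _)

/-- `φ*(t) = |Sym(t)| m_λ` if the branches of `t` are ladders of sizes `λ`, and `φ*(t) = 0`
otherwise. -/
theorem exists_phiDual : ∃ g : KT k →ₗ[k] SymF k, ∀ f x,
    symForm k f (g x) = pairKT k x (phiHom k f) := by
  classical
  refine exists_adjoint (p := symForm k) separatingRight_symForm
    (fun f => (pairKT k).flip (phiHom k f))
    (Set.range fun t => Finsupp.single t 1) (Finsupp.basisSingleOne (R := k)).span_eq ?_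
  rintro _ ⟨t, rfl⟩
  have key : ∀ p, pairKT k (Finsupp.single t 1) (phiHom k (elemSymProd k p)) =
      if t.children = p.map fun n => RTree.ofPlanar (PTree.ladder n.natPred) then
        (t.symOrder : k) else 0 := by
    intro p
    rw [phiHom_elemSymProd, pairKT_single_forest, isoWeight, ← RTree.ofMultiset_coe_map, List.map_map,
      ← Multiset.map_coe, Multiset.coe_toList]
    refine if_congr ⟨fun h => ?_, fun h => ?_⟩ rfl rfl
    · rw [h, RTree.children_ofMultiset]
      rfl
    · rw [← RTree.ofMultiset_children t, h]
      rfl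
  by_cases h : ∃ q : Multiset ℕ+,
      t.children = q.map fun n => RTree.ofPlanar (PTree.ladder n.natPred)
  · obtain ⟨q, hq⟩ := h
    refine ⟨(t.symOrder : k) • monoSym k q, LinearMap.congr_fun
      (f := (symForm k).flip ((t.symOrder : k) • monoSym k q))
      (g := pairKT k (Finsupp.single t 1) ∘ₗ (phiHom k).toLinearMap)
      ((elemBasis k).ext fun p => ?_)⟩
    rw [elemBasis_apply, LinearMap.comp_apply, AlgHom.toLinearMap_apply, key, LinearMap.flip_apply,
      map_smul, symForm_elemSymProd_monoSym, hq, smul_eq_mul, mul_ite, mul_one, mul_zero]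
    exact if_congr (eq_comm.trans
      (Multiset.map_injective ofPlanar_ladder_injective).eq_iff.symm) rfl rfl
  · refine ⟨0, LinearMap.congr_fun (f := (symForm k).flip 0)
      (g := pairKT k (Finsupp.single t 1) ∘ₗ (phiHom k).toLinearMap)
      ((elemBasis k).ext fun p => ?_)⟩
    rw [elemBasis_apply, LinearMap.comp_apply, AlgHom.toLinearMap_apply, key, map_zero,
      if_neg fun hp => h ⟨p, hp⟩, LinearMap.zero_apply]

/-! ### The grading of `kT` -/

/-- An assignment puts every entry at exactly one point, so the total weight of its lists is that of
`A`; only such lists have to be considered. -/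
theorem allSum_mem {α P M : Type*} [AddCommMonoid M] [Fintype P] (S : AddSubmonoid M) (s : α → ℕ)
    (A : List α) (Ψ : (P → List α) → M)
    (h : ∀ F, ∑ p, ((F p).map s).sum = (A.map s).sum → Ψ F ∈ S) : allSum A Ψ ∈ S := by
  classical
  induction A generalizing Ψ with
  | nil => exact h _ (by simp)
  | cons a A ih =>
    refine AddSubmonoid.sum_mem S fun p _ => ih _ fun F hF => h _ ?_
    have hc : ∀ q, ((consAt p a F q).map s).sum = (if p = q then s a else 0) + ((F q).map s).sum := by
      intro q
      by_cases hq : p = q <;> simp [consAt, hq]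
    simp only [hc, Finset.sum_add_distrib, hF, Finset.sum_ite_eq, Finset.mem_univ, if_true,
      List.map_cons, List.sum_cons]

variable (k) in
/-- The homogeneous component of degree `n` of `kT`. -/
def gradeKT (n : ℕ) : Submodule k (KT k) := Finsupp.supported k k {t : RTree | t.size = n + 1}

theorem glTree_mem_gradeKT (t t' : RTree) (m n : ℕ) (ht : t.size = m + 1) (ht' : t'.size = n + 1) :
    glTree k t t' ∈ gradeKT k (m + n) := by
  classical
  rw [glTree_eq, graftSum, map_allSum]
  refine allSum_mem (gradeKT k (m + n)).toAddSubmonoid PTree.size _ _ fun F hF => ?_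
  refine Finsupp.single_mem_supported k (1 : k) ?_ |> fun h => by rw [bPlus_forest]; exact h
  rw [PTree.ofList_children, Set.mem_ofPred_eq, RTree.size_ofPlanar, PTree.size_graft, hF]
  rw [← RTree.ofPlanar_toPlanar t, RTree.size_ofPlanar, ← PTree.size_children] at ht
  rw [← RTree.ofPlanar_toPlanar t', RTree.size_ofPlanar] at ht'
  omega

theorem mul_mem_gradeKT {m n : ℕ} {x y : KT k} (hx : x ∈ gradeKT k m) (hy : y ∈ gradeKT k n) :
    (opsKT k).mul x y ∈ gradeKT k (m + n) := by
  rw [gradeKT, Finsupp.supported_eq_span_single] at hx hy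
  induction hx using Submodule.span_induction with
  | zero => simp
  | add x x' _ _ hx hx' => rw [map_add, LinearMap.add_apply]; exact add_mem hx hx'
  | smul c x _ hx => rw [map_smul, LinearMap.smul_apply]; exact Submodule.smul_mem _ _ hx
  | mem x hx =>
    obtain ⟨t, ht, rfl⟩ := hx
    induction hy using Submodule.span_induction with
    | zero => simp
    | add x x' _ _ hx hx' => rw [map_add]; exact add_mem hx hx'
    | smul c x _ hx => rw [map_smul]; exact Submodule.smul_mem _ _ hx
    | mem y hy =>
      obtain ⟨t', ht', rfl⟩ := hy
      have h := opsKT_mul_single (k := k) t.toPlanar t'.toPlanar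
      rw [RTree.ofPlanar_toPlanar, RTree.ofPlanar_toPlanar] at h
      dsimp only
      rw [h]
      exact glTree_mem_gradeKT t t' m n ht ht'

theorem bullet_mem_gradeKT : (opsKT k).one ∈ gradeKT k 0 := by
  refine Finsupp.single_mem_supported k (1 : k) ?_
  rw [Set.mem_ofPred_eq, RTree.bullet, RTree.size_ofPlanar, size_ladder]

theorem kappa_mem_gradeKT (n : ℕ) : kappa k n ∈ gradeKT k n := by
  rw [gradeKT, Finsupp.mem_supported']
  intro t ht
  exact (kappa_apply n t).trans (if_neg ht)

theorem eps_mem_gradeKT (n : ℕ) : eps k n ∈ gradeKT k n := by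
  induction n using Nat.strong_induction_on with
  | _ n ih =>
    cases n with
    | zero =>
      rw [eps]
      exact bullet_mem_gradeKT
    | succ n =>
      rw [eps]
      refine Submodule.sum_mem _ fun j _ => Submodule.smul_mem _ _ ?_
      have h := mul_mem_gradeKT (kappa_mem_gradeKT (k := k) (j + 1)) (ih (n - j) (by omega))
      rwa [show (j : ℕ) + 1 + (n - j) = n + 1 by omega] at h

theorem ZMap_word_mem_gradeKT (I : List ℕ+) : ZMap k (word k I) ∈ gradeKT k (I.map PNat.val).sum := by
  induction I with
  | nil =>
    rw [word_nil, ZMap_one]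
    exact bullet_mem_gradeKT
  | cons n I ih =>
    rw [word_cons, ZMap_ι_mul, List.map_cons, List.sum_cons]
    exact mul_mem_gradeKT (eps_mem_gradeKT _) ih

/-- `Z` preserves degrees, so a forest pairs nontrivially with only finitely many words, and its
image is a finite combination of the `M_I`. -/
theorem exists_ZDual : ∃ g : HK k →ₗ[k] QSymF k, ∀ w u, pairNQ k w (g u) = pairKT k (ZMap k w) u := by
  classical
  have hspan : Submodule.span k (Set.range (forest k)) = ⊤ := by
    rw [eq_top_iff, ← (MvPolynomial.basisMonomials RTree k).span_eq, Submodule.span_le]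
    rintro _ ⟨s, rfl⟩
    exact Submodule.subset_span ⟨_, (monomial_eq_forest s).symm⟩
  refine exists_adjoint (p := pairNQ k) separatingRight_pairNQ (fun w => pairKT k (ZMap k w))
    (Set.range (forest k)) hspan ?_
  rintro _ ⟨L, rfl⟩
  have hfin : {I : List ℕ+ | pairKT k (ZMap k (word k I)) (forest k L) ≠ 0}.Finite := by
    refine (finite_sum_le (L.map PTree.size).sum).subset fun I hI => ?_
    by_contra h
    refine hI ?_
    have h1 := pairKT_forest_children (ZMap k (word k I)) (PTree.ofList L)
    rw [PTree.children_ofList] at h1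
    rw [h1, (Finsupp.mem_supported' k _).1 (ZMap_word_mem_gradeKT I), mul_zero]
    intro h2
    rw [Set.mem_ofPred_eq, RTree.size_ofPlanar, PTree.size_ofList] at h2
    exact h (by rw [Set.mem_ofPred_eq]; omega)
  let y : QSymF k := ∑ I ∈ hfin.toFinset, pairKT k (ZMap k (word k I)) (forest k L) • monoQSym k I
  refine ⟨y, LinearMap.congr_fun (f := (pairNQ k).flip y)
    (g := (pairKT k).flip (forest k L) ∘ₗ ZMap k) (linearMap_ext_word fun J => ?_)⟩
  rw [LinearMap.flip_apply, LinearMap.comp_apply, LinearMap.flip_apply, map_sum]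
  simp only [map_smul, pairNQ_word_monoQSym, smul_eq_mul, mul_ite, mul_one, mul_zero,
    Finset.sum_ite_eq]
  by_cases hJ : pairKT k (ZMap k (word k J)) (forest k L) = 0
  · rw [hJ, ite_self]
  · rw [if_pos (hfin.mem_toFinset.2 hJ)]

/-! ### `φ* Z = τ` -/

theorem comul_tauHom_genE (n : ℕ) : (opsSym k).comul (tauHom k (genE k n)) =
    ∑ p ∈ Finset.HasAntidiagonal.antidiagonal n,
      tauHom k (genE k p.1) ⊗ₜ[k] tauHom k (genE k p.2) := by
  have h := isHopfHom_tauHom.map_comul (genE k n)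
  rw [comul_genE, map_sum] at h
  exact h

/-- For `i ≥ 1`, `e_m` is `m_(1^m)` and the dual of `e_i` is `m_(i)`, which agree only for `m = i =
1`. The next lemma finds the same values on the side of trees. -/
theorem symForm_tauHom_genE_elemSym (i : ℕ) (m : ℕ+) :
    symForm k (tauHom k (genE k i)) (elemSym k m) = if m = 1 ∧ i = 1 then 1 else 0 := by
  cases i with
  | zero =>
    have h := symForm_elemSymProd_monoSym (k := k) 0 (Multiset.replicate m 1)
    rw [genE, map_one, elemSym]
    refine h.trans ?_
    rw [if_neg, if_neg (by simp)]
    intro h0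
    have := congrArg Multiset.card h0
    rw [Multiset.card_zero, Multiset.card_replicate] at this
    exact m.ne_zero this.symm
  | succ i =>
    have h := symForm_elemSymProd_monoSym (k := k) {i.succPNat} (Multiset.replicate m 1)
    rw [elemSymProd, Multiset.map_singleton, Multiset.prod_singleton] at h
    rw [genE, tauHom_ι]
    refine h.trans (if_congr ?_ rfl rfl)
    constructor
    · intro h0
      have h1 := congrArg Multiset.card h0
      rw [Multiset.card_singleton, Multiset.card_replicate] at h1
      have hm : m = 1 := PNat.eq h1.symm
      subst hm
      have h2 : i.succPNat = 1 := by simpa using h0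
      exact ⟨rfl, by simpa using congrArg PNat.val h2⟩
    · rintro ⟨rfl, h1⟩
      obtain rfl : i = 0 := by omega
      rfl

theorem epsChar_phiHom_elemSym (i : ℕ) (m : ℕ+) :
    (epsChar k (phiHom k (elemSym k m))).coeff i = if m = 1 ∧ i = 1 then 1 else 0 := by
  classical
  rw [phiHom_elemSym, epsChar, MvPolynomial.aeval_X]
  have h : RTree.ofPlanar (PTree.ladder m.natPred) = RTree.bullet ↔ m = 1 :=
    ofPlanar_ladder_injective.eq_iff (a := m) (b := 1)
  by_cases hm : m = 1
  · rw [if_pos (h.2 hm), Polynomial.coeff_X]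
    simp [hm, eq_comm]
  · rw [if_neg fun h' => hm (h.1 h')]
    simp [hm]

variable [CharZero k]

/-- In `f`, both sides expand a product over the antidiagonal of `n`: on the left as coefficients of
a homomorphism to polynomials, on the right because the `e_n` are divided powers and `Sym` is
self-dual. So the values on the `e_m` decide. -/
theorem pairKT_eps_phiHom (n : ℕ) (f : SymF k) :
    pairKT k (eps k n) (phiHom k f) = symForm k (tauHom k (genE k n)) f := by
  have key : ∀ (p : Multiset ℕ+) (n : ℕ), (epsChar k (phiHom k (elemSymProd k p))).coeff n =
      symForm k (tauHom k (genE k n)) (elemSymProd k p) := by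
    intro p
    induction p using Multiset.induction with
    | empty =>
      intro n
      have h := isDualPair_symForm.one_right (tauHom k (genE k n))
      have h' := isHopfHom_tauHom.map_counit (genE k n)
      rw [counit_genE] at h'
      refine Eq.trans ?_ (h.trans h').symm
      rw [elemSymProd, Multiset.map_zero, Multiset.prod_zero, map_one, map_one, Polynomial.coeff_one]
    | cons m p ih =>
      intro n
      have hp : elemSymProd k (m ::ₘ p) = elemSym k m * elemSymProd k p := by
        rw [elemSymProd, Multiset.map_cons, Multiset.prod_cons, elemSymProd]
      have h := isDualPair_symForm.mul_right (tauHom k (genE k n)) (elemSym k m) (elemSymProd k p)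
      rw [comul_tauHom_genE, map_sum, LinearMap.sum_apply] at h
      rw [hp, map_mul, map_mul, Polynomial.coeff_mul]
      refine Eq.trans ?_ h.symm
      refine Finset.sum_congr rfl fun p _ => ?_
      rw [tensorPairing_tmul, ih, epsChar_phiHom_elemSym, symForm_tauHom_genE_elemSym]
  have : pairKT k (eps k n) ∘ₗ (phiHom k).toLinearMap = symForm k (tauHom k (genE k n)) :=
    (elemBasis k).ext fun p => by
      rw [elemBasis_apply, LinearMap.comp_apply, AlgHom.toLinearMap_apply, pairKT_eps, key]
  exact LinearMap.congr_fun this f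

end Duals

/-! ## The hexagon -/

section Hexagon

variable {k : Type*} [Field k]

theorem IsAlgHom.freeAlgebra_ext {X B : Type*} [AddCommGroup B] [Module k B] {opB : HopfOps k B}
    {ε : FreeAlgebra k X →ₗ[k] k} {Δ : FreeAlgebra k X →ₗ[k] FreeAlgebra k X ⊗[k] FreeAlgebra k X}
    {f g : FreeAlgebra k X →ₗ[k] B} (hf : IsAlgHom (HopfOps.ofAlgebra ε Δ) opB f)
    (hg : IsAlgHom (HopfOps.ofAlgebra ε Δ) opB g)
    (h : ∀ x, f (FreeAlgebra.ι k x) = g (FreeAlgebra.ι k x)) : f = g := by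
  have hf1 : f 1 = opB.one := hf.map_one
  have hg1 : g 1 = opB.one := hg.map_one
  have hfm : ∀ a b, f (a * b) = opB.mul (f a) (f b) := hf.map_mul
  have hgm : ∀ a b, g (a * b) = opB.mul (g a) (g b) := hg.map_mul
  refine linearMap_ext_word fun L => ?_
  induction L with
  | nil => rw [word_nil, hf1, hg1]
  | cons x L ih => rw [word_cons, hfm, hgm, ih, h]

theorem IsAlgHom.sym_ext {B : Type*} [AddCommGroup B] [Module k B] {opB : HopfOps k B}
    {f g : SymF k →ₗ[k] B} (hf : IsAlgHom (opsSym k) opB f) (hg : IsAlgHom (opsSym k) opB g)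
    (h : ∀ n, f (elemSym k n) = g (elemSym k n)) : f = g := by
  have hτ := (isHopfHom_tauHom (k := k)).toIsAlgHom
  have hcomp : ∀ f : SymF k →ₗ[k] B, IsAlgHom (opsSym k) opB f →
      IsAlgHom (opsNSym k) opB (f ∘ₗ (tauHom k).toLinearMap) := fun f hf =>
    ⟨by rw [LinearMap.comp_apply, hτ.map_one, hf.map_one], fun a b => by
      simp only [LinearMap.comp_apply, hτ.map_mul, hf.map_mul]⟩
  have := (hcomp f hf).freeAlgebra_ext (hcomp g hg) fun n => by
    rw [LinearMap.comp_apply, LinearMap.comp_apply, AlgHom.toLinearMap_apply, tauHom_ι, h]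
  refine LinearMap.ext fun x => ?_
  obtain ⟨w, rfl⟩ := tauHom_surjective x
  exact LinearMap.congr_fun this w

namespace HexagonMaps.IsHexagon

variable {H : HexagonMaps k}

theorem form_eq (hH : H.IsHexagon) : H.form = symForm k := symForm_unique hH.form_elem_mono

theorem Phi_eq (hH : H.IsHexagon) : H.Phi = (PhiHom k).toLinearMap :=
  hH.Phi_hom.freeAlgebra_ext isHopfHom_PhiHom.toIsAlgHom fun n =>
    (hH.Phi_E n).trans (PhiHom_ι n).symm

theorem rho_eq (hH : H.IsHexagon) : H.rho = (rhoHom k).toLinearMap :=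
  hH.rho_hom.freeAlgebra_ext isHopfHom_rhoHom.toIsAlgHom fun T =>
    (hH.rho_tree T).trans (rhoHom_ι T).symm

theorem tau_eq (hH : H.IsHexagon) : H.tau = (tauHom k).toLinearMap :=
  hH.tau_hom.freeAlgebra_ext isHopfHom_tauHom.toIsAlgHom fun n =>
    (hH.tau_E n).trans (tauHom_ι n).symm

theorem phi_eq (hH : H.IsHexagon) : H.phi = (phiHom k).toLinearMap :=
  hH.phi_hom.sym_ext isHopfHom_phiHom.toIsAlgHom fun n =>
    (hH.phi_e n).trans (phiHom_elemSym n).symm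

theorem symForm_phiDual (hH : H.IsHexagon) (f : SymF k) (x : KT k) :
    symForm k f (H.phiDual x) = pairKT k x (H.phi f) := by
  rw [symForm_comm, ← hH.form_eq, hH.phiDual_adj]

theorem rho_comp_Phi (hH : H.IsHexagon) : H.rho ∘ₗ H.Phi = H.phi ∘ₗ H.tau := by
  rw [hH.rho_eq, hH.Phi_eq, hH.phi_eq, hH.tau_eq]
  exact LinearMap.ext fun w => (phiHom_tauHom w).symm

/-- This is the adjoint of the identity `ρΦ = φτ`. -/
theorem PhiDual_comp_rhoDual (hH : H.IsHexagon) :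
    H.PhiDual ∘ₗ H.rhoDual = H.tauDual ∘ₗ H.phiDual := by
  refine adjoint_unique (p := pairNQ k) separatingRight_pairNQ fun w x => ?_
  have h : H.rho (H.Phi w) = H.phi (H.tau w) := LinearMap.congr_fun hH.rho_comp_Phi w
  rw [LinearMap.comp_apply, LinearMap.comp_apply, hH.PhiDual_adj, hH.rhoDual_adj, hH.tauDual_adj,
    hH.form_eq, hH.symForm_phiDual, h]

variable [CharZero k]

theorem Z_eq (hH : H.IsHexagon) : H.Z = ZMap k :=
  hH.Z_hom.freeAlgebra_ext isHopfHom_ZMap.toIsAlgHom fun n => (hH.Z_E n).trans (ZMap_ι n).symm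

theorem ext_maps {H' : HexagonMaps k} (hH : H.IsHexagon) (hH' : H'.IsHexagon) : H = H' := by
  refine HexagonMaps.ext (hH.form_eq.trans hH'.form_eq.symm) (hH.Phi_eq.trans hH'.Phi_eq.symm)
    (hH.rho_eq.trans hH'.rho_eq.symm) (hH.tau_eq.trans hH'.tau_eq.symm)
    (hH.phi_eq.trans hH'.phi_eq.symm) (hH.Z_eq.trans hH'.Z_eq.symm) ?_ ?_ ?_ ?_ ?_
  · refine adjoint_unique (p := pairNQ k) separatingRight_pairNQ fun w x => ?_
    rw [hH.PhiDual_adj, hH'.PhiDual_adj, hH.Phi_eq, hH'.Phi_eq]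
  · refine adjoint_unique (p := (pairKP k).flip)
      (LinearMap.flip_separatingRight.2 separatingLeft_pairKP) fun u x => ?_
    rw [LinearMap.flip_apply, LinearMap.flip_apply, hH.rhoDual_adj, hH'.rhoDual_adj, hH.rho_eq,
      hH'.rho_eq]
  · refine adjoint_unique (p := pairNQ k) separatingRight_pairNQ fun w x => ?_
    rw [hH.tauDual_adj, hH'.tauDual_adj, hH.tau_eq, hH'.tau_eq, hH.form_eq, hH'.form_eq]
  · refine adjoint_unique (p := symForm k) separatingRight_symForm fun f x => ?_
    rw [symForm_comm, symForm_comm f]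
    conv_lhs => rw [← hH.form_eq]
    conv_rhs => rw [← hH'.form_eq]
    rw [hH.phiDual_adj, hH'.phiDual_adj, hH.phi_eq, hH'.phi_eq]
  · refine adjoint_unique (p := pairNQ k) separatingRight_pairNQ fun w x => ?_
    rw [hH.ZDual_adj, hH'.ZDual_adj, hH.Z_eq, hH'.Z_eq]

theorem areHopfHoms (hH : H.IsHexagon) : H.AreHopfHoms := by
  have hPhi : IsHopfHom (opsNSym k) (opsHF k) H.Phi := hH.Phi_eq ▸ isHopfHom_PhiHom
  have hrho : IsHopfHom (opsHF k) (opsHK k) H.rho := hH.rho_eq ▸ isHopfHom_rhoHom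
  have htau : IsHopfHom (opsNSym k) (opsSym k) H.tau := hH.tau_eq ▸ isHopfHom_tauHom
  have hphi : IsHopfHom (opsSym k) (opsHK k) H.phi := hH.phi_eq ▸ isHopfHom_phiHom
  have hZ : IsHopfHom (opsNSym k) (opsKT k) H.Z := hH.Z_eq ▸ isHopfHom_ZMap
  -- The tree pairings have `kP` and `kT` on the left, hence the flips where `H_F` or `H_K` is the
  -- source or target of the map being dualized.
  refine ⟨hPhi, hrho, htau, hphi, hZ, ?_, ?_, ?_, ?_, ?_⟩
  · exact hPhi.adjoint (p := pairNQ k) (q := (pairKP k).flip) isDualPair_pairNQ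
      isDualPair_pairKP.flip separatingRight_pairNQ hH.PhiDual_adj
  · exact hrho.adjoint (p := (pairKP k).flip) (q := (pairKT k).flip) isDualPair_pairKP.flip
      isDualPair_pairKT.flip (LinearMap.flip_separatingRight.2 separatingLeft_pairKP)
      hH.rhoDual_adj
  · refine htau.adjoint (p := pairNQ k) (q := symForm k) isDualPair_pairNQ isDualPair_symForm
      separatingRight_pairNQ fun w f => ?_
    rw [hH.tauDual_adj, hH.form_eq]
  · exact hphi.adjoint (p := symForm k) (q := (pairKT k).flip) isDualPair_symForm
      isDualPair_pairKT.flip separatingRight_symForm hH.symForm_phiDual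
  · exact hZ.adjoint (p := pairNQ k) (q := pairKT k) isDualPair_pairNQ isDualPair_pairKT
      separatingRight_pairNQ hH.ZDual_adj

/-- Both sides are homomorphisms of algebras on `NSym`, so it suffices to pair their values on `E_n`
with all of `Sym`. -/
theorem phiDual_comp_Z (hH : H.IsHexagon) : H.phiDual ∘ₗ H.Z = H.tau := by
  have h := hH.areHopfHoms
  have hcomp := h.phiDual.comp h.Z
  refine hcomp.toIsAlgHom.freeAlgebra_ext h.tau.toIsAlgHom fun n => ?_
  refine sub_eq_zero.1 (separatingRight_symForm _ fun f => ?_)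
  rw [map_sub, sub_eq_zero, LinearMap.comp_apply, hH.symForm_phiDual, hH.Z_E, hH.phi_eq,
    AlgHom.toLinearMap_apply, pairKT_eps_phiHom, symForm_comm, genE_coe, hH.tau_eq,
    AlgHom.toLinearMap_apply]

/-- This is the adjoint of the identity `φ*Z = τ`. -/
theorem ZDual_comp_phi (hH : H.IsHexagon) : H.ZDual ∘ₗ H.phi = H.tauDual := by
  refine adjoint_unique (p := pairNQ k) separatingRight_pairNQ fun w f => ?_
  have h : H.phiDual (H.Z w) = H.tau w := LinearMap.congr_fun hH.phiDual_comp_Z w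
  rw [LinearMap.comp_apply, hH.ZDual_adj, ← hH.phiDual_adj, h, hH.tauDual_adj]

end HexagonMaps.IsHexagon

theorem exists_isHexagon [CharZero k] : ∃ H : HexagonMaps k, H.IsHexagon := by
  obtain ⟨g₁, h₁⟩ := exists_PhiDual (k := k)
  obtain ⟨g₂, h₂⟩ := exists_rhoDual (k := k)
  obtain ⟨g₃, h₃⟩ := exists_phiDual (k := k)
  obtain ⟨g₄, h₄⟩ := exists_ZDual (k := k)
  exact ⟨{
    form := symForm k
    Phi := (PhiHom k).toLinearMap
    rho := (rhoHom k).toLinearMap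
    tau := (tauHom k).toLinearMap
    phi := (phiHom k).toLinearMap
    Z := ZMap k
    PhiDual := g₁
    rhoDual := g₂
    tauDual := (symToQSym k).toLinearMap
    phiDual := g₃
    ZDual := g₄ }, {
    form_elem_mono := symForm_elemSymProd_monoSym
    Phi_hom := isHopfHom_PhiHom.toIsAlgHom
    Phi_E := PhiHom_ι
    rho_hom := isHopfHom_rhoHom.toIsAlgHom
    rho_tree := rhoHom_ι
    tau_hom := isHopfHom_tauHom.toIsAlgHom
    tau_E := tauHom_ι
    phi_hom := isHopfHom_phiHom.toIsAlgHom
    phi_e := phiHom_elemSym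
    Z_hom := isHopfHom_ZMap.toIsAlgHom
    Z_E := ZMap_ι
    PhiDual_adj := h₁
    rhoDual_adj := h₂
    tauDual_adj := symForm_tauHom_toLinearMap
    phiDual_adj := fun f x => (symForm_comm _ _).trans (h₃ f x)
    ZDual_adj := h₄ }⟩

end Hexagon

end CommHexagon

end

theorem mainTheorem1 (k : Type*) [Field k] [CharZero k] :
    (∃! H : CommHexagon.HexagonMaps k, H.IsHexagon) ∧
    ∀ H : CommHexagon.HexagonMaps k, H.IsHexagon →
      H.AreHopfHoms ∧
      H.rho ∘ₗ H.Phi = H.phi ∘ₗ H.tau ∧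
      H.PhiDual ∘ₗ H.rhoDual = H.tauDual ∘ₗ H.phiDual ∧
      H.phiDual ∘ₗ H.Z = H.tau ∧
      H.ZDual ∘ₗ H.phi = H.tauDual ∧
      H.ZDual ∘ₗ H.rho ∘ₗ H.Phi = H.PhiDual ∘ₗ H.rhoDual ∘ₗ H.Z := by
  obtain ⟨H₀, h₀⟩ := CommHexagon.exists_isHexagon (k := k)
  refine ⟨⟨H₀, h₀, fun H hH => hH.ext_maps h₀⟩, fun H hH => ⟨hH.areHopfHoms, hH.rho_comp_Phi,
    hH.PhiDual_comp_rhoDual, hH.phiDual_comp_Z, hH.ZDual_comp_phi, ?_⟩⟩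
  -- Both composites around the hexagon equal `τ*τ`.
  rw [hH.rho_comp_Phi, ← LinearMap.comp_assoc, hH.ZDual_comp_phi, ← LinearMap.comp_assoc,
    hH.PhiDual_comp_rhoDual, LinearMap.comp_assoc, hH.phiDual_comp_Z]
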